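/- Let $G=(V,E)$ be a finite simple undirected graph with $n$ vertices, $m$ edges and maximum degree $\Delta$. A partial $(\Delta+1)$-edge coloring is a map $\chi:E\to\{1,\dots,\Delta+1\}\cup\{\bot\}$ such that any two distinct edges sharing an endpoint that both receive colors (values $\ne\bot$) receive different ones; edges with $\chi(e)=\bot$ are uncolored, and $\mathsf{miss}_\chi(x)$ is the set of colors not used by $\chi$ on any edge at $x$. A u-fan with respect to $\chi$ is a tuple $\mathbf f=(u,v,w,\alpha,\beta)$ of distinct vertices $u,v,w$ and distinct colors $\alpha,\beta$ such that $(u,v)$ and $(u,w)$ are uncolored edges of $G$, $\alpha\in\mathsf{miss}_\chi(u)$ and $\beta\in\mathsf{miss}_\chi(v)\cap\mathsf{miss}_\chi(w)$. It assigns $c_{\mathbf f}(u)=\alpha$ and $c_{\mathbf f}(v)=c_{\mathbf f}(w)=\beta$. A collection of u-fans is separable if its members are pairwise edge-disjoint and, for every vertex $x$, the colors $c_{\mathbf f}(x)$ over the members $\mathbf f$ containing $x$ are pairwise distinct. **Lemma.** There are a deterministic algorithm and absolute constants $c>0$ and $C$ such that the following holds. Given any such $G$ (as a list of its edges), a partial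 $(\Delta+1)$-edge coloring $\chi$ of $G$, and a set $U$ of $\lambda$ edges that are uncolored under $\chi$, the algorithm runs for at most $C\,(m+\Delta\lambda+1)$ steps on a word RAM with words of $O(\log(n+2))$ bits and memory that is zero outside the input. It outputs a partial $(\Delta+1)$-edge coloring $\chi'$ of $G$, reports which of the following two outcomes it has reached, and that outcome holds: 1. it has extended the coloring to at least $c\lambda$ uncolored edges: at least $c\lambda$ edges of $U$ are colored under $\chi'$, and the number of uncolored edges under $\chi'$ is smaller than the number under $\chi$ by at least $c\lambda$; or 2. $\chi'$ has at most as many uncolored edges as $\chi$, and the algorithm also outputs a separable collection (with respect to $\chi'$) of at least $c\lambda$ u-fans. -/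

import Mathlib

/-! ## Partial edge colorings, u-fans, separable collections -/

namespace EdgeColoring

/-- An assignment of a color in a set of `k` colors, or of `none` (playing the role of `⊥`,
"uncolored"), to every edge of `G`. -/
abbrev PartialLabeling {V : Type} (G : SimpleGraph V) (k : ℕ) : Type :=
  G.EdgeLabeling (Option (Fin k))

variable {V : Type} {G : SimpleGraph V} {k : ℕ}

/-- `χ` is a partial `k`-edge coloring: distinct edges that share an endpoint never carry the
same color. -/
def IsPartialColoring (χ : PartialLabeling G k) : Prop :=
  ∀ e f : G.edgeSet, e ≠ f → (∃ x : V, x ∈ e.1 ∧ x ∈ f.1) →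
    ∀ c : Fin k, χ e = some c → χ f ≠ some c

/-- The set of uncolored edges. -/
def uncolored (χ : PartialLabeling G k) : Set G.edgeSet :=
  {e | χ e = none}

/-- The palette of `x`: the colors that are not assigned to any edge incident on `x`. -/
def missing (χ : PartialLabeling G k) (x : V) : Set (Fin k) :=
  {c | ∀ e : G.edgeSet, x ∈ e.1 → χ e ≠ some c}

/-- A tuple `(u, v, w, α, β)` of vertices and colors. -/
structure FanTuple (V : Type) (k : ℕ) where
  u : V
  v : V
  w : V
  α : Fin k
  β : Fin k

/-- The tuple is a u-fan with respect to `χ`. -/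
structure IsUFan (χ : PartialLabeling G k) (f : FanTuple V k) : Prop where
  u_ne_v : f.u ≠ f.v
  u_ne_w : f.u ≠ f.w
  v_ne_w : f.v ≠ f.w
  α_ne_β : f.α ≠ f.β
  uncolored_uv : ∃ h : G.Adj f.u f.v, χ.get f.u f.v h = none
  uncolored_uw : ∃ h : G.Adj f.u f.w, χ.get f.u f.w h = none
  α_missing : f.α ∈ missing χ f.u
  β_missing_v : f.β ∈ missing χ f.v
  β_missing_w : f.β ∈ missing χ f.w

namespace FanTuple

/-- The two edges of a u-fan. -/
def edges (f : FanTuple V k) : Set (Sym2 V) :=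
  {s(f.u, f.v), s(f.u, f.w)}

/-- The vertices of a u-fan. -/
def verts (f : FanTuple V k) : Set V :=
  {f.u, f.v, f.w}

open Classical in
/-- The color that a u-fan assigns to one of its vertices: `α` to the center and `β` to the two
leaves (only used at vertices of the fan). -/
noncomputable def assigned (f : FanTuple V k) (x : V) : Fin k :=
  if x = f.u then f.α else f.β

end FanTuple

/-- The indexed family `F` of tuples is a separable collection of u-fans with respect to `χ`:
every member is a u-fan, distinct members are edge-disjoint, and at every vertex the colors
assigned by the distinct members that contain it are distinct. (Edge-disjointness makes the
family injective, so a family indexed by `ι` is a collection of `|ι|` u-fans.) -/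
structure IsSeparable {ι : Type} (χ : PartialLabeling G k) (F : ι → FanTuple V k) : Prop where
  isUFan : ∀ i, IsUFan χ (F i)
  edge_disjoint : ∀ i j, i ≠ j → Disjoint (F i).edges (F j).edges
  colors_distinct : ∀ i j, i ≠ j → ∀ x, x ∈ (F i).verts → x ∈ (F j).verts →
    (F i).assigned x ≠ (F j).assigned x

/-- A listing of the edges of `G`, every edge exactly once, in an arbitrary order and with
arbitrarily oriented endpoints. In particular `m` is the number of edges. -/
structure EdgeList (G : SimpleGraph V) (m : ℕ) where
  edge : Fin m ≃ G.edgeSet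
  src : Fin m → V
  tgt : Fin m → V
  edge_eq : ∀ i, (edge i).1 = s(src i, tgt i)

end EdgeColoring

/-! ## A deterministic word RAM with a step count

Memory consists of word-valued registers and word-addressed arrays. A program is a fixed finite
piece of syntax, so it names only finitely many registers and arrays. All operations are on
natural numbers smaller than the word bound `W`; there is no derivation for a run that would ever
produce a value `≥ W`. -/

namespace WordRAM

/-- Memory: register `x` holds `reg x`, cell `i` of array `a` holds `arr a i`. -/
structure State where
  reg : ℕ → ℕ
  arr : ℕ → ℕ → ℕ

/-- Write a register. -/
def State.setReg (s : State) (x v : ℕ) : State :=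
  { s with reg := Function.update s.reg x v }

/-- Write an array cell. -/
def State.setArr (s : State) (a i v : ℕ) : State :=
  { s with arr := Function.update s.arr a (Function.update (s.arr a) i v) }

/-- The word operations; comparisons return `1` or `0`. -/
inductive Op where
  | add | sub | mul | div | mod | lt | eq

/-- Semantics of the word operations (subtraction is truncated, division by zero gives zero). -/
def Op.eval : Op → ℕ → ℕ → ℕ
  | .add, a, b => a + b
  | .sub, a, b => a - b
  | .mul, a, b => a * b
  | .div, a, b => a / b
  | .mod, a, b => a % b
  | .lt, a, b => if a < b then 1 else 0
  | .eq, a, b => if a = b then 1 else 0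

/-- Expressions: constants, registers, array reads, and word operations. -/
inductive Expr where
  | lit (v : ℕ)
  | reg (x : ℕ)
  | get (a : ℕ) (i : Expr)
  | op (o : Op) (e₁ e₂ : Expr)

/-- The value of an expression. -/
def Expr.eval (s : State) : Expr → ℕ
  | .lit v => v
  | .reg x => s.reg x
  | .get a i => s.arr a (i.eval s)
  | .op o e₁ e₂ => o.eval (e₁.eval s) (e₂.eval s)

/-- All values that occur in evaluating the expression, addresses included, are words. -/
def Expr.Fits (W : ℕ) (s : State) : Expr → Prop
  | .lit v => v < W
  | .reg x => s.reg x < W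
  | .get a i => i.Fits W s ∧ s.arr a (i.eval s) < W
  | .op o e₁ e₂ => e₁.Fits W s ∧ e₂.Fits W s ∧ o.eval (e₁.eval s) (e₂.eval s) < W

/-- Evaluation takes one step for every constant, register access, array access and operation. -/
def Expr.cost : Expr → ℕ
  | .lit _ => 1
  | .reg _ => 1
  | .get _ i => i.cost + 1
  | .op _ e₁ e₂ => e₁.cost + e₂.cost + 1

/-- Programs. -/
inductive Prog where
  | skip
  | assign (x : ℕ) (e : Expr)
  | store (a : ℕ) (i e : Expr)
  | seq (p q : Prog)
  | ite (b : Expr) (p q : Prog)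
  | while (b : Expr) (p : Prog)

/-- `Exec W p s t s'`: started in memory `s` on a machine with word bound `W`, the program `p`
halts after exactly `t` steps, with memory `s'`. A test succeeds if its value is nonzero. For
given `W`, `p`, `s` at most one rule applies at every point of the run, so there is at most one
such pair `(t, s')`. -/
inductive Exec (W : ℕ) : Prog → State → ℕ → State → Prop
  | skip (s : State) : Exec W .skip s 1 s
  | assign (s : State) (x : ℕ) (e : Expr) :
      e.Fits W s → Exec W (.assign x e) s (e.cost + 1) (s.setReg x (e.eval s))
  | store (s : State) (a : ℕ) (i e : Expr) :
      i.Fits W s → e.Fits W s →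
      Exec W (.store a i e) s (i.cost + e.cost + 1) (s.setArr a (i.eval s) (e.eval s))
  | seq {s s₁ s₂ : State} {p q : Prog} {t₁ t₂ : ℕ} :
      Exec W p s t₁ s₁ → Exec W q s₁ t₂ s₂ → Exec W (.seq p q) s (t₁ + t₂) s₂
  | ite_true {s s' : State} {b : Expr} {p q : Prog} {t : ℕ} :
      b.Fits W s → b.eval s ≠ 0 → Exec W p s t s' → Exec W (.ite b p q) s (b.cost + 1 + t) s'
  | ite_false {s s' : State} {b : Expr} {p q : Prog} {t : ℕ} :
      b.Fits W s → b.eval s = 0 → Exec W q s t s' → Exec W (.ite b p q) s (b.cost + 1 + t) s'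
  | while_false {s : State} {b : Expr} {p : Prog} :
      b.Fits W s → b.eval s = 0 → Exec W (.while b p) s (b.cost + 1) s
  | while_true {s s₁ s₂ : State} {b : Expr} {p : Prog} {t₁ t₂ : ℕ} :
      b.Fits W s → b.eval s ≠ 0 → Exec W p s t₁ s₁ → Exec W (.while b p) s₁ t₂ s₂ →
      Exec W (.while b p) s (b.cost + 1 + t₁ + t₂) s₂

end WordRAM

/-! ## Input and output conventions -/

namespace EdgeColoring

open WordRAM

/-- Machine code of a label: `0` for "uncolored" and `c + 1` for the color `c`. -/
def labelCode {k : ℕ} : Option (Fin k) → ℕ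
  | none => 0
  | some c => c + 1

/-- The finite sequence `a` written at the beginning of an array that is zero elsewhere. -/
def cells {m : ℕ} (a : Fin m → ℕ) (i : ℕ) : ℕ :=
  if h : i < m then a ⟨i, h⟩ else 0

/-- The initial memory. Registers `0, 1, 2, 3` hold the number `n` of vertices, the number `m` of
edges, the maximum degree `Δ`, and the number `l` of given uncolored edges. Arrays `0` and `1` hold
the endpoints of the edges, array `2` their labels, and array `3` the positions of the given
uncolored edges in the edge list. All other memory is zero. -/
def inputState {n m Δ l : ℕ} {G : SimpleGraph (Fin n)} (L : EdgeList G m)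
    (χ : PartialLabeling G (Δ + 1)) (U : Fin l → Fin m) : State where
  reg
    | 0 => n
    | 1 => m
    | 2 => Δ
    | 3 => l
    | _ => 0
  arr
    | 0 => cells fun i => (L.src i : ℕ)
    | 1 => cells fun i => (L.tgt i : ℕ)
    | 2 => cells fun i => labelCode (χ (L.edge i))
    | 3 => cells fun j => (U j : ℕ)
    | _ => fun _ => 0

/-- Array `2` of the memory holds the labels of `χ`. -/
def HoldsLabeling {n m k : ℕ} {G : SimpleGraph (Fin n)} (s : State) (L : EdgeList G m)
    (χ : PartialLabeling G k) : Prop :=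
  ∀ i : Fin m, s.arr 2 i = labelCode (χ (L.edge i))

/-- Register `1` holds the number of members of the family `F`, and arrays `4, 5, 6, 7, 8` hold
their components `u, v, w, α, β`. -/
def HoldsFans {n k r : ℕ} (s : State) (F : Fin r → FanTuple (Fin n) k) : Prop :=
  s.reg 1 = r ∧ ∀ i : Fin r,
    s.arr 4 i = ((F i).u : ℕ) ∧ s.arr 5 i = ((F i).v : ℕ) ∧ s.arr 6 i = ((F i).w : ℕ) ∧
    s.arr 7 i = labelCode (some (F i).α) ∧ s.arr 8 i = labelCode (some (F i).β)

/-- First outcome: `χ'` extends the coloring `χ` to at least `b` uncolored edges. At least `b` of the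
given uncolored edges have received a color, and in total the number of uncolored edges has dropped
by at least `b` (the position of the remaining uncolored edges may have been shifted). -/
def Extends {n m k l : ℕ} {G : SimpleGraph (Fin n)} (L : EdgeList G m)
    (χ : PartialLabeling G k) (U : Fin l → Fin m) (χ' : PartialLabeling G k) (b : ℝ) : Prop :=
  b ≤ ({j : Fin l | L.edge (U j) ∉ uncolored χ'}.ncard : ℝ) ∧
    ((uncolored χ').ncard : ℝ) + b ≤ ((uncolored χ).ncard : ℝ)

end EdgeColoring

/-! ## A program logic for the word RAM -/

namespace WordRAM

/-! Each of the `λ` given edges gets one round and a claim number. In its round it is a token: an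
uncolored edge `e` between `z` and `x`, with a color `c` missing at `z` and a color `a` missing at
`x`. If `c` is missing at `x` too, then `e` is colored with `c`, a success. Otherwise the edge `f`
at `x` of color `c` gives its color to `e` and becomes the uncolored edge (`Cfg.move`); the token
travels and the number of uncolored edges stays the same.

The route is Vizing's. The token first turns around a fixed vertex `u`, always taking the edge at
`u` whose color is missing at the current leaf. If that edge has been used before, an earlier leaf
misses the same color `β` as the last leaf. With `α` missing at `u`, the token then follows the
alternating `α`-`β` path from `u`. The path can close up only at the last leaf
(`WalkInv.meets_start`). In that case `β` has become missing at `u`, and running the fan backwards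
leads to the earlier leaf, where `β` is missing as well (`WalkInv.unfan`, `UnfanInv.step`).

Paths may be long, so a walk is cut off after `T = 2m/λ + 1` edges (with integer division) and its
token is left pending, as the owner of the trail behind it. The trails of live pending tokens are
disjoint, so fewer than `λ/2` of them can exist. A token that is about to use an edge `f` of such a
trail must not destroy it. Instead the pending token retraces its trail up to `f`. If both tokens
now face `f` from the same vertex, their two uncolored edges form a u-fan (`CollInv.fan`). If they
face it from opposite ends, the pending token steps over `f`, and this frees the color that the
other token needs (`CollInv.gain`).

The colors that a token or u-fan relies on are reserved at their vertices, and every vertex keeps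
one more missing color in stock that nobody has reserved. There is always room: at a vertex, the
used and the reserved colors belong to distinct incident edges, colored or uncolored, and there are
at most `Δ` of these (`exists_fresh`). Since no color at a vertex has two holders, the surviving
u-fans are separable (`Base.isSeparable`). Moves and swaps do not touch the reservations of other
claims. Only coloring an edge can take away a color held by another claim, and by at most one.

After `k` rounds, `k ≤ (live pending) + 2 (valid u-fans) + 5 (successes)`: `Busy.complete`,
`Busy.pending` and `Busy.makeFan` show that every way to end a round pays for it. With `k = λ` and
fewer than `λ/2` live pending tokens, there are at least `λ/16` successes or at least `λ/16` valid
u-fans (`Base.many_valid`).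

Every step is a table lookup, and a round costs `O(Δ + T)`, hence `O(m + Δλ)` in total including the
linear initialization (`time_le`). No computation overflows a word, because contents are polynomial
in `n` and expressions have bounded size (`Expr.fits`). -/

/-- All memory contents are at most `B`. -/
structure State.Bdd (B : ℕ) (s : State) : Prop where
  reg : ∀ x, s.reg x ≤ B
  arr : ∀ a i, s.arr a i ≤ B

/-- The largest constant in an expression. -/
def Expr.maxLit : Expr → ℕ
  | .lit v => v
  | .reg _ => 0
  | .get _ i => i.maxLit
  | .op _ e₁ e₂ => max e₁.maxLit e₂.maxLit

/-- The expression is short and has small constants only. -/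
def Expr.small (e : Expr) : Bool := decide (e.cost ≤ 64) && decide (e.maxLit ≤ 16)

theorem Expr.one_le_cost (e : Expr) : 1 ≤ e.cost := by
  cases e <;> simp [Expr.cost]

/-- Multiplication is the worst case and adds exponents; one extra factor `B ≥ 2` absorbs the sum.
The exponents follow the recursion of `Expr.cost`, so cost doubles as a bound on the size of values.
-/
theorem Op.eval_le {B a b p q : ℕ} (hB : 2 ≤ B) (hp : 1 ≤ p) (hq : 1 ≤ q) (o : Op)
    (ha : a ≤ B ^ p) (hb : b ≤ B ^ q) : o.eval a b ≤ B ^ (p + q + 1) := by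
  have h1 : B ^ p ≤ B ^ (p + q) := Nat.pow_le_pow_right (by omega) (by omega)
  have h2 : B ^ q ≤ B ^ (p + q) := Nat.pow_le_pow_right (by omega) (by omega)
  have h3 : 2 * B ^ (p + q) ≤ B ^ (p + q + 1) := by
    rw [pow_succ, mul_comm]; exact Nat.mul_le_mul_left _ hB
  have h4 : 1 ≤ B ^ (p + q) := Nat.one_le_pow _ _ (by omega)
  have h5 : B ^ p * B ^ q = B ^ (p + q) := (pow_add _ _ _).symm
  cases o <;> simp only [Op.eval]
  · omega
  · omega
  · have := Nat.mul_le_mul ha hb; omega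
  · have := Nat.div_le_self a b; omega
  · have := Nat.mod_le a b; omega
  · split <;> omega
  · split <;> omega

theorem Expr.eval_le {B : ℕ} {s : State} (hB : 2 ≤ B) (hs : s.Bdd B) (e : Expr)
    (he : e.maxLit ≤ B) : e.eval s ≤ B ^ e.cost := by
  induction e with
  | lit v => simp only [Expr.eval, Expr.cost, pow_one]; exact he
  | reg x => simpa [Expr.eval, Expr.cost] using hs.reg x
  | get a i ih =>
    exact (hs.arr a _).trans (Nat.le_self_pow (by simp [Expr.cost]) _)
  | op o e₁ e₂ ih₁ ih₂ =>
    have h := max_le_iff.1 (show max e₁.maxLit e₂.maxLit ≤ B from he)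
    exact Op.eval_le hB e₁.one_le_cost e₂.one_le_cost o (ih₁ h.1) (ih₂ h.2)

theorem Expr.fits_of_bdd {B W : ℕ} {s : State} (hB : 2 ≤ B) (hs : s.Bdd B) (e : Expr)
    (he : e.maxLit ≤ B) (hW : B ^ e.cost < W) : e.Fits W s := by
  induction e with
  | lit v => simp only [Expr.cost, pow_one] at hW; exact lt_of_le_of_lt he hW
  | reg x => simp only [Expr.cost, pow_one] at hW; exact lt_of_le_of_lt (hs.reg x) hW
  | get a i ih =>
    have h1 : B ^ i.cost ≤ B ^ (i.cost + 1) := Nat.pow_le_pow_right (by omega) (by omega)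
    have h2 : B ≤ B ^ (i.cost + 1) := Nat.le_self_pow (by simp) _
    exact ⟨ih he (lt_of_le_of_lt h1 hW), lt_of_le_of_lt ((hs.arr a _).trans h2) hW⟩
  | op o e₁ e₂ ih₁ ih₂ =>
    have h := max_le_iff.1 (show max e₁.maxLit e₂.maxLit ≤ B from he)
    have h1 : B ^ e₁.cost ≤ B ^ (e₁.cost + e₂.cost + 1) :=
      Nat.pow_le_pow_right (by omega) (by omega)
    have h2 : B ^ e₂.cost ≤ B ^ (e₁.cost + e₂.cost + 1) :=
      Nat.pow_le_pow_right (by omega) (by omega)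
    exact ⟨ih₁ h.1 (lt_of_le_of_lt h1 hW), ih₂ h.2 (lt_of_le_of_lt h2 hW),
      lt_of_le_of_lt (Expr.eval_le hB hs (.op o e₁ e₂) he) hW⟩

/-- The word bound `W` leaves enough room above the bound `B` on memory contents. -/
structure Room (B W : ℕ) : Prop where
  big : 16 ≤ B
  lt : B ^ 64 < W

/-- This makes overflow a syntactic matter: smallness of a concrete expression is decided by
evaluation, and all that remains per program is that the values written back are at most `B`. -/
theorem Expr.fits {B W : ℕ} (hr : Room B W) {s : State} (hs : s.Bdd B) {e : Expr}
    (he : e.small = true) : e.Fits W s := by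
  simp only [Expr.small, Bool.and_eq_true, decide_eq_true_eq] at he
  have := hr.big
  refine e.fits_of_bdd (by omega) hs (he.2.trans this) (lt_of_le_of_lt ?_ hr.lt)
  exact Nat.pow_le_pow_right (by omega) he.1

theorem State.Bdd.setReg {B : ℕ} {s : State} (hs : s.Bdd B) {x v : ℕ} (hv : v ≤ B) :
    (s.setReg x v).Bdd B := by
  refine ⟨fun y => ?_, hs.arr⟩
  simp only [State.setReg, Function.update_apply]
  split
  · exact hv
  · exact hs.reg y

theorem State.Bdd.setArr {B : ℕ} {s : State} (hs : s.Bdd B) {a i v : ℕ} (hv : v ≤ B) :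
    (s.setArr a i v).Bdd B := by
  refine ⟨hs.reg, fun b j => ?_⟩
  simp only [State.setArr, Function.update_apply]
  split
  · simp only [Function.update_apply]
    split
    · exact hv
    · exact hs.arr _ _
  · exact hs.arr b j

/-- The program halts within `t` steps in a bounded memory that satisfies `Q`. -/
def Run (B W : ℕ) (p : Prog) (s : State) (t : ℕ) (Q : State → Prop) : Prop :=
  ∃ t' s', t' ≤ t ∧ Exec W p s t' s' ∧ s'.Bdd B ∧ Q s'

/-- Loop-free programs with small expressions. -/
def Prog.flat : Prog → Bool
  | .skip => true
  | .assign _ e => e.small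
  | .store _ i e => i.small && e.small
  | .seq p q => p.flat && q.flat
  | .ite b p q => b.small && (p.flat && q.flat)
  | .while _ _ => false

/-- An upper bound on the running time of a loop-free program. -/
def Prog.time : Prog → ℕ
  | .skip => 1
  | .assign _ e => e.cost + 1
  | .store _ i e => i.cost + e.cost + 1
  | .seq p q => p.time + q.time
  | .ite b p q => b.cost + 1 + (p.time + q.time)
  | .while _ _ => 0

/-- The final memory of a loop-free program. -/
def Prog.final : Prog → State → State
  | .skip, s => s
  | .assign x e, s => s.setReg x (e.eval s)
  | .store a i e, s => s.setArr a (i.eval s) (e.eval s)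
  | .seq p q, s => q.final (p.final s)
  | .ite b p q, s => if b.eval s ≠ 0 then p.final s else q.final s
  | .while _ _, s => s

/-- All values that a loop-free program writes are at most `B`. -/
def Prog.Safe (B : ℕ) : Prog → State → Prop
  | .skip, _ => True
  | .assign _ e, s => e.eval s ≤ B
  | .store _ _ e, s => e.eval s ≤ B
  | .seq p q, s => p.Safe B s ∧ q.Safe B (p.final s)
  | .ite b p q, s => (b.eval s ≠ 0 → p.Safe B s) ∧ (b.eval s = 0 → q.Safe B s)
  | .while _ _, _ => True

/-- Loop-free code is executed symbolically: time and final memory are computed by recursion on the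
program, so that later proofs about a block are simplifications of `Prog.final`. -/
theorem Run.flat {B W : ℕ} (hr : Room B W) {p : Prog} (hp : p.flat = true) {s : State}
    (hs : s.Bdd B) (hsafe : p.Safe B s) : Run B W p s p.time (fun s' => s' = p.final s) := by
  induction p generalizing s with
  | skip => exact ⟨1, s, le_rfl, .skip s, hs, rfl⟩
  | assign x e => exact ⟨_, _, le_rfl, .assign s x e (Expr.fits hr hs hp), hs.setReg hsafe, rfl⟩
  | store a i e =>
    simp only [Prog.flat, Bool.and_eq_true] at hp
    exact ⟨_, _, le_rfl, .store s a i e (Expr.fits hr hs hp.1) (Expr.fits hr hs hp.2),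
      hs.setArr hsafe, rfl⟩
  | seq p q ihp ihq =>
    simp only [Prog.flat, Bool.and_eq_true] at hp
    obtain ⟨t₁, s₁, h₁, e₁, b₁, rfl⟩ := ihp hp.1 hs hsafe.1
    obtain ⟨t₂, s₂, h₂, e₂, b₂, rfl⟩ := ihq hp.2 b₁ hsafe.2
    exact ⟨_, _, Nat.add_le_add h₁ h₂, .seq e₁ e₂, b₂, rfl⟩
  | ite b p q ihp ihq =>
    simp only [Prog.flat, Bool.and_eq_true] at hp
    by_cases hb : b.eval s = 0
    · obtain ⟨t₁, s₁, h₁, e₁, b₁, rfl⟩ := ihq hp.2.2 hs (hsafe.2 hb)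
      refine ⟨_, _, ?_, .ite_false (Expr.fits hr hs hp.1) hb e₁, b₁, by simp [Prog.final, hb]⟩
      simp only [Prog.time]; omega
    · obtain ⟨t₁, s₁, h₁, e₁, b₁, rfl⟩ := ihp hp.2.1 hs (hsafe.1 hb)
      refine ⟨_, _, ?_, .ite_true (Expr.fits hr hs hp.1) hb e₁, b₁, by simp [Prog.final, hb]⟩
      simp only [Prog.time]; omega
  | _ => simp [Prog.flat] at hp

theorem Run.mono {B W : ℕ} {p : Prog} {s : State} {t t' : ℕ} {Q Q' : State → Prop}
    (h : Run B W p s t Q) (ht : t ≤ t') (hQ : ∀ s', s'.Bdd B → Q s' → Q' s') :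
    Run B W p s t' Q' := by
  obtain ⟨t₁, s₁, h₁, e₁, b₁, q₁⟩ := h
  exact ⟨t₁, s₁, h₁.trans ht, e₁, b₁, hQ _ b₁ q₁⟩

theorem Run.flat' {B W : ℕ} (hr : Room B W) {p : Prog} (hp : p.flat = true) {s : State}
    (hs : s.Bdd B) (hsafe : p.Safe B s) {t : ℕ} (ht : p.time ≤ t) {Q : State → Prop}
    (hQ : Q (p.final s)) : Run B W p s t Q :=
  (Run.flat hr hp hs hsafe).mono ht (by rintro _ _ rfl; exact hQ)

theorem Run.seq {B W : ℕ} {p q : Prog} {s : State} {t₁ t₂ t : ℕ} {Q Q' : State → Prop}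
    (hp : Run B W p s t₁ Q') (hq : ∀ s', s'.Bdd B → Q' s' → Run B W q s' t₂ Q)
    (ht : t₁ + t₂ ≤ t) : Run B W (.seq p q) s t Q := by
  obtain ⟨a, s₁, h₁, e₁, b₁, q₁⟩ := hp
  obtain ⟨b, s₂, h₂, e₂, b₂, q₂⟩ := hq s₁ b₁ q₁
  exact ⟨a + b, s₂, by omega, .seq e₁ e₂, b₂, q₂⟩

theorem Run.ite {B W : ℕ} (hr : Room B W) {b : Expr} {p q : Prog} {s : State} {t t₀ : ℕ}
    {Q : State → Prop} (hs : s.Bdd B) (hb : b.small = true)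
    (hp : b.eval s ≠ 0 → Run B W p s t₀ Q) (hq : b.eval s = 0 → Run B W q s t₀ Q)
    (ht : b.cost + 1 + t₀ ≤ t) : Run B W (.ite b p q) s t Q := by
  by_cases h : b.eval s = 0
  · obtain ⟨t₁, s₁, h₁, e₁, b₁, q₁⟩ := hq h
    exact ⟨_, s₁, by omega, .ite_false (Expr.fits hr hs hb) h e₁, b₁, q₁⟩
  · obtain ⟨t₁, s₁, h₁, e₁, b₁, q₁⟩ := hp h
    exact ⟨_, s₁, by omega, .ite_true (Expr.fits hr hs hb) h e₁, b₁, q₁⟩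

/-- A loop whose invariant `I N` carries an upper bound `N` on the number of remaining rounds. -/
theorem Run.while {B W : ℕ} (hr : Room B W) {b : Expr} {p : Prog} {t : ℕ}
    (hb : b.small = true) (I : ℕ → State → Prop)
    (step : ∀ N s, s.Bdd B → I N s → b.eval s ≠ 0 →
      Run B W p s t (fun s' => ∃ M < N, I M s'))
    {N : ℕ} {s : State} (hs : s.Bdd B) (hI : I N s) :
    Run B W (.while b p) s ((N + 1) * (b.cost + 1 + t))
      (fun s' => b.eval s' = 0 ∧ ∃ M, I M s') := by
  induction N using Nat.strong_induction_on generalizing s with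
  | _ N ih =>
    by_cases h : b.eval s = 0
    · refine ⟨_, s, ?_, .while_false (Expr.fits hr hs hb) h, hs, h, N, hI⟩
      nlinarith [Nat.zero_le (N * (b.cost + 1 + t))]
    · obtain ⟨t₁, s₁, h₁, e₁, b₁, M, hM, hI'⟩ := step N s hs hI h
      obtain ⟨t₂, s₂, h₂, e₂, b₂, q₂⟩ := ih M hM b₁ hI'
      refine ⟨_, s₂, ?_, .while_true (Expr.fits hr hs hb) h e₁ e₂, b₂, q₂⟩
      have : (M + 1) * (b.cost + 1 + t) ≤ N * (b.cost + 1 + t) := Nat.mul_le_mul_right _ hM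
      have h3 : (N + 1) * (b.cost + 1 + t) = N * (b.cost + 1 + t) + (b.cost + 1 + t) := by ring
      omega

end WordRAM

/-! ## Configurations with reserved colors, and tokens -/

namespace EdgeColoring

/-- A simple graph on `n` vertices, given by the endpoints of its `m` edges. -/
structure Net (n m : ℕ) where
  src : Fin m → Fin n
  tgt : Fin m → Fin n
  ne : ∀ i, src i ≠ tgt i
  simple : ∀ i j, s(src i, tgt i) = s(src j, tgt j) → i = j

/-- What is recorded about a claim: nothing, a pending token, or a u-fan. -/
inductive Rec (n m K : ℕ) where
  | none
  | pend (z x : Fin n) (a c : Fin K) (e : Fin m)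
  | fan (u v w : Fin n) (α β : Fin K)

/-- A partial coloring `col` with a table `tab` of the edge of each color at each vertex. A
color at a vertex may be reserved (`res`) by a claim with a given number, on behalf of an
uncolored edge; `free` is a missing color that is not reserved; `own` names the claim whose
trail contains the edge. -/
structure Cfg (n m K : ℕ) where
  col : Fin m → Option (Fin K)
  tab : Fin n → Fin K → Option (Fin m)
  res : Fin n → Fin K → Option (ℕ × Fin m)
  free : Fin n → Fin K
  own : Fin m → ℕ
  log : ℕ → Rec n m K

/-- Update of a function of two arguments. -/
def upd {α β γ : Type} [DecidableEq α] [DecidableEq β] (F : α → β → γ) (a : α) (b : β) (v : γ) :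
    α → β → γ :=
  fun a' b' => if a' = a ∧ b' = b then v else F a' b'

section

variable {n m K : ℕ} (N : Net n m)

/-- The endpoints of edge `i` are `x` and `y`. -/
def Net.Ends (i : Fin m) (x y : Fin n) : Prop :=
  (N.src i = x ∧ N.tgt i = y) ∨ (N.src i = y ∧ N.tgt i = x)

/-- Vertex `x` is an endpoint of edge `i`. -/
def Net.Inc (x : Fin n) (i : Fin m) : Prop := N.src i = x ∨ N.tgt i = x

variable {N}

theorem Net.Ends.symm {i : Fin m} {x y : Fin n} (h : N.Ends i x y) : N.Ends i y x := Or.symm h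

theorem Net.Ends.ne {i : Fin m} {x y : Fin n} (h : N.Ends i x y) : x ≠ y := by
  have := N.ne i
  rintro rfl
  rcases h with ⟨h1, h2⟩ | ⟨h1, h2⟩ <;> exact this (h1.trans h2.symm)

theorem Net.Ends.inc_left {i : Fin m} {x y : Fin n} (h : N.Ends i x y) : N.Inc x i :=
  h.imp And.left And.right

theorem Net.Ends.inc_right {i : Fin m} {x y : Fin n} (h : N.Ends i x y) : N.Inc y i :=
  h.symm.inc_left

theorem Net.Ends.inc_iff {i : Fin m} {x y v : Fin n} (h : N.Ends i x y) :
    N.Inc v i ↔ v = x ∨ v = y := by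
  rcases h with ⟨h1, h2⟩ | ⟨h1, h2⟩ <;> simp only [Net.Inc, h1, h2, eq_comm (a := v)]
  exact or_comm

theorem Net.Inc.ends {i : Fin m} {x : Fin n} (h : N.Inc x i) : ∃ y, N.Ends i x y := by
  rcases h with h | h
  · exact ⟨N.tgt i, Or.inl ⟨h, rfl⟩⟩
  · exact ⟨N.src i, Or.inr ⟨rfl, h⟩⟩

theorem Net.Ends.eq_of {i j : Fin m} {x y : Fin n} (h : N.Ends i x y) (h' : N.Ends j x y) :
    i = j := by
  apply N.simple
  rcases h with ⟨h1, h2⟩ | ⟨h1, h2⟩ <;> rcases h' with ⟨h3, h4⟩ | ⟨h3, h4⟩ <;>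
    simp [h1, h2, h3, h4, Sym2.eq_swap]

theorem Net.Ends.right_unique {i : Fin m} {x y y' : Fin n} (h : N.Ends i x y)
    (h' : N.Ends i x y') : y = y' := by
  have := h.inc_iff.1 h'.inc_right
  have := h'.ne
  aesop

variable (N)

/-- The consistency conditions of a configuration. The edges in `F` are uncolored and not used
for reservations. -/
structure Core (F : Set (Fin m)) (g : Cfg n m K) : Prop where
  tab_iff : ∀ v c i, g.tab v c = some i ↔ N.Inc v i ∧ g.col i = some c
  res_tab : ∀ v c j e, g.res v c = some (j, e) → g.tab v c = none
  res_inc : ∀ v c j e, g.res v c = some (j, e) → N.Inc v e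
  res_col : ∀ v c j e, g.res v c = some (j, e) → g.col e = none
  res_fut : ∀ v c j e, g.res v c = some (j, e) → e ∉ F
  res_color : ∀ v c c' j j' e, g.res v c = some (j, e) → g.res v c' = some (j', e) → c = c'
  res_id : ∀ v v' c c' j j' e, g.res v c = some (j, e) → g.res v' c' = some (j', e) → j = j'
  free_tab : ∀ v, g.tab v (g.free v) = none
  free_res : ∀ v, g.res v (g.free v) = none
  fut : ∀ e ∈ F, g.col e = none

/-- Claim `id` holds color `c` at `z` and color `a` at `x` for the uncolored edge `e` between
`z` and `x`, and nothing else. -/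
structure Tok (g : Cfg n m K) (id : ℕ) (z x : Fin n) (a c : Fin K) (e : Fin m) : Prop where
  ends : N.Ends e z x
  hz : g.res z c = some (id, e)
  hx : g.res x a = some (id, e)
  only : ∀ v c' e', g.res v c' = some (id, e') → e' = e

/-- Recolor: the color `c` of edge `f` between `x` and `y` is moved to the uncolored edge `e`
between `z` and `x`. -/
def Cfg.move (g : Cfg n m K) (id : ℕ) (z x y : Fin n) (a c : Fin K) (e f : Fin m) : Cfg n m K :=
  { g with
    col := Function.update (Function.update g.col e (some c)) f none
    tab := upd (upd (upd g.tab z c (some e)) x c (some e)) y c none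
    res := upd (upd (upd g.res z c none) y c (some (id, f))) x a (some (id, f)) }

/-- Exchange the color held at `z` with the free color of `z`. -/
def Cfg.swap (g : Cfg n m K) (id : ℕ) (z : Fin n) (c : Fin K) (e : Fin m) : Cfg n m K :=
  { g with
    res := upd (upd g.res z c none) z (g.free z) (some (id, e))
    free := Function.update g.free z c }

/-- Reserve the free color of `v`; the new free color is `d`. -/
def Cfg.acquire (g : Cfg n m K) (id : ℕ) (v : Fin n) (d : Fin K) (e : Fin m) : Cfg n m K :=
  { g with
    res := upd g.res v (g.free v) (some (id, e))
    free := Function.update g.free v d }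

/-- Color the edge `e` between `z` and `x`. -/
def Cfg.complete (g : Cfg n m K) (z x : Fin n) (a c : Fin K) (e : Fin m) : Cfg n m K :=
  { g with
    col := Function.update g.col e (some c)
    tab := upd (upd g.tab z c (some e)) x c (some e)
    res := upd (upd (upd g.res z c none) x a none) x c none
    free := if a = c then g.free else Function.update g.free x a }

variable {N} {F : Set (Fin m)} {g : Cfg n m K} {id : ℕ} {z x y : Fin n} {a c : Fin K}
  {e f : Fin m}

theorem Core.col_of_tab (h : Core N F g) {v : Fin n} {i : Fin m} (ht : g.tab v c = some i) :
    g.col i = some c := ((h.tab_iff _ _ _).1 ht).2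

theorem Core.inc_of_tab (h : Core N F g) {v : Fin n} {i : Fin m} (ht : g.tab v c = some i) :
    N.Inc v i := ((h.tab_iff _ _ _).1 ht).1

theorem Tok.col (ht : Tok N g id z x a c e) (h : Core N F g) : g.col e = none :=
  h.res_col _ _ _ _ ht.hz

theorem Tok.tab_z (ht : Tok N g id z x a c e) (h : Core N F g) : g.tab z c = none :=
  h.res_tab _ _ _ _ ht.hz

theorem Tok.tab_x (ht : Tok N g id z x a c e) (h : Core N F g) : g.tab x a = none :=
  h.res_tab _ _ _ _ ht.hx

theorem Tok.eq_hold (ht : Tok N g id z x a c e) (h : Core N F g) {v : Fin n} {c' : Fin K} {j : ℕ}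
    (hr : g.res v c' = some (j, e)) : (v = z ∧ c' = c) ∨ (v = x ∧ c' = a) := by
  rcases ht.ends.inc_iff.1 (h.res_inc _ _ _ _ hr) with rfl | rfl
  · exact Or.inl ⟨rfl, h.res_color _ _ _ _ _ _ hr ht.hz⟩
  · exact Or.inr ⟨rfl, h.res_color _ _ _ _ _ _ hr ht.hx⟩

theorem Tok.swap_ends (ht : Tok N g id z x a c e) : Tok N g id x z c a e :=
  ⟨ht.ends.symm, ht.hx, ht.hz, ht.only⟩

/-- Data for a recoloring move. -/
structure MoveData (N : Net n m) (F : Set (Fin m)) (g : Cfg n m K) (id : ℕ) (z x y : Fin n)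
    (a c : Fin K) (e f : Fin m) : Prop where
  core : Core N F g
  tok : Tok N g id z x a c e
  tab : g.tab x c = some f
  ends : N.Ends f x y

/-! ### Recoloring moves preserve consistency. -/

namespace MoveData

variable (d : MoveData N F g id z x y a c e f)
include d

theorem col_f : g.col f = some c := d.core.col_of_tab d.tab
theorem col_e : g.col e = none := d.tok.col d.core
theorem e_ne_f : e ≠ f := by
  rintro rfl; have := d.col_f; rw [d.col_e] at this; cases this
theorem z_ne_x : z ≠ x := d.tok.ends.ne
theorem x_ne_y : x ≠ y := d.ends.ne
theorem z_ne_y : z ≠ y := by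
  rintro rfl; exact d.e_ne_f (d.tok.ends.symm.eq_of d.ends)
theorem a_ne_c : a ≠ c := by
  rintro rfl; have := d.tab; rw [d.tok.tab_x d.core] at this; cases this
theorem tab_y : g.tab y c = some f := (d.core.tab_iff _ _ _).2 ⟨d.ends.inc_right, d.col_f⟩
theorem res_y : g.res y c = none := by
  rcases h : g.res y c with _ | ⟨j, e'⟩
  · rfl
  · have := d.core.res_tab _ _ _ _ h; rw [d.tab_y] at this; cases this

/-- The token's two reservations pass from `e` to `f`. Nobody else is affected: the only cell newly
reserved, color `c` at `y`, was not reserved before because `f` used that color there. -/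
theorem res_iff {v : Fin n} {c' : Fin K} {j : ℕ} {e' : Fin m} :
    (g.move id z x y a c e f).res v c' = some (j, e') ↔
      (j = id ∧ e' = f ∧ ((v = y ∧ c' = c) ∨ (v = x ∧ c' = a))) ∨
      (e' ≠ e ∧ g.res v c' = some (j, e')) := by
  have h1 := d.z_ne_x
  have h2 := d.x_ne_y
  have h3 := d.z_ne_y
  have hc := d.a_ne_c
  have hhold : ∀ {v c' j}, g.res v c' = some (j, e) → _ := fun {v c' j} => d.tok.eq_hold d.core
  have hz := d.tok.hz
  have hx := d.tok.hx
  have hy := d.res_y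
  simp only [Cfg.move, upd]
  by_cases hA : v = x ∧ c' = a
  · obtain ⟨rfl, rfl⟩ := hA
    simp only [and_self, if_true, or_true, and_true, hx, Option.some.injEq, Prod.mk.injEq]
    constructor
    · rintro ⟨rfl, rfl⟩; simp
    · rintro (⟨rfl, rfl⟩ | ⟨h, rfl, rfl⟩)
      · simp
      · exact absurd rfl h
  · by_cases hB : v = y ∧ c' = c
    · obtain ⟨rfl, rfl⟩ := hB
      simp only [hA, if_false, and_self, if_true, and_true, hy, Option.some.injEq,
        Prod.mk.injEq, reduceCtorEq, and_false, or_false]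
      constructor <;> rintro ⟨rfl, rfl⟩ <;> simp
    · by_cases hC : v = z ∧ c' = c
      · obtain ⟨rfl, rfl⟩ := hC
        simp only [hA, h3, if_false, and_self, if_true, hz, Option.some.injEq, reduceCtorEq,
          Prod.mk.injEq, or_self, and_false, false_and, false_or, false_iff, not_and]
        rintro h rfl rfl
        exact h rfl
      · simp only [hA, hB, hC, if_false, or_self, and_false, false_or]
        constructor
        · intro h
          refine ⟨?_, h⟩
          rintro rfl
          rcases hhold h with h | h
          · exact hC h
          · exact hA h
        · exact And.right

theorem res_other {v : Fin n} {c' : Fin K} {j : ℕ} {e' : Fin m} (hj : j ≠ id) :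
    (g.move id z x y a c e f).res v c' = some (j, e') ↔ g.res v c' = some (j, e') := by
  rw [d.res_iff]
  constructor
  · rintro (⟨h, -⟩ | h)
    · exact absurd h hj
    · exact h.2
  · intro h
    refine Or.inr ⟨?_, h⟩
    rintro rfl
    exact hj (d.core.res_id _ _ _ _ _ _ _ h d.tok.hz)

theorem col_of_ne {i : Fin m} (h1 : i ≠ e) (h2 : i ≠ f) :
    (g.move id z x y a c e f).col i = g.col i := by
  simp [Cfg.move, h1, h2]

theorem col_e' : (g.move id z x y a c e f).col e = some c := by
  simp [Cfg.move, d.e_ne_f]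

theorem col_f' : (g.move id z x y a c e f).col f = none := by
  simp [Cfg.move]

theorem tab_eq (v : Fin n) (c' : Fin K) : (g.move id z x y a c e f).tab v c' =
    if c' = c ∧ (v = z ∨ v = x) then some e else if c' = c ∧ v = y then none
      else g.tab v c' := by
  have h1 := d.z_ne_x
  have h2 := d.x_ne_y
  have h3 := d.z_ne_y
  simp only [Cfg.move, upd]
  by_cases hc : c' = c
  · by_cases hv : v = y
    · subst hv hc; simp [h2.symm, h3.symm]
    · by_cases hv2 : v = x <;> by_cases hv3 : v = z <;> simp [hc, hv, hv2, hv3]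
      all_goals (simp_all)
  · simp [hc]

theorem core_move : Core N F (g.move id z x y a c e f) where
  tab_iff v c' i := by
    rw [d.tab_eq]
    have hI := d.core.tab_iff v c' i
    have he := d.tok.ends.inc_iff (v := v)
    have hf := d.ends.inc_iff (v := v)
    by_cases hi : i = e
    · subst hi
      rw [d.col_e', he]
      have hce := d.col_e
      rw [hce] at hI
      have : g.tab v c' ≠ some i := by rw [Ne, hI]; simp
      split_ifs with h1 h2
      · simp [h1.1, h1.2]
      · simp only [Option.some.injEq, false_iff]
        rintro ⟨h, h'⟩; exact h1 ⟨h'.symm, h⟩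
      · simp only [this, Option.some.injEq, false_iff]
        rintro ⟨h, h'⟩; exact h1 ⟨h'.symm, h⟩
    · by_cases hi2 : i = f
      · subst hi2
        rw [d.col_f']
        rw [hf, d.col_f] at hI
        have := d.e_ne_f
        split_ifs with h1 h2
        · simp [this]
        · simp
        · rw [hI]
          simp only [Option.some.injEq, and_false, iff_false, not_and]
          rintro (rfl | rfl) rfl
          · exact h1 ⟨rfl, Or.inr rfl⟩
          · exact h2 ⟨rfl, rfl⟩
      · rw [d.col_of_ne hi hi2, ← hI]
        split_ifs with h1 h2
        · obtain ⟨rfl, rfl | rfl⟩ := h1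
          · rw [d.tok.tab_z d.core]; simp [Ne.symm hi]
          · rw [d.tab]; simp [Ne.symm hi, Ne.symm hi2]
        · obtain ⟨rfl, rfl⟩ := h2
          rw [d.tab_y]; simp [Ne.symm hi2]
        · rfl
  res_tab v c' j e' h := by
    rw [d.tab_eq]
    have h1 := d.z_ne_y
    have h2 := d.x_ne_y
    have h3 := d.a_ne_c
    rcases d.res_iff.1 h with ⟨-, -, ⟨rfl, rfl⟩ | ⟨rfl, rfl⟩⟩ | ⟨h', h''⟩
    · simp [h1.symm, h2.symm]
    · simp [h3, d.tok.tab_x d.core]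
    · have ht := d.core.res_tab _ _ _ _ h''
      rw [if_neg, ht, ite_self]
      rintro ⟨rfl, rfl | rfl⟩
      · rw [d.tok.hz] at h''; simp at h''; exact h' h''.2.symm
      · rw [d.tab] at ht; cases ht
  res_inc v c' j e' h := by
    rcases d.res_iff.1 h with ⟨-, rfl, ⟨rfl, rfl⟩ | ⟨rfl, rfl⟩⟩ | ⟨h', h''⟩
    · exact d.ends.inc_right
    · exact d.ends.inc_left
    · exact d.core.res_inc _ _ _ _ h''
  res_col v c' j e' h := by
    rcases d.res_iff.1 h with ⟨-, rfl, -⟩ | ⟨h', h''⟩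
    · exact d.col_f'
    · by_cases hf : e' = f
      · rw [hf]; exact d.col_f'
      · rw [d.col_of_ne h' hf]; exact d.core.res_col _ _ _ _ h''
  res_fut v c' j e' h := by
    rcases d.res_iff.1 h with ⟨-, rfl, -⟩ | ⟨h', h''⟩
    · intro hF; have := d.core.fut _ hF; rw [d.col_f] at this; cases this
    · exact d.core.res_fut _ _ _ _ h''
  res_color v c₁ c₂ j₁ j₂ e' h₁ h₂ := by
    have h2 := d.x_ne_y
    have hff : ∀ {v c j}, g.res v c ≠ some (j, f) := fun h => by
      have := d.core.res_col _ _ _ _ h; rw [d.col_f] at this; cases this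
    rcases d.res_iff.1 h₁ with ⟨-, rfl, ⟨rfl, rfl⟩ | ⟨rfl, rfl⟩⟩ | ⟨h', h''⟩ <;>
    rcases d.res_iff.1 h₂ with ⟨-, hh, ⟨hv, rfl⟩ | ⟨hv, rfl⟩⟩ | ⟨k', k''⟩
    · rfl
    · exact absurd hv h2.symm
    · exact absurd k'' hff
    · exact absurd hv h2
    · rfl
    · exact absurd k'' hff
    · rw [hh] at h''; exact absurd h'' hff
    · rw [hh] at h''; exact absurd h'' hff
    · exact d.core.res_color _ _ _ _ _ _ h'' k''
  res_id v₁ v₂ c₁ c₂ j₁ j₂ e' h₁ h₂ := by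
    have hff : ∀ {v c j}, g.res v c ≠ some (j, f) := fun h => by
      have := d.core.res_col _ _ _ _ h; rw [d.col_f] at this; cases this
    rcases d.res_iff.1 h₁ with ⟨rfl, rfl, -⟩ | ⟨h', h''⟩ <;>
    rcases d.res_iff.1 h₂ with ⟨hj, hh, -⟩ | ⟨k', k''⟩
    · exact hj.symm
    · exact absurd k'' hff
    · rw [hh] at h''; exact absurd h'' hff
    · exact d.core.res_id _ _ _ _ _ _ _ h'' k''
  free_tab v := by
    rw [d.tab_eq]
    have ht := d.core.free_tab v
    have hr := d.core.free_res v
    change (if g.free v = c ∧ (v = z ∨ v = x) then some e else if g.free v = c ∧ v = y then none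
      else g.tab v (g.free v)) = none
    rw [if_neg, ht, ite_self]
    rintro ⟨h, rfl | rfl⟩
    · rw [h, d.tok.hz] at hr; cases hr
    · rw [h, d.tab] at ht; cases ht
  free_res v := by
    have ht := d.core.free_tab v
    have hr := d.core.free_res v
    change (g.move id z x y a c e f).res v (g.free v) = none
    rcases h : (g.move id z x y a c e f).res v (g.free v) with _ | ⟨j, e'⟩
    · rfl
    · rcases d.res_iff.1 h with ⟨-, rfl, ⟨rfl, h1⟩ | ⟨rfl, h1⟩⟩ | ⟨h', h''⟩
      · rw [h1, d.tab_y] at ht; cases ht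
      · rw [h1, d.tok.hx] at hr; cases hr
      · rw [h''] at hr; cases hr
  fut i hi := by
    have h1 := d.core.fut i hi
    by_cases hf : i = f
    · rw [hf]; exact d.col_f'
    · rw [d.col_of_ne _ hf]; exact h1
      rintro rfl; exact d.core.res_fut _ _ _ _ d.tok.hz hi

/-- The colors change roles: `x` still misses `a`, and `y` now misses `c`. Iterating the move
therefore follows an alternating path. -/
theorem tok_move : Tok N (g.move id z x y a c e f) id x y c a f where
  ends := d.ends
  hz := d.res_iff.2 (Or.inl ⟨rfl, rfl, Or.inr ⟨rfl, rfl⟩⟩)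
  hx := d.res_iff.2 (Or.inl ⟨rfl, rfl, Or.inl ⟨rfl, rfl⟩⟩)
  only v c' e' h := by
    rcases d.res_iff.1 h with ⟨-, rfl, -⟩ | ⟨h', h''⟩
    · rfl
    · exact absurd (d.tok.only _ _ _ h'') h'

theorem tok_other {j : ℕ} {z' x' : Fin n} {a' c' : Fin K} {e' : Fin m} (hj : j ≠ id)
    (ht : Tok N g j z' x' a' c' e') : Tok N (g.move id z x y a c e f) j z' x' a' c' e' where
  ends := ht.ends
  hz := (d.res_other hj).2 ht.hz
  hx := (d.res_other hj).2 ht.hx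
  only _ _ _ h := ht.only _ _ _ ((d.res_other hj).1 h)

end MoveData

/-! ### Exchanging a held color with the stocked one. -/

section Swap

variable (h : Core N F g) (ht : Tok N g id z x a c e)
include h ht

theorem free_ne_of_tok : g.free z ≠ c := by
  intro hc
  have := h.free_res z
  rw [hc, ht.hz] at this
  cases this

/-- The exchange stays at one vertex and between colors that belong to the token or to nobody. A fan
needs it: the color that brought the token to a leaf goes into stock there, where it later serves to
run the fan backwards. -/
theorem swap_res_iff {v : Fin n} {c' : Fin K} {j : ℕ} {e' : Fin m} :
    (g.swap id z c e).res v c' = some (j, e') ↔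
      (v = z ∧ c' = g.free z ∧ j = id ∧ e' = e) ∨
      (¬ (v = z ∧ c' = c) ∧ g.res v c' = some (j, e')) := by
  have hf := h.free_res z
  have hne := free_ne_of_tok h ht
  simp only [Cfg.swap, upd]
  by_cases hA : v = z ∧ c' = g.free z
  · obtain ⟨rfl, rfl⟩ := hA
    simp [hf, eq_comm]
  · rw [if_neg hA]
    by_cases hB : v = z ∧ c' = c
    · obtain ⟨rfl, rfl⟩ := hB
      simp [hne.symm]
    · rw [if_neg hB]
      simp only [hB, not_false_eq_true, true_and, ← and_assoc, hA, false_and, false_or]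

theorem swap_res_other {v : Fin n} {c' : Fin K} {j : ℕ} {e' : Fin m} (hj : j ≠ id) :
    (g.swap id z c e).res v c' = some (j, e') ↔ g.res v c' = some (j, e') := by
  rw [swap_res_iff h ht]
  constructor
  · rintro (⟨-, -, h', -⟩ | h')
    · exact absurd h' hj
    · exact h'.2
  · intro h'
    refine Or.inr ⟨?_, h'⟩
    rintro ⟨rfl, rfl⟩
    rw [ht.hz] at h'
    simp only [Option.some.injEq, Prod.mk.injEq] at h'
    exact hj h'.1.symm

theorem core_swap : Core N F (g.swap id z c e) where
  tab_iff := h.tab_iff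
  res_tab v c' j e' h' := by
    rcases (swap_res_iff h ht).1 h' with ⟨rfl, rfl, -, -⟩ | ⟨-, h''⟩
    · exact h.free_tab _
    · exact h.res_tab _ _ _ _ h''
  res_inc v c' j e' h' := by
    rcases (swap_res_iff h ht).1 h' with ⟨rfl, rfl, -, rfl⟩ | ⟨-, h''⟩
    · exact ht.ends.inc_left
    · exact h.res_inc _ _ _ _ h''
  res_col v c' j e' h' := by
    rcases (swap_res_iff h ht).1 h' with ⟨rfl, rfl, -, rfl⟩ | ⟨-, h''⟩
    · exact ht.col h
    · exact h.res_col _ _ _ _ h''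
  res_fut v c' j e' h' := by
    rcases (swap_res_iff h ht).1 h' with ⟨rfl, rfl, -, rfl⟩ | ⟨-, h''⟩
    · exact h.res_fut _ _ _ _ ht.hz
    · exact h.res_fut _ _ _ _ h''
  res_color v c₁ c₂ j₁ j₂ e' h₁ h₂ := by
    rcases (swap_res_iff h ht).1 h₁ with ⟨rfl, rfl, -, rfl⟩ | ⟨k₁, h₁'⟩ <;>
    rcases (swap_res_iff h ht).1 h₂ with ⟨hv, rfl, -, he⟩ | ⟨k₂, h₂'⟩
    · rfl
    · exact absurd ⟨rfl, h.res_color _ _ _ _ _ _ h₂' ht.hz⟩ k₂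
    · subst hv he
      exact absurd ⟨rfl, h.res_color _ _ _ _ _ _ h₁' ht.hz⟩ k₁
    · exact h.res_color _ _ _ _ _ _ h₁' h₂'
  res_id v₁ v₂ c₁ c₂ j₁ j₂ e' h₁ h₂ := by
    rcases (swap_res_iff h ht).1 h₁ with ⟨rfl, rfl, rfl, rfl⟩ | ⟨k₁, h₁'⟩ <;>
    rcases (swap_res_iff h ht).1 h₂ with ⟨hv, rfl, hj, he⟩ | ⟨k₂, h₂'⟩
    · exact hj.symm
    · exact h.res_id _ _ _ _ _ _ _ ht.hz h₂'
    · subst hv he hj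
      exact h.res_id _ _ _ _ _ _ _ h₁' ht.hz
    · exact h.res_id _ _ _ _ _ _ _ h₁' h₂'
  free_tab v := by
    change g.tab v (Function.update g.free z c v) = none
    by_cases hv : v = z
    · subst hv; simpa using ht.tab_z h
    · simpa [hv] using h.free_tab v
  free_res v := by
    have hne := free_ne_of_tok h ht
    change upd (upd g.res z c none) z (g.free z) (some (id, e)) v (Function.update g.free z c v)
      = none
    by_cases hv : v = z
    · subst hv; simp [upd, hne.symm]
    · simpa [upd, hv] using h.free_res v
  fut := h.fut

theorem tok_swap : Tok N (g.swap id z c e) id z x a (g.free z) e where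
  ends := ht.ends
  hz := (swap_res_iff h ht).2 (Or.inl ⟨rfl, rfl, rfl, rfl⟩)
  hx := (swap_res_iff h ht).2 (Or.inr ⟨fun h' => ht.ends.ne h'.1.symm, ht.hx⟩)
  only v c' e' h' := by
    rcases (swap_res_iff h ht).1 h' with ⟨-, -, -, rfl⟩ | ⟨-, h''⟩
    · rfl
    · exact ht.only _ _ _ h''

end Swap

/-! ### Reserving a color for a new token. -/

section Acquire

/-- If no such color existed, every color could be charged to an edge at `v`: a used color to its
edge, a reserved color to the uncolored edge it is reserved for, and the stocked color to `e`, which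
has no reservation at `v` yet. By `res_color` the charging is injective, which gives `K` edges at
`v`. -/
theorem exists_fresh (hK : ∀ v : Fin n, {i | N.Inc v i}.ncard < K) (h : Core N F g) {v : Fin n}
    (hv : N.Inc v e) (he : g.col e = none) (hr : ∀ c' j, g.res v c' ≠ some (j, e)) :
    ∃ d, g.tab v d = none ∧ g.res v d = none ∧ d ≠ g.free v := by
  by_contra hcon
  push Not at hcon
  have hex : ∀ d : Fin K, ∃ i : Fin m, N.Inc v i ∧ (g.tab v d = some i ∨
      (∃ j, g.res v d = some (j, i)) ∨ (d = g.free v ∧ i = e)) := by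
    intro d
    rcases ht : g.tab v d with _ | i
    · rcases hr' : g.res v d with _ | ⟨j, i⟩
      · exact ⟨e, hv, Or.inr (Or.inr ⟨hcon d ht hr', rfl⟩)⟩
      · exact ⟨i, h.res_inc _ _ _ _ hr', Or.inr (Or.inl ⟨j, rfl⟩)⟩
    · exact ⟨i, h.inc_of_tab ht, Or.inl rfl⟩
  choose φ h1 h2 using hex
  have hinj : Function.Injective φ := by
    intro d d' hd
    have hc1 : ∀ {d}, g.tab v d = some (φ d) → g.col (φ d) = some d := fun h' => h.col_of_tab h'
    have hc2 : ∀ {d}, (∃ j, g.res v d = some (j, φ d)) ∨ (d = g.free v ∧ φ d = e) →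
        g.col (φ d) = none := by
      rintro d (⟨j, hj⟩ | ⟨-, hj⟩)
      · exact h.res_col _ _ _ _ hj
      · rw [hj]; exact he
    rcases h2 d with h3 | h3 <;> rcases h2 d' with h4 | h4
    · have h5 := hc1 h3
      rw [hd, hc1 h4] at h5
      exact (Option.some.inj h5).symm
    · have h5 := hc1 h3; rw [hd, hc2 h4] at h5; cases h5
    · have h5 := hc1 h4; rw [← hd, hc2 h3] at h5; cases h5
    · rcases h3 with ⟨j, h3⟩ | ⟨h3, h3'⟩ <;> rcases h4 with ⟨j', h4⟩ | ⟨h4, h4'⟩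
      · rw [← hd] at h4; exact h.res_color _ _ _ _ _ _ h3 h4
      · rw [hd, h4'] at h3; exact absurd h3 (hr _ _)
      · rw [← hd, h3'] at h4; exact absurd h4 (hr _ _)
      · rw [h3, h4]
  have hle : K ≤ {i | N.Inc v i}.ncard := by
    have : (Set.range φ).ncard = K := by
      rw [Set.ncard_eq_toFinset_card', Set.toFinset_range,
        Finset.card_image_of_injective _ hinj, Finset.card_univ, Fintype.card_fin]
    rw [← this]
    exact Set.ncard_le_ncard (Set.range_subset_iff.2 h1)
  exact absurd hle (not_le.2 (hK v))

/-- Conditions under which the free color of `v` can be reserved for the edge `e`. -/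
structure AcqData (N : Net n m) (F : Set (Fin m)) (g : Cfg n m K) (id : ℕ) (v : Fin n)
    (d : Fin K) (e : Fin m) : Prop where
  core : Core N F g
  inc : N.Inc v e
  col : g.col e = none
  fut : e ∉ F
  fresh : ∀ c j, g.res v c ≠ some (j, e)
  same : ∀ v' c j, g.res v' c = some (j, e) → j = id
  d_tab : g.tab v d = none
  d_res : g.res v d = none
  d_ne : d ≠ g.free v

namespace AcqData

variable {v : Fin n} {d : Fin K} (q : AcqData N F g id v d e)
include q

theorem res_iff {v' : Fin n} {c' : Fin K} {j : ℕ} {e' : Fin m} :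
    (g.acquire id v d e).res v' c' = some (j, e') ↔
      (v' = v ∧ c' = g.free v ∧ j = id ∧ e' = e) ∨ g.res v' c' = some (j, e') := by
  have hf := q.core.free_res v
  simp only [Cfg.acquire, upd]
  by_cases hA : v' = v ∧ c' = g.free v
  · obtain ⟨rfl, rfl⟩ := hA
    simp [hf, eq_comm]
  · rw [if_neg hA]
    simp only [← and_assoc, hA, false_and, false_or]

theorem core_acquire : Core N F (g.acquire id v d e) where
  tab_iff := q.core.tab_iff
  res_tab v c' j e' h' := by
    rcases q.res_iff.1 h' with ⟨rfl, rfl, -, -⟩ | h''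
    · exact q.core.free_tab _
    · exact q.core.res_tab _ _ _ _ h''
  res_inc v c' j e' h' := by
    rcases q.res_iff.1 h' with ⟨rfl, rfl, -, rfl⟩ | h''
    · exact q.inc
    · exact q.core.res_inc _ _ _ _ h''
  res_col v c' j e' h' := by
    rcases q.res_iff.1 h' with ⟨rfl, rfl, -, rfl⟩ | h''
    · exact q.col
    · exact q.core.res_col _ _ _ _ h''
  res_fut v c' j e' h' := by
    rcases q.res_iff.1 h' with ⟨rfl, rfl, -, rfl⟩ | h''
    · exact q.fut
    · exact q.core.res_fut _ _ _ _ h''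
  res_color v c₁ c₂ j₁ j₂ e' h₁ h₂ := by
    rcases q.res_iff.1 h₁ with ⟨rfl, rfl, -, rfl⟩ | h₁' <;>
    rcases q.res_iff.1 h₂ with ⟨hv, rfl, -, he⟩ | h₂'
    · rfl
    · exact absurd h₂' (q.fresh _ _)
    · subst hv he
      exact absurd h₁' (q.fresh _ _)
    · exact q.core.res_color _ _ _ _ _ _ h₁' h₂'
  res_id v₁ v₂ c₁ c₂ j₁ j₂ e' h₁ h₂ := by
    rcases q.res_iff.1 h₁ with ⟨rfl, rfl, rfl, rfl⟩ | h₁' <;>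
    rcases q.res_iff.1 h₂ with ⟨hv, rfl, hj, he⟩ | h₂'
    · exact hj.symm
    · exact (q.same _ _ _ h₂').symm
    · subst he hj
      exact q.same _ _ _ h₁'
    · exact q.core.res_id _ _ _ _ _ _ _ h₁' h₂'
  free_tab v' := by
    change g.tab v' (Function.update g.free v d v') = none
    by_cases hv : v' = v
    · subst hv; simpa using q.d_tab
    · simpa [hv] using q.core.free_tab v'
  free_res v' := by
    change upd g.res v (g.free v) (some (id, e)) v' (Function.update g.free v d v') = none
    by_cases hv : v' = v
    · subst hv; simpa [upd, q.d_ne] using q.d_res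
    · simpa [upd, hv] using q.core.free_res v'
  fut := q.core.fut

end AcqData

end Acquire

/-! ### Coloring the edge of a token. -/

section Complete

variable (h : Core N F g) (ht : Tok N g id z x a c e) (hc : g.tab x c = none)

theorem complete_res_iff {v : Fin n} {c' : Fin K} {j : ℕ} {e' : Fin m} :
    (g.complete z x a c e).res v c' = some (j, e') ↔
      (¬ (v = z ∧ c' = c) ∧ ¬ (v = x ∧ c' = a) ∧ ¬ (v = x ∧ c' = c)) ∧
        g.res v c' = some (j, e') := by
  simp only [Cfg.complete, upd]
  split_ifs <;> simp_all

include h ht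

theorem complete_res_ne {v : Fin n} {c' : Fin K} {j : ℕ} {e' : Fin m}
    (hr : (g.complete z x a c e).res v c' = some (j, e')) : e' ≠ e := by
  rintro rfl
  rw [complete_res_iff] at hr
  rcases ht.eq_hold h hr.2 with h' | h'
  · exact hr.1.1 h'
  · exact hr.1.2.1 h'

include hc

/-- The color `c` may be the stocked color of `x`, or may be reserved at `x` by another claim. The
second case is settled by deleting that reservation. For the first, the released color `a` becomes
the stock of `x`; if `a = c`, then `c` was reserved by the token and thus is not the stocked color.
-/
theorem core_complete : Core N F (g.complete z x a c e) where
  tab_iff v c' i := by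
    have hI := h.tab_iff v c' i
    have he := ht.ends.inc_iff (v := v)
    have hz := ht.tab_z h
    have hce := ht.col h
    change upd (upd g.tab z c (some e)) x c (some e) v c' = some i ↔
      _ ∧ Function.update g.col e (some c) i = some c'
    by_cases hi : i = e
    · subst hi
      rw [hce] at hI
      simp only [upd, Function.update_self, Option.some.injEq, he]
      by_cases h1 : v = x ∧ c' = c
      · simp [h1]
      · by_cases h2 : v = z ∧ c' = c
        · simp [h2]
        · simp only [h1, h2, if_false, hI]
          simp only [reduceCtorEq, and_false, false_iff]
          rintro ⟨h3 | h3, h4⟩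
          · exact h2 ⟨h3, h4.symm⟩
          · exact h1 ⟨h3, h4.symm⟩
    · rw [Function.update_of_ne hi, ← hI]
      simp only [upd]
      split_ifs with h1 h2
      · obtain ⟨rfl, rfl⟩ := h1; simp [hc, Ne.symm hi]
      · obtain ⟨rfl, rfl⟩ := h2; simp [hz, Ne.symm hi]
      · rfl
  res_tab v c' j e' h' := by
    rw [complete_res_iff] at h'
    change upd (upd g.tab z c (some e)) x c (some e) v c' = none
    simp only [upd, h'.1.1, h'.1.2.2, if_false]
    exact h.res_tab _ _ _ _ h'.2
  res_inc v c' j e' h' := h.res_inc _ _ _ _ (complete_res_iff.1 h').2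
  res_col v c' j e' h' := by
    change Function.update g.col e (some c) e' = none
    rw [Function.update_of_ne (complete_res_ne h ht h')]
    exact h.res_col _ _ _ _ (complete_res_iff.1 h').2
  res_fut v c' j e' h' := h.res_fut _ _ _ _ (complete_res_iff.1 h').2
  res_color v c₁ c₂ j₁ j₂ e' h₁ h₂ :=
    h.res_color _ _ _ _ _ _ (complete_res_iff.1 h₁).2 (complete_res_iff.1 h₂).2
  res_id v₁ v₂ c₁ c₂ j₁ j₂ e' h₁ h₂ :=
    h.res_id _ _ _ _ _ _ _ (complete_res_iff.1 h₁).2 (complete_res_iff.1 h₂).2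
  free_tab v := by
    have hfz := free_ne_of_tok h ht
    have hfx := free_ne_of_tok h ht.swap_ends
    have hne := ht.ends.ne
    change upd (upd g.tab z c (some e)) x c (some e) v
      ((if a = c then g.free else Function.update g.free x a) v) = none
    by_cases hac : a = c
    · subst hac
      simp only [if_true, upd]
      rw [if_neg (by rintro ⟨rfl, h'⟩; exact hfx h'), if_neg (by rintro ⟨rfl, h'⟩; exact hfz h')]
      exact h.free_tab v
    · by_cases hv : v = x
      · subst hv
        simp only [upd, hac, if_false, Function.update_self, and_false]
        exact ht.tab_x h
      · simp only [upd, hac, if_false, Function.update_of_ne hv, hv, false_and]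
        rw [if_neg (by rintro ⟨rfl, h'⟩; exact hfz h')]
        exact h.free_tab v
  free_res v := by
    rcases hr : (g.complete z x a c e).res v ((g.complete z x a c e).free v) with _ | ⟨j, e'⟩
    · rfl
    · exfalso
      rw [complete_res_iff] at hr
      change (¬ (_ ∧ (if a = c then g.free else Function.update g.free x a) v = _) ∧ ¬ (_ ∧
        (if a = c then g.free else Function.update g.free x a) v = a) ∧ _) ∧ g.res v
        ((if a = c then g.free else Function.update g.free x a) v) = _ at hr
      by_cases hv : a ≠ c ∧ v = x
      · obtain ⟨h1, rfl⟩ := hv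
        simp [h1] at hr
      · have : (if a = c then g.free else Function.update g.free x a) v = g.free v := by
          split_ifs with h1
          · rfl
          · rw [Function.update_of_ne]; exact fun h2 => hv ⟨h1, h2⟩
        rw [this, h.free_res v] at hr
        exact absurd hr.2 (by simp)
  fut i hi := by
    change Function.update g.col e (some c) i = none
    rw [Function.update_of_ne, h.fut i hi]
    rintro rfl
    exact h.res_fut _ _ _ _ ht.hz hi

end Complete

end

end EdgeColoring

/-! ## Claims: pending tokens and u-fans -/

namespace EdgeColoring

section

variable {n m K : ℕ} (N : Net n m)

/-- The edges `es` form a walk from `v` whose colors alternate, starting with `c₁`. -/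
def Net.Trail (col : Fin m → Option (Fin K)) :
    Fin n → Fin K → Fin K → List (Fin m) → Prop
  | _, _, _, [] => True
  | v, c₁, c₂, e :: es => ∃ w, N.Ends e v w ∧ col e = some c₁ ∧ Net.Trail col w c₂ c₁ es

/-- Claim `j` is a pending token that still holds its colors. -/
def Cfg.Live (g : Cfg n m K) (j : ℕ) : Prop :=
  ∃ z x a c e, g.log j = .pend z x a c e ∧ g.res z c = some (j, e) ∧ g.res x a = some (j, e)

/-- Claim `j` is a u-fan that still holds its colors. -/
def Cfg.Valid (g : Cfg n m K) (j : ℕ) : Prop :=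
  ∃ u v w α β e₁ e₂ e₃, g.log j = .fan u v w α β ∧ g.res u α = some (j, e₁) ∧
    g.res v β = some (j, e₂) ∧ g.res w β = some (j, e₃)

open Classical in
/-- Number of live pending tokens plus twice the number of valid u-fans. -/
noncomputable def Cfg.score (g : Cfg n m K) (M : ℕ) : ℕ :=
  ((Finset.range M).filter g.Live).card + 2 * ((Finset.range M).filter g.Valid).card

/-- The records of all claims are consistent; a live pending token has a trail of `T` edges. -/
structure Claims (T : ℕ) (g : Cfg n m K) : Prop where
  pend : ∀ j z x a c e, g.log j = .pend z x a c e →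
    N.Ends e z x ∧ ∀ v c' e', g.res v c' = some (j, e') → e' = e
  trail : ∀ j z x a c e, g.log j = .pend z x a c e → g.Live j →
    ∃ es, N.Trail g.col x c a es ∧ es.Nodup ∧ es.length = T ∧ ∀ i, g.own i = j ↔ i ∈ es
  fan : ∀ j u v w α β, g.log j = .fan u v w α β → v ≠ w ∧ α ≠ β ∧
    (∀ e', g.res u α = some (j, e') → N.Ends e' u v) ∧
    (∀ e', g.res v β = some (j, e') → N.Ends e' u v) ∧
    (∀ e', g.res w β = some (j, e') → N.Ends e' u w)

/-- The overall invariant: claim numbers are at most `b`, there are `U₀ - S` uncolored edges, and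
`q` tokens are accounted for. -/
structure Base (F : Set (Fin m)) (T M U₀ b q S : ℕ) (g : Cfg n m K) : Prop where
  core : Core N F g
  claims : Claims N T g
  log_none : ∀ j, j = 0 ∨ b < j → g.log j = .none
  res_le : ∀ v c j e, g.res v c = some (j, e) → 1 ≤ j ∧ j ≤ b
  own_le : ∀ i, g.own i ≤ b
  unc : {i | g.col i = none}.ncard + S = U₀
  count : q ≤ g.score M + 5 * S

/-- The two configurations differ only in what concerns claim `id`. -/
structure Frame (id : ℕ) (g g' : Cfg n m K) : Prop where
  log : g'.log = g.log
  log_id : g.log id = .none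
  res : ∀ j, j ≠ id → ∀ v c e, g'.res v c = some (j, e) ↔ g.res v c = some (j, e)

variable {N} {F : Set (Fin m)} {T M U₀ b q S : ℕ} {g g' : Cfg n m K} {id : ℕ} {z x y : Fin n}
  {a c : Fin K} {e f : Fin m}

theorem Net.Trail.congr {col col' : Fin m → Option (Fin K)} {v : Fin n} {c₁ c₂ : Fin K}
    {es : List (Fin m)} (h : N.Trail col v c₁ c₂ es) (hc : ∀ i ∈ es, col' i = col i) :
    N.Trail col' v c₁ c₂ es := by
  induction es generalizing v c₁ c₂ with
  | nil => trivial
  | cons e es ih =>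
    obtain ⟨w, h1, h2, h3⟩ := h
    exact ⟨w, h1, (hc e (by simp)).trans h2, ih h3 fun i hi => hc i (by simp [hi])⟩

theorem not_live_of_log (h : g.log id = .none) : ¬ g.Live id := by
  rintro ⟨z, x, a, c, e, h', -⟩; rw [h] at h'; cases h'

theorem not_valid_of_log (h : g.log id = .none) : ¬ g.Valid id := by
  rintro ⟨u, v, w, α, β, e₁, e₂, e₃, h', -⟩; rw [h] at h'; cases h'

/-! ### Changes that concern a single claim. -/

namespace Frame

variable (fr : Frame id g g')
include fr

theorem live (j : ℕ) : g'.Live j ↔ g.Live j := by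
  by_cases hj : j = id
  · subst hj
    exact iff_of_false (not_live_of_log (by rw [fr.log, fr.log_id]))
      (not_live_of_log fr.log_id)
  · simp only [Cfg.Live, fr.log, fr.res j hj]

theorem valid (j : ℕ) : g'.Valid j ↔ g.Valid j := by
  by_cases hj : j = id
  · subst hj
    exact iff_of_false (not_valid_of_log (by rw [fr.log, fr.log_id]))
      (not_valid_of_log fr.log_id)
  · simp only [Cfg.Valid, fr.log, fr.res j hj]

theorem score : g'.score M = g.score M := by
  have h1 : g'.Live = g.Live := funext fun j => propext (fr.live j)
  have h2 : g'.Valid = g.Valid := funext fun j => propext (fr.valid j)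
  rw [Cfg.score, Cfg.score, h1, h2]

/-- Records and reservations of the other claims are untouched, so only their trails can be damaged.
It suffices that edges on live trails keep owner and color. -/
theorem claims (h : Claims N T g)
    (ht : ∀ j, j ≠ id → g.Live j → ∀ i,
      (g'.own i = j ↔ g.own i = j) ∧ (g.own i = j → g'.col i = g.col i)) : Claims N T g' where
  pend j z x a c e hl := by
    rw [fr.log] at hl
    have hj : j ≠ id := by rintro rfl; rw [fr.log_id] at hl; cases hl
    refine ⟨(h.pend _ _ _ _ _ _ hl).1, fun v c' e' hr => ?_⟩
    exact (h.pend _ _ _ _ _ _ hl).2 _ _ _ ((fr.res j hj _ _ _).1 hr)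
  trail j z x a c e hl hv := by
    rw [fr.log] at hl
    have hj : j ≠ id := by rintro rfl; rw [fr.log_id] at hl; cases hl
    have hv' := (fr.live j).1 hv
    obtain ⟨es, h1, h2, h3, h4⟩ := h.trail _ _ _ _ _ _ hl hv'
    refine ⟨es, h1.congr fun i hi => ?_, h2, h3, fun i => ?_⟩
    · exact (ht j hj hv' i).2 ((h4 i).2 hi)
    · exact (ht j hj hv' i).1.trans (h4 i)
  fan j u v w α β hl := by
    rw [fr.log] at hl
    have hj : j ≠ id := by rintro rfl; rw [fr.log_id] at hl; cases hl
    simpa only [fr.res j hj] using h.fan _ _ _ _ _ _ hl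

end Frame

/-- The token of an active claim. -/
structure Busy (N : Net n m) (F : Set (Fin m)) (T M U₀ b q S : ℕ) (g : Cfg n m K) (id : ℕ)
    (z x : Fin n) (a c : Fin K) (e : Fin m) : Prop where
  base : Base N F T M U₀ b q S g
  tok : Tok N g id z x a c e
  log : g.log id = .none
  id_pos : 1 ≤ id

theorem Busy.id_le (h : Busy N F T M U₀ b q S g id z x a c e) : id ≤ b :=
  (h.base.res_le _ _ _ _ h.tok.hz).2

/-- All edges of a live trail are colored. Hence coloring or marking the edge of the active token
cannot damage a live trail. -/
theorem Base.own_ne (h : Base N F T M U₀ b q S g) {j : ℕ} (hj : g.Live j) {i : Fin m}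
    (hi : g.col i = none) : g.own i ≠ j := by
  obtain ⟨z, x, a, c, e, hl, -⟩ := id hj
  obtain ⟨es, h1, -, -, h4⟩ := h.claims.trail _ _ _ _ _ _ hl hj
  rw [Ne, h4]
  intro hmem
  clear h4 hl hj
  generalize x = v, c = c₁, a = c₂ at h1
  induction es generalizing v c₁ c₂ with
  | nil => cases hmem
  | cons e' es ih =>
    obtain ⟨w, h2, h3, h5⟩ := h1
    rcases List.mem_cons.1 hmem with rfl | hmem
    · rw [hi] at h3; cases h3
    · exact ih hmem _ _ _ h5

/-- Data for a move of the active token. -/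
theorem Busy.moveData (h : Busy N F T M U₀ b q S g id z x a c e) (ht : g.tab x c = some f)
    (hf : N.Ends f x y) : MoveData N F g id z x y a c e f :=
  ⟨h.base.core, h.tok, ht, hf⟩

theorem Busy.frame_move (h : Busy N F T M U₀ b q S g id z x a c e) (ht : g.tab x c = some f)
    (hf : N.Ends f x y) : Frame id g (g.move id z x y a c e f) :=
  ⟨rfl, h.log, fun _ hj _ _ _ => (h.moveData ht hf).res_other hj⟩

/-- The side condition on the owner of `f` is the reason for the liveness tests in the program: a
move over an edge of a dead trail is harmless, one over a live trail would destroy it. -/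
theorem Busy.move (h : Busy N F T M U₀ b q S g id z x a c e) (ht : g.tab x c = some f)
    (hf : N.Ends f x y) (hl : ¬ g.Live (g.own f)) :
    Busy N F T M U₀ b q S (g.move id z x y a c e f) id x y c a f := by
  have d := h.moveData ht hf
  have fr := h.frame_move ht hf
  refine ⟨⟨d.core_move, fr.claims h.base.claims ?_, h.base.log_none, ?_, h.base.own_le, ?_, ?_⟩,
    d.tok_move, h.log, h.id_pos⟩
  · intro j hj hlive i
    refine ⟨Iff.rfl, fun hi => d.col_of_ne ?_ ?_⟩
    · rintro rfl; exact h.base.own_ne hlive d.col_e hi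
    · rintro rfl; rw [hi] at hl; exact hl hlive
  · intro v c' j e' hr
    rcases d.res_iff.1 hr with ⟨rfl, -⟩ | ⟨-, hr⟩
    · exact ⟨h.id_pos, h.id_le⟩
    · exact h.base.res_le _ _ _ _ hr
  · rw [← h.base.unc]
    congr 1
    -- The uncolored edges lose `e` and gain `f`, so their number is unchanged.
    have h1 : {i | (g.move id z x y a c e f).col i = none}
        = insert f ({i | g.col i = none} \ {e}) := by
      ext i
      simp only [Set.mem_ofPred_eq, Set.mem_insert_iff, Set.mem_sdiff, Set.mem_singleton_iff]
      by_cases hif : i = f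
      · simp [hif, d.col_f']
      · by_cases hie : i = e
        · rw [hie, d.col_e']; simp [d.e_ne_f]
        · rw [d.col_of_ne hie hif]; simp [hif, hie]
    rw [h1, Set.ncard_insert_of_notMem, Set.ncard_sdiff_singleton_add_one]
    · exact d.col_e
    · simp [d.col_f]
  · rw [fr.score]; exact h.base.count

theorem Busy.frame_swap (h : Busy N F T M U₀ b q S g id z x a c e) :
    Frame id g (g.swap id z c e) :=
  ⟨rfl, h.log, fun _ hj _ _ _ => swap_res_other h.base.core h.tok hj⟩

theorem Busy.swap (h : Busy N F T M U₀ b q S g id z x a c e) :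
    Busy N F T M U₀ b q S (g.swap id z c e) id z x a (g.free z) e := by
  have fr := h.frame_swap
  refine ⟨⟨core_swap h.base.core h.tok, fr.claims h.base.claims fun _ _ _ _ =>
    ⟨Iff.rfl, fun _ => rfl⟩, h.base.log_none, ?_, h.base.own_le, h.base.unc, ?_⟩,
    tok_swap h.base.core h.tok, h.log, h.id_pos⟩
  · intro v c' j e' hr
    rcases (swap_res_iff h.base.core h.tok).1 hr with ⟨-, -, rfl, -⟩ | ⟨-, hr⟩
    · exact ⟨h.id_pos, h.id_le⟩
    · exact h.base.res_le _ _ _ _ hr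
  · rw [fr.score]; exact h.base.count

/-- Mark an edge as visited by claim `id`. -/
def Cfg.mark (g : Cfg n m K) (id : ℕ) (e : Fin m) : Cfg n m K :=
  { g with own := Function.update g.own e id }

theorem Busy.mark (h : Busy N F T M U₀ b q S g id z x a c e) :
    Busy N F T M U₀ b q S (g.mark id e) id z x a c e := by
  have fr : Frame id g (g.mark id e) := ⟨rfl, h.log, fun _ _ _ _ _ => Iff.rfl⟩
  have k := h.base.core
  refine ⟨⟨⟨k.tab_iff, k.res_tab, k.res_inc, k.res_col, k.res_fut, k.res_color, k.res_id,
    k.free_tab, k.free_res, k.fut⟩, fr.claims h.base.claims ?_, h.base.log_none,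
    h.base.res_le, ?_, h.base.unc, ?_⟩, ⟨h.tok.ends, h.tok.hz, h.tok.hx, h.tok.only⟩, h.log,
    h.id_pos⟩
  · intro j hj hlive i
    refine ⟨?_, fun _ => rfl⟩
    by_cases hi : i = e
    · subst hi
      simp only [Cfg.mark, Function.update_self]
      exact iff_of_false (Ne.symm hj) (h.base.own_ne hlive (h.tok.col k))
    · simp [Cfg.mark, hi]
  · intro i
    simp only [Cfg.mark, Function.update_apply]
    split
    · exact h.id_le
    · exact h.base.own_le i
  · rw [fr.score]; exact h.base.count

/-- A success is worth 5 in the count and destroys at most one other claim, the holder of `c` at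
`x`. The net gain of at least 2 also pays for a pending token given up in a collision. -/
theorem Busy.complete (h : Busy N F T M U₀ b q S g id z x a c e)
    (hc : g.tab x c = none) :
    Base N F T M U₀ b (q + 2) (S + 1) (g.complete z x a c e) := by
  classical
  have k := h.base.core
  have hback : ∀ {v c' j e'}, (g.complete z x a c e).res v c' = some (j, e') →
      g.res v c' = some (j, e') := fun hr => (complete_res_iff.1 hr).2
  have hfwd : ∀ {v c' j e'}, g.res v c' = some (j, e') → j ≠ id →
      (∀ e'', g.res x c ≠ some (j, e'')) →
      (g.complete z x a c e).res v c' = some (j, e') := by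
    intro v c' j e' hr hj hx
    refine complete_res_iff.2 ⟨⟨?_, ?_, ?_⟩, hr⟩
    · rintro ⟨rfl, rfl⟩; rw [h.tok.hz] at hr; simp at hr; exact hj hr.1.symm
    · rintro ⟨rfl, rfl⟩; rw [h.tok.hx] at hr; simp at hr; exact hj hr.1.symm
    · rintro ⟨rfl, rfl⟩; exact hx _ hr
  have hlive : ∀ j, (g.complete z x a c e).Live j → g.Live j := by
    rintro j ⟨z', x', a', c', e', h1, h2, h3⟩
    exact ⟨z', x', a', c', e', h1, hback h2, hback h3⟩
  refine ⟨core_complete k h.tok hc, ?_, h.base.log_none,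
    fun v c' j e' hr => h.base.res_le _ _ _ _ (hback hr), h.base.own_le, ?_, ?_⟩
  · refine ⟨fun j z' x' a' c' e' hl => ?_, fun j z' x' a' c' e' hl hv => ?_,
      fun j u v w α β hl => ?_⟩
    · have h1 := h.base.claims.pend _ _ _ _ _ _ hl
      exact ⟨h1.1, fun v c'' e'' hr => h1.2 _ _ _ (hback hr)⟩
    · obtain ⟨es, h1, h2, h3, h4⟩ := h.base.claims.trail _ _ _ _ _ _ hl (hlive _ hv)
      refine ⟨es, h1.congr fun i hi => ?_, h2, h3, h4⟩
      have : i ≠ e := by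
        rintro rfl
        exact h.base.own_ne (hlive _ hv) (h.tok.col k) ((h4 _).2 hi)
      simp [Cfg.complete, this]
    · obtain ⟨h1, h2, h3, h4, h5⟩ := h.base.claims.fan _ _ _ _ _ _ hl
      exact ⟨h1, h2, fun e' hr => h3 _ (hback hr), fun e' hr => h4 _ (hback hr),
        fun e' hr => h5 _ (hback hr)⟩
  · have hset : {i | (g.complete z x a c e).col i = none} = {i | g.col i = none} \ {e} := by
      ext i
      by_cases hi : i = e <;> simp [Cfg.complete, Function.update_apply, hi]
    have h1 := Set.ncard_sdiff_singleton_add_one (s := {i | g.col i = none}) (a := e) (h.tok.col k)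
      (Set.toFinite _)
    have h2 := h.base.unc
    rw [hset]; omega
  -- `j₀` is the claim that loses a color; the value `0` stands for no such claim.
  · obtain ⟨j₀, hj₀⟩ : ∃ j₀, ∀ j, j ≠ j₀ → ∀ e'', g.res x c ≠ some (j, e'') := by
      rcases hr : g.res x c with _ | ⟨j₀, e₀⟩
      · exact ⟨0, by simp⟩
      · refine ⟨j₀, fun j hj e'' h' => ?_⟩
        simp at h'; exact hj h'.1.symm
    have hnl : ∀ j, g.Live j → j ≠ id := by
      rintro j hj rfl; exact not_live_of_log h.log hj
    have hnv : ∀ j, g.Valid j → j ≠ id := by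
      rintro j hj rfl; exact not_valid_of_log h.log hj
    have hA : (Finset.range M).filter g.Live ⊆
        insert j₀ ((Finset.range M).filter (g.complete z x a c e).Live) := by
      intro j hj
      rw [Finset.mem_filter] at hj
      rw [Finset.mem_insert, Finset.mem_filter]
      by_cases hjj : j = j₀
      · exact Or.inl hjj
      · refine Or.inr ⟨hj.1, ?_⟩
        have hne := hnl _ hj.2
        obtain ⟨z', x', a', c', e', h1, h2, h3⟩ := hj.2
        exact ⟨z', x', a', c', e', h1, hfwd h2 hne (hj₀ _ hjj), hfwd h3 hne (hj₀ _ hjj)⟩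
    have hB : (Finset.range M).filter g.Valid ⊆
        insert j₀ ((Finset.range M).filter (g.complete z x a c e).Valid) := by
      intro j hj
      rw [Finset.mem_filter] at hj
      rw [Finset.mem_insert, Finset.mem_filter]
      by_cases hjj : j = j₀
      · exact Or.inl hjj
      · refine Or.inr ⟨hj.1, ?_⟩
        have hne := hnv _ hj.2
        obtain ⟨u, v, w, α, β, e₁, e₂, e₃, h1, h2, h3, h4⟩ := hj.2
        exact ⟨u, v, w, α, β, e₁, e₂, e₃, h1, hfwd h2 hne (hj₀ _ hjj), hfwd h3 hne (hj₀ _ hjj),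
          hfwd h4 hne (hj₀ _ hjj)⟩
    -- Bounding the two losses separately costs `1 + 2 = 3` at most, which leaves 2 of the 5.
    have h1 := (Finset.card_le_card hA).trans (Finset.card_insert_le _ _)
    have h2 := (Finset.card_le_card hB).trans (Finset.card_insert_le _ _)
    have h3 := h.base.count
    simp only [Cfg.score] at h3 ⊢
    omega

/-- Record something about claim `j`. -/
def Cfg.record (g : Cfg n m K) (j : ℕ) (r : Rec n m K) : Cfg n m K :=
  { g with log := Function.update g.log j r }

theorem Core.record (k : Core N F g) (j : ℕ) (r : Rec n m K) : Core N F (g.record j r) :=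
  ⟨k.tab_iff, k.res_tab, k.res_inc, k.res_col, k.res_fut, k.res_color, k.res_id,
    k.free_tab, k.free_res, k.fut⟩

theorem record_live {j i : ℕ} {r : Rec n m K} (hi : i ≠ j) :
    (g.record j r).Live i ↔ g.Live i := by
  simp [Cfg.Live, Cfg.record, hi]

theorem record_valid {j i : ℕ} {r : Rec n m K} (hi : i ≠ j) :
    (g.record j r).Valid i ↔ g.Valid i := by
  simp [Cfg.Valid, Cfg.record, hi]

/-- The active token becomes pending. -/
theorem Busy.pending (h : Busy N F T M U₀ b q S g id z x a c e) (hM : b < M)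
    {es : List (Fin m)} (h1 : N.Trail g.col z a c es) (h2 : es.Nodup) (h3 : es.length = T)
    (h4 : ∀ i, g.own i = id ↔ i ∈ es) :
    Base N F T M U₀ b (q + 1) S (g.record id (.pend x z c a e)) := by
  classical
  have k := h.base.core
  have hb := h.id_le
  -- The ends and colors are recorded in exchanged roles. The trail starts at `z` with color `a`, so
  -- on resumption the first move goes back over the most recent edge.
  have hlog : (g.record id (.pend x z c a e)).log id = .pend x z c a e := by simp [Cfg.record]
  have hlog' : ∀ j, j ≠ id → (g.record id (.pend x z c a e)).log j = g.log j := by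
    intro j hj; simp [Cfg.record, hj]
  refine ⟨k.record _ _, ⟨fun j z' x' a' c' e' hl => ?_, fun j z' x' a' c' e' hl hv => ?_,
    fun j u v w α β hl => ?_⟩, fun j hj => ?_, h.base.res_le, h.base.own_le, h.base.unc, ?_⟩
  · by_cases hj : j = id
    · subst hj
      rw [hlog] at hl; cases hl
      exact ⟨h.tok.ends.symm, h.tok.only⟩
    · rw [hlog' j hj] at hl
      exact h.base.claims.pend _ _ _ _ _ _ hl
  · by_cases hj : j = id
    · subst hj
      rw [hlog] at hl; cases hl
      exact ⟨es, h1, h2, h3, h4⟩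
    · rw [hlog' j hj] at hl
      exact h.base.claims.trail _ _ _ _ _ _ hl ((record_live hj).1 hv)
  · by_cases hj : j = id
    · subst hj
      rw [hlog] at hl; cases hl
    · rw [hlog' j hj] at hl
      exact h.base.claims.fan _ _ _ _ _ _ hl
  · have hj' : j ≠ id := by have := h.id_pos; omega
    rw [hlog' j hj']; exact h.base.log_none j hj
  · have hA : insert id ((Finset.range M).filter g.Live) ⊆
        (Finset.range M).filter (g.record id (.pend x z c a e)).Live := by
      intro j hj
      rw [Finset.mem_insert, Finset.mem_filter] at hj
      rw [Finset.mem_filter]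
      rcases hj with rfl | hj
      · exact ⟨Finset.mem_range.2 (by omega), _, _, _, _, _, hlog, h.tok.hx, h.tok.hz⟩
      · refine ⟨hj.1, (record_live ?_).2 hj.2⟩
        rintro rfl; exact not_live_of_log h.log hj.2
    have hB : (Finset.range M).filter g.Valid ⊆
        (Finset.range M).filter (g.record id (.pend x z c a e)).Valid := by
      intro j hj
      rw [Finset.mem_filter] at hj ⊢
      refine ⟨hj.1, (record_valid ?_).2 hj.2⟩
      rintro rfl; exact not_valid_of_log h.log hj.2
    have h5 := Finset.card_le_card hA
    rw [Finset.card_insert_of_notMem] at h5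
    · have h6 := Finset.card_le_card hB
      have h7 := h.base.count
      simp only [Cfg.score] at h7 ⊢
      omega
    · simp only [Finset.mem_filter, not_and]
      exact fun _ => not_live_of_log h.log

/-- A live pending token is taken up again. -/
theorem Base.resume (h : Base N F T M U₀ b q S g) {j : ℕ}
    (hl : g.log j = .pend z x a c e) (hv : g.Live j) :
    Busy N F T M U₀ b (q - 1) S (g.record j .none) j z x a c e ∧
      ∃ es, N.Trail g.col x c a es ∧ es.Nodup ∧ es.length = T ∧ ∀ i, g.own i = j ↔ i ∈ es := by
  classical
  have k := h.core
  refine ⟨⟨⟨k.record _ _, ⟨fun i z' x' a' c' e' hl' => ?_, fun i z' x' a' c' e' hl' hv' => ?_,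
    fun i u v w α β hl' => ?_⟩, fun i hi => ?_, h.res_le, h.own_le, h.unc, ?_⟩, ?_, ?_, ?_⟩,
    h.claims.trail _ _ _ _ _ _ hl hv⟩
  · have hi : i ≠ j := by rintro rfl; simp [Cfg.record] at hl'
    exact h.claims.pend _ _ _ _ _ _ (by simpa [Cfg.record, hi] using hl')
  · have hi : i ≠ j := by rintro rfl; simp [Cfg.record] at hl'
    exact h.claims.trail _ _ _ _ _ _ (by simpa [Cfg.record, hi] using hl')
      ((record_live hi).1 hv')
  · have hi : i ≠ j := by rintro rfl; simp [Cfg.record] at hl'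
    exact h.claims.fan _ _ _ _ _ _ (by simpa [Cfg.record, hi] using hl')
  · by_cases hij : i = j
    · simp [Cfg.record, hij]
    · simpa [Cfg.record, hij] using h.log_none i hi
  · have hA : (Finset.range M).filter g.Live ⊆
        insert j ((Finset.range M).filter (g.record j .none).Live) := by
      intro i hi
      rw [Finset.mem_filter] at hi
      rw [Finset.mem_insert, Finset.mem_filter]
      by_cases hij : i = j
      · exact Or.inl hij
      · exact Or.inr ⟨hi.1, (record_live hij).2 hi.2⟩
    have hB : (Finset.range M).filter g.Valid ⊆
        (Finset.range M).filter (g.record j .none).Valid := by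
      intro i hi
      rw [Finset.mem_filter] at hi ⊢
      refine ⟨hi.1, (record_valid ?_).2 hi.2⟩
      rintro rfl
      obtain ⟨u, v, w, α, β, e₁, e₂, e₃, h1, -⟩ := hi.2
      rw [hl] at h1; cases h1
    have h5 := (Finset.card_le_card hA).trans (Finset.card_insert_le _ _)
    have h6 := Finset.card_le_card hB
    have h7 := h.count
    simp only [Cfg.score] at h7 ⊢
    omega
  -- Liveness supplies the two reservations, and the record supplies the incidences; together they
  -- form a token.
  · obtain ⟨h1, h2⟩ := h.claims.pend _ _ _ _ _ _ hl
    obtain ⟨z', x', a', c', e', h3, h4, h5⟩ := hv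
    rw [hl] at h3; cases h3
    exact ⟨h1, h4, h5, h2⟩
  · simp [Cfg.record]
  · by_contra h0
    rw [h.log_none j (Or.inl (by omega))] at hl; cases hl

/-- Turn the tokens `id` at `e` and `p` at `e'`, both next to `x`, into a u-fan. -/
def Cfg.makeFan (g : Cfg n m K) (id : ℕ) (z x z' : Fin n) (a a' c : Fin K) (e' : Fin m) :
    Cfg n m K :=
  { g with
    res := upd (upd g.res x a' none) z' c (some (id, e'))
    log := Function.update g.log id (.fan x z z' a c) }

/-- Two tokens at the same `x`, both wanting color `c` there, miss `c` at their outer ends `z` and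
`z'`, and `a` is missing at `x`: this is a u-fan. Claim `id` takes over the reservation of `p` at
`z'`, and the color `a'` that `p` held at `x` is released. Neither token counted towards the score
before, as both logs were empty. -/
theorem Busy.makeFan (h : Busy N F T M U₀ b q S g id z x a c e) (hM : b < M) {p : ℕ} {z' : Fin n}
    {a' : Fin K} {e' : Fin m} (h' : Busy N F T M U₀ b q S g p z' x a' c e') (hp : p ≠ id)
    (hac : a ≠ c) :
    Base N F T M U₀ b (q + 2) S (g.makeFan id z x z' a a' c e') := by
  classical
  have k := h.base.core
  have hzx := h.tok.ends.ne
  have hzx' := h'.tok.ends.ne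
  -- An uncolored edge serves a single claim, so the two edges, and hence the two leaves, are
  -- distinct.
  have hee : e' ≠ e := by
    rintro rfl; exact hp (k.res_id _ _ _ _ _ _ _ h'.tok.hz h.tok.hz)
  have hzz : z ≠ z' := by
    rintro rfl; exact hee (h'.tok.ends.eq_of h.tok.ends)
  have hres : ∀ {v c' j i}, (g.makeFan id z x z' a a' c e').res v c' = some (j, i) ↔
      (v = z' ∧ c' = c ∧ j = id ∧ i = e') ∨ (i ≠ e' ∧ g.res v c' = some (j, i)) := by
    intro v c' j i
    have hz' := h'.tok.hz
    have hx' := h'.tok.hx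
    have hhold : ∀ {v c' j}, g.res v c' = some (j, e') → _ := fun {v c' j} =>
      h'.tok.eq_hold k
    simp only [Cfg.makeFan, upd]
    by_cases hA : v = z' ∧ c' = c
    · obtain ⟨rfl, rfl⟩ := hA
      simp only [and_self, if_true, true_and, hz', Option.some.injEq, Prod.mk.injEq]
      constructor
      · rintro ⟨rfl, rfl⟩; simp
      · rintro (⟨rfl, rfl⟩ | ⟨h1, h2, h3⟩)
        · simp
        · exact absurd h3.symm h1
    · rw [if_neg hA]
      have hA' : ¬ (v = z' ∧ c' = c ∧ j = id ∧ i = e') := fun h => hA ⟨h.1, h.2.1⟩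
      simp only [hA', false_or]
      by_cases hB : v = x ∧ c' = a'
      · obtain ⟨rfl, rfl⟩ := hB
        simp only [and_self, if_true, hx', Option.some.injEq, Prod.mk.injEq, reduceCtorEq,
          false_iff, not_and]
        rintro h1 h2 h3
        exact h1 h3.symm
      · rw [if_neg hB]
        constructor
        · intro h1
          refine ⟨?_, h1⟩
          rintro rfl
          rcases hhold h1 with h2 | h2
          · exact hA h2
          · exact hB h2
        · exact And.right
  have hback : ∀ {v c' j i}, (g.makeFan id z x z' a a' c e').res v c' = some (j, i) → j ≠ id →
      g.res v c' = some (j, i) := by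
    intro v c' j i hr hj
    rcases hres.1 hr with ⟨-, -, h1, -⟩ | h1
    · exact absurd h1 hj
    · exact h1.2
  have hfwd : ∀ {v c' j i}, g.res v c' = some (j, i) → j ≠ p →
      (g.makeFan id z x z' a a' c e').res v c' = some (j, i) := by
    intro v c' j i hr hj
    refine hres.2 (Or.inr ⟨?_, hr⟩)
    rintro rfl
    exact hj (k.res_id _ _ _ _ _ _ _ hr h'.tok.hz)
  have hlog' : ∀ j, j ≠ id → (g.makeFan id z x z' a a' c e').log j = g.log j := by
    intro j hj; simp [Cfg.makeFan, hj]
  have hlog : (g.makeFan id z x z' a a' c e').log id = .fan x z z' a c := by simp [Cfg.makeFan]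
  have hlive : ∀ j, (g.makeFan id z x z' a a' c e').Live j ↔ g.Live j := by
    intro j
    by_cases hj : j = id
    · subst hj
      refine iff_of_false ?_ (not_live_of_log h.log)
      rintro ⟨_, _, _, _, _, h1, -⟩
      rw [hlog] at h1; cases h1
    · by_cases hjp : j = p
      · subst hjp
        exact iff_of_false (not_live_of_log (by rw [hlog' _ hj, h'.log]))
          (not_live_of_log h'.log)
      · simp only [Cfg.Live, hlog' j hj]
        constructor <;> rintro ⟨z₁, x₁, a₁, c₁, e₁, h1, h2, h3⟩
        · exact ⟨z₁, x₁, a₁, c₁, e₁, h1, hback h2 hj, hback h3 hj⟩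
        · exact ⟨z₁, x₁, a₁, c₁, e₁, h1, hfwd h2 hjp, hfwd h3 hjp⟩
  have hvalid : ∀ j, j ≠ id → g.Valid j → (g.makeFan id z x z' a a' c e').Valid j := by
    intro j hj hv
    have hjp : j ≠ p := by rintro rfl; exact not_valid_of_log h'.log hv
    obtain ⟨u, v, w, α, β, e₁, e₂, e₃, h1, h2, h3, h4⟩ := hv
    exact ⟨u, v, w, α, β, e₁, e₂, e₃, by rw [hlog' j hj, h1], hfwd h2 hjp, hfwd h3 hjp,
      hfwd h4 hjp⟩
  have hfree : ∀ v, (v, g.free v) ≠ (z', c) := by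
    rintro v h1
    simp only [Prod.mk.injEq] at h1
    obtain ⟨rfl, h2⟩ := h1
    have := k.free_res v
    rw [h2, h'.tok.hz] at this; cases this
  refine ⟨⟨k.tab_iff, ?_, ?_, ?_, ?_, ?_, ?_, k.free_tab, ?_, k.fut⟩,
    ⟨fun j z₁ x₁ a₁ c₁ e₁ hl => ?_, fun j z₁ x₁ a₁ c₁ e₁ hl hv => ?_,
    fun j u v w α β hl => ?_⟩, fun j hj => ?_, ?_, h.base.own_le, h.base.unc, ?_⟩
  · intro v c' j i hr
    rcases hres.1 hr with ⟨rfl, rfl, -, -⟩ | ⟨-, h1⟩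
    · exact k.res_tab _ _ _ _ h'.tok.hz
    · exact k.res_tab _ _ _ _ h1
  · intro v c' j i hr
    rcases hres.1 hr with ⟨rfl, rfl, -, rfl⟩ | ⟨-, h1⟩
    · exact k.res_inc _ _ _ _ h'.tok.hz
    · exact k.res_inc _ _ _ _ h1
  · intro v c' j i hr
    rcases hres.1 hr with ⟨rfl, rfl, -, rfl⟩ | ⟨-, h1⟩
    · exact k.res_col _ _ _ _ h'.tok.hz
    · exact k.res_col _ _ _ _ h1
  · intro v c' j i hr
    rcases hres.1 hr with ⟨rfl, rfl, -, rfl⟩ | ⟨-, h1⟩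
    · exact k.res_fut _ _ _ _ h'.tok.hz
    · exact k.res_fut _ _ _ _ h1
  · intro v c₁ c₂ j₁ j₂ i h₁ h₂
    rcases hres.1 h₁ with ⟨rfl, rfl, -, rfl⟩ | ⟨k₁, h₁⟩ <;>
    rcases hres.1 h₂ with ⟨-, rfl, -, h3⟩ | ⟨k₂, h₂⟩
    · rfl
    · exact absurd rfl k₂
    · exact absurd h3 k₁
    · exact k.res_color _ _ _ _ _ _ h₁ h₂
  · intro v₁ v₂ c₁ c₂ j₁ j₂ i h₁ h₂
    rcases hres.1 h₁ with ⟨-, -, rfl, rfl⟩ | ⟨k₁, h₁⟩ <;>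
    rcases hres.1 h₂ with ⟨-, -, h4, h3⟩ | ⟨k₂, h₂⟩
    · exact h4.symm
    · exact absurd rfl k₂
    · exact absurd h3 k₁
    · exact k.res_id _ _ _ _ _ _ _ h₁ h₂
  · intro v
    rcases hr : (g.makeFan id z x z' a a' c e').res v (g.free v) with _ | ⟨j, i⟩
    · exact hr
    · rcases hres.1 hr with ⟨h1, h2, -, -⟩ | ⟨-, h1⟩
      · exact absurd (Prod.ext h1 h2) (hfree v)
      · rw [k.free_res] at h1; cases h1
  · have hj : j ≠ id := by rintro rfl; rw [hlog] at hl; cases hl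
    rw [hlog' j hj] at hl
    obtain ⟨h1, h2⟩ := h.base.claims.pend _ _ _ _ _ _ hl
    exact ⟨h1, fun v c' i hr => h2 _ _ _ (hback hr hj)⟩
  · have hj : j ≠ id := by rintro rfl; rw [hlog] at hl; cases hl
    rw [hlog' j hj] at hl
    exact h.base.claims.trail _ _ _ _ _ _ hl ((hlive j).1 hv)
  · by_cases hj : j = id
    · subst hj
      rw [hlog] at hl; cases hl
      refine ⟨hzz, hac, fun i hr => ?_, fun i hr => ?_, fun i hr => ?_⟩
      · rcases hres.1 hr with ⟨h1, -⟩ | ⟨-, h1⟩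
        · exact absurd h1.symm hzx'
        · rw [h.tok.only _ _ _ h1]; exact h.tok.ends.symm
      · rcases hres.1 hr with ⟨h1, -⟩ | ⟨-, h1⟩
        · exact absurd h1 hzz
        · rw [h.tok.only _ _ _ h1]; exact h.tok.ends.symm
      · rcases hres.1 hr with ⟨-, -, -, rfl⟩ | ⟨h0, h1⟩
        · exact h'.tok.ends.symm
        · rw [h'.tok.hz] at h1
          simp only [Option.some.injEq, Prod.mk.injEq] at h1
          exact absurd h1.2.symm h0
    · rw [hlog' j hj] at hl
      obtain ⟨h1, h2, h3, h4, h5⟩ := h.base.claims.fan _ _ _ _ _ _ hl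
      exact ⟨h1, h2, fun i hr => h3 _ (hback hr hj), fun i hr => h4 _ (hback hr hj),
        fun i hr => h5 _ (hback hr hj)⟩
  · have hj' : j ≠ id := by have := h.id_pos; have := h.id_le; omega
    rw [hlog' j hj']; exact h.base.log_none j hj
  · intro v c' j i hr
    rcases hres.1 hr with ⟨-, -, rfl, -⟩ | ⟨-, h1⟩
    · exact ⟨h.id_pos, h.id_le⟩
    · exact h.base.res_le _ _ _ _ h1
  · have hA : insert id ((Finset.range M).filter g.Valid) ⊆
        (Finset.range M).filter (g.makeFan id z x z' a a' c e').Valid := by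
      intro j hj
      rw [Finset.mem_insert, Finset.mem_filter] at hj
      rw [Finset.mem_filter]
      rcases hj with rfl | hj
      · refine ⟨Finset.mem_range.2 (h.id_le.trans_lt hM), x, z, z', a, c, e, e, e', hlog,
          hfwd h.tok.hx hp.symm, hfwd h.tok.hz hp.symm, hres.2 (Or.inl ⟨rfl, rfl, rfl, rfl⟩)⟩
      · refine ⟨hj.1, hvalid j ?_ hj.2⟩
        rintro rfl; exact not_valid_of_log h.log hj.2
    have h5 := Finset.card_le_card hA
    rw [Finset.card_insert_of_notMem] at h5
    · have h7 := h.base.count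
      have h8 : (g.makeFan id z x z' a a' c e').Live = g.Live := funext fun j => propext (hlive j)
      simp only [Cfg.score] at h7 ⊢
      rw [h8]
      omega
    · simp only [Finset.mem_filter, not_and]
      exact fun _ => not_valid_of_log h.log

end

end EdgeColoring

/-! ## The phases of the processing of one token -/

namespace EdgeColoring

section

variable {n m K : ℕ} (N : Net n m)

/-- The edges `es` at `u` lead through a sequence of vertices starting next to `v`; each has the
free color of the vertex before it. The free color of the last vertex satisfies `R`. -/
def Net.Chain (col : Fin m → Option (Fin K)) (free : Fin n → Fin K) (u : Fin n)
    (R : Fin K → Prop) : Fin n → List (Fin m) → Prop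
  | v, [] => R (free v)
  | v, e :: es => ∃ w, N.Ends e u w ∧ col e = some (free v) ∧ Net.Chain col free u R w es

variable {N} {F : Set (Fin m)} {T M U₀ b q S : ℕ} {g : Cfg n m K} {id : ℕ} {z x y u : Fin n}
  {a c α β : Fin K} {e f : Fin m}

theorem Net.Chain.congr {col col' : Fin m → Option (Fin K)} {free free' : Fin n → Fin K}
    {R : Fin K → Prop} {v : Fin n} {es : List (Fin m)} (h : N.Chain col free u R v es)
    (hc : ∀ i ∈ es, col' i = col i) (hv : free' v = free v)
    (hw : ∀ i ∈ es, ∀ w, N.Ends i u w → free' w = free w) :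
    N.Chain col' free' u R v es := by
  induction es generalizing v with
  | nil => simp only [Net.Chain] at h ⊢; rwa [hv]
  | cons e es ih =>
    obtain ⟨w, h1, h2, h3⟩ := h
    exact ⟨w, h1, by rw [hc e (by simp), h2, hv],
      ih h3 (fun i hi => hc i (by simp [hi])) (hw e (by simp) w h1)
        fun i hi => hw i (by simp [hi])⟩

theorem Net.Chain.mem {col : Fin m → Option (Fin K)} {free : Fin n → Fin K}
    {R : Fin K → Prop} {v : Fin n} {es : List (Fin m)} (h : N.Chain col free u R v es) {i : Fin m}
    (hi : i ∈ es) : N.Inc u i ∧ col i ≠ none := by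
  induction es generalizing v with
  | nil => cases hi
  | cons e es ih =>
    obtain ⟨w, h1, h2, h3⟩ := h
    rcases List.mem_cons.1 hi with rfl | hi
    · exact ⟨h1.inc_left, by simp [h2]⟩
    · exact ih h3 hi

/-- Cutting the chain just before `f` ends it at the vertex whose free color is the color of `f`.
For a fan this is the earlier leaf that shares its missing color with the last one. -/
theorem Net.Chain.prefix {col : Fin m → Option (Fin K)} {free : Fin n → Fin K} {v : Fin n}
    {es : List (Fin m)} (h : N.Chain col free u (fun _ => True) v es) (hn : es.Nodup)
    (hf : f ∈ es) (hc : col f = some c)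
    (huniq : ∀ i ∈ es, col i = some c → i = f) :
    ∃ fs, N.Chain col free u (fun d => d = c) v fs ∧ fs.Nodup ∧ (∀ i ∈ fs, i ∈ es ∧ i ≠ f) := by
  induction es generalizing v with
  | nil => cases hf
  | cons e es ih =>
    obtain ⟨w, h1, h2, h3⟩ := h
    by_cases hef : e = f
    · subst hef
      rw [hc] at h2
      exact ⟨[], (Option.some.inj h2).symm, List.nodup_nil, by simp⟩
    · have hf' : f ∈ es := by
        rcases List.mem_cons.1 hf with h | h
        · exact absurd h.symm hef
        · exact h
      obtain ⟨fs, k1, k2, k3⟩ := ih h3 (List.nodup_cons.1 hn).2 hf'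
        fun i hi => huniq i (by simp [hi])
      refine ⟨e :: fs, ⟨w, h1, h2, k1⟩, List.nodup_cons.2 ⟨?_, k2⟩, ?_⟩
      · exact fun h => (List.nodup_cons.1 hn).1 (k3 _ h).1
      · intro i hi
        rcases List.mem_cons.1 hi with rfl | hi
        · exact ⟨by simp, hef⟩
        · exact ⟨by simp [(k3 i hi).1], (k3 i hi).2⟩

theorem length_lt_of_inc (hK : ∀ v : Fin n, {i | N.Inc v i}.ncard < K) {es : List (Fin m)}
    (hn : es.Nodup) (hi : ∀ i ∈ es, N.Inc u i) : es.length < K := by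
  classical
  refine lt_of_le_of_lt ?_ (hK u)
  rw [← List.toFinset_card_of_nodup hn, ← Set.ncard_coe_finset]
  exact Set.ncard_le_ncard fun i h => hi i (by simpa using h)

/-- Invariant of the construction of a fan at `u`; `st` marks the edges `es` of the fan. -/
structure FanInv (N : Net n m) (F : Set (Fin m)) (T M U₀ b q S : ℕ) (g : Cfg n m K) (id : ℕ)
    (z u : Fin n) (α c : Fin K) (e : Fin m) (st : Fin m → ℕ) (es : List (Fin m)) : Prop where
  busy : Busy N F T M U₀ b q S g id z u α c e
  chain : N.Chain g.col g.free u (fun _ => True) z es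
  nodup : es.Nodup
  stamp : ∀ i, st i = id ↔ i ∈ es
  own : ∀ i, g.own i ≠ id
  dead : ∀ i ∈ es, ¬ g.Live (g.own i)

/-- One step along the fan. -/
def Cfg.fanStep (g : Cfg n m K) (id : ℕ) (z u y : Fin n) (a c : Fin K) (e f : Fin m) :
    Cfg n m K :=
  (g.move id z u y a c e f).swap id y c f

/-- The new leaf `y` stocks the color `c` just freed by `f`, and `c` is now the color of `e`. So `e`
is the first edge of the chain that leads back from `y`. The old chain survives because `f`, and
with it the leaf `y`, did not occur in it. -/
theorem FanInv.step {st : Fin m → ℕ} {es : List (Fin m)}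
    (h : FanInv N F T M U₀ b q S g id z u α c e st es) (ht : g.tab u c = some f)
    (hf : N.Ends f u y) (hl : ¬ g.Live (g.own f)) (hs : f ∉ es) :
    FanInv N F T M U₀ b q S (g.fanStep id z u y α c e f) id y u α (g.free y) f
      (Function.update st e id) (e :: es) := by
  have d := h.busy.moveData ht hf
  have b1 := h.busy.move ht hf hl
  have b2 : Busy N F T M U₀ b q S (g.move id z u y α c e f) id y u α c f :=
    ⟨b1.base, b1.tok.swap_ends, b1.log, b1.id_pos⟩
  have hlive : ∀ j, (g.fanStep id z u y α c e f).Live j ↔ g.Live j := fun j =>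
    (b2.frame_swap.live j).trans ((h.busy.frame_move ht hf).live j)
  have hees : e ∉ es := fun he => (h.chain.mem he).2 d.col_e
  refine ⟨b2.swap, ⟨z, h.busy.tok.ends.symm, ?_, ?_⟩, List.nodup_cons.2 ⟨hees, h.nodup⟩, ?_,
    h.own, ?_⟩
  · change (g.move id z u y α c e f).col e = some (Function.update g.free y c y)
    rw [d.col_e']; simp
  · refine h.chain.congr (fun i hi => ?_) ?_ fun i hi w hw => ?_
    · refine d.col_of_ne ?_ ?_
      · rintro rfl; exact hees hi
      · rintro rfl; exact hs hi
    · change Function.update g.free y c z = _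
      rw [Function.update_of_ne d.z_ne_y]
    · change Function.update g.free y c w = _
      rw [Function.update_of_ne]
      rintro rfl
      exact hs (hw.eq_of hf ▸ hi)
  · intro i
    by_cases hi : i = e
    · simp [hi]
    · simp [hi, h.stamp]
  · intro i hi
    rw [hlive]
    rcases List.mem_cons.1 hi with rfl | hi
    · exact fun hj => h.busy.base.own_ne hj d.col_e rfl
    · exact h.dead i hi

/-- Invariant of the walk that starts with the edge `e₀` between `z₀` and `u`. The edges `es` have
been visited, and the edges `fs` lead back through the fan at `u`. -/
structure WalkInv (N : Net n m) (F : Set (Fin m)) (T M U₀ b q S : ℕ) (g : Cfg n m K) (id : ℕ)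
    (z x : Fin n) (a c : Fin K) (e : Fin m) (z₀ u : Fin n) (e₀ : Fin m) (α β : Fin K)
    (es fs : List (Fin m)) : Prop where
  busy : Busy N F T M U₀ b q S g id z x a c e
  trail : N.Trail g.col z a c es
  nodup : es.Nodup
  own : ∀ i, g.own i = id ↔ i ∈ es
  colors : (a = α ∧ c = β) ∨ (a = β ∧ c = α)
  ends₀ : N.Ends e₀ z₀ u
  start : es = [] → z = z₀ ∧ x = u ∧ e = e₀ ∧ c = β
  first : es ≠ [] → e₀ ∈ es ∧ g.col e₀ = some β
  visited : ∀ i ∈ es, ∀ y, N.Inc y i → y = z ∨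
    (∀ d, d = a ∨ d = c → ∃ j ∈ es, g.tab y d = some j) ∨ (i = e₀ ∧ y = z₀)
  chain : N.Chain g.col g.free u (fun d => d = β) z₀ fs
  fs_nodup : fs.Nodup
  fs_col : ∀ i ∈ fs, g.col i ≠ some α ∧ g.col i ≠ some β
  fs_dead : ∀ i ∈ fs, ¬ g.Live (g.own i)

/-- The chain is cut before the repeated edge `f`. The remaining edges have neither of the path
colors: `α` is missing at `u`, and `f` is the only edge at `u` of color `c`. So the walk to come
will not recolor them. -/
theorem FanInv.walk {st : Fin m → ℕ} {es : List (Fin m)}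
    (h : FanInv N F T M U₀ b q S g id z u α c e st es) (ht : g.tab u c = some f)
    (hs : f ∈ es) :
    ∃ fs, WalkInv N F T M U₀ b q S g id z u α c e z u e α c [] fs := by
  have k := h.busy.base.core
  have hcf := k.col_of_tab ht
  obtain ⟨fs, h1, h2, h3⟩ := h.chain.prefix h.nodup hs hcf fun i hi hic => by
    have := (k.tab_iff u c i).2 ⟨(h.chain.mem hi).1, hic⟩
    rw [ht] at this; exact (Option.some.inj this).symm
  refine ⟨fs, h.busy, trivial, List.nodup_nil, fun i => ?_, Or.inl ⟨rfl, rfl⟩,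
    h.busy.tok.ends, fun _ => ⟨rfl, rfl, rfl, rfl⟩, fun h => absurd rfl h, by simp, h1, h2,
    fun i hi => ⟨fun hic => ?_, fun hic => ?_⟩, fun i hi => h.dead i (h3 i hi).1⟩
  · simp [h.own i]
  · have := (k.tab_iff u α i).2 ⟨(h.chain.mem (h3 i hi).1).1, hic⟩
    rw [h.busy.tok.tab_x k] at this; cases this
  · have := (k.tab_iff u c i).2 ⟨(h.chain.mem (h3 i hi).1).1, hic⟩
    rw [ht] at this; exact (h3 i hi).2 (Option.some.inj this).symm

/-! ### Alternating walks. -/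

section Walk

variable {z₀ : Fin n} {e₀ : Fin m} {es fs : List (Fin m)}
  (h : WalkInv N F T M U₀ b q S g id z x a c e z₀ u e₀ α β es fs)
include h

/-- The vertex left behind becomes an inner vertex of the trail, with both path colors on trail
edges, except on the first step, where it is the starting leaf `z₀`. The chain back through the fan
avoids both path colors and is unaffected; no stocked color changes on a walk. -/
theorem WalkInv.step (ht : g.tab x c = some f)
    (hf : N.Ends f x y) (hl : ¬ g.Live (g.own f)) (ho : g.own f ≠ id) :
    WalkInv N F T M U₀ b q S ((g.mark id e).move id z x y a c e f) id x y c a f z₀ u e₀ α β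
      (e :: es) fs := by
  have k := h.busy.base.core
  have d := h.busy.moveData ht hf
  have hfes : f ∉ es := fun hm => ho ((h.own f).2 hm)
  have hfe : f ≠ e := d.e_ne_f.symm
  have hlm : ¬ (g.mark id e).Live ((g.mark id e).own f) := by
    change ¬ g.Live (Function.update g.own e id f)
    rwa [Function.update_of_ne hfe]
  have b1 := h.busy.mark
  have d1 := b1.moveData ht hf
  have b2 := b1.move ht hf hlm
  have hidl : ¬ g.Live id := not_live_of_log h.busy.log
  have hmem : ∀ {es v c₁ c₂}, N.Trail g.col v c₁ c₂ es → e ∉ es := by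
    intro es
    induction es with
    | nil => simp
    | cons e' es ih =>
      rintro v c₁ c₂ ⟨w, -, h2, h3⟩ hm
      rcases List.mem_cons.1 hm with rfl | hm
      · rw [d.col_e] at h2; cases h2
      · exact ih h3 hm
  have hees := hmem h.trail
  have hcol : ∀ i ∈ es, ((g.mark id e).move id z x y a c e f).col i = g.col i := by
    intro i hi
    refine d1.col_of_ne ?_ ?_
    · rintro rfl; exact hees hi
    · rintro rfl; exact hfes hi
  have hz : es ≠ [] → ∃ j ∈ es, g.tab z a = some j := by
    intro hne
    rcases es with _ | ⟨e', es⟩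
    · exact absurd rfl hne
    · obtain ⟨w, h1, h2, -⟩ := h.trail
      exact ⟨e', by simp, (k.tab_iff _ _ _).2 ⟨h1.inc_left, h2⟩⟩
  -- Behind the token, `z` now has color `c` on `e` and still has color `a` on the edge by which the
  -- trail reached it.
  have hztab : ∀ d', es ≠ [] → d' = c ∨ d' = a →
      ∃ j ∈ e :: es, ((g.mark id e).move id z x y a c e f).tab z d' = some j := by
    rintro d' hne (rfl | rfl)
    · exact ⟨e, by simp, by rw [d1.tab_eq]; simp⟩
    · obtain ⟨j, hj, hj'⟩ := hz hne
      refine ⟨j, by simp [hj], ?_⟩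
      rw [d1.tab_eq, if_neg fun h' => d.a_ne_c h'.1, if_neg fun h' => d.a_ne_c h'.1]
      exact hj'
  refine ⟨b2, ⟨z, h.busy.tok.ends.symm, d1.col_e', h.trail.congr hcol⟩,
    List.nodup_cons.2 ⟨hees, h.nodup⟩, fun i => ?_, ?_, h.ends₀, by simp, fun _ => ?_, ?_,
    ?_, h.fs_nodup, ?_, ?_⟩
  · change Function.update g.own e id i = id ↔ _
    by_cases hi : i = e
    · simp [hi]
    · simp [hi, h.own]
  · rcases h.colors with h' | h'
    · exact Or.inr ⟨h'.2, h'.1⟩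
    · exact Or.inl ⟨h'.2, h'.1⟩
  · by_cases hne : es = []
    · obtain ⟨-, -, h3, h4⟩ := h.start hne
      exact ⟨by simp [h3], by rw [← h3, d1.col_e', h4]⟩
    · obtain ⟨h1, h2⟩ := h.first hne
      exact ⟨by simp [h1], (hcol _ h1).trans h2⟩
  · intro i hi y' hy'
    by_cases hx : y' = x
    · exact Or.inl hx
    refine Or.inr ?_
    by_cases hyz : y' = z
    · subst hyz
      by_cases hne : es = []
      · obtain ⟨h1, -, h3, -⟩ := h.start hne
        subst hne
        simp only [List.mem_singleton] at hi
        exact Or.inr ⟨hi.trans h3, h1⟩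
      · exact Or.inl fun d' hd' => hztab d' hne hd'
    · rcases List.mem_cons.1 hi with rfl | hi
      · rcases h.busy.tok.ends.inc_iff.1 hy' with h' | h'
        · exact absurd h' hyz
        · exact absurd h' hx
      · rcases h.visited i hi y' hy' with h' | h' | h'
        · exact absurd h' hyz
        · refine Or.inl fun d' hd' => ?_
          obtain ⟨j, hj, hj'⟩ := h' d' hd'.symm
          refine ⟨j, by simp [hj], ?_⟩
          rw [d1.tab_eq, if_neg (by rintro ⟨-, h1 | h1⟩; exacts [hyz h1, hx h1]), if_neg]
          · exact hj'
          · rintro ⟨rfl, rfl⟩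
            rw [d.tab_y] at hj'
            exact hfes (Option.some.inj hj' ▸ hj)
        · exact Or.inr h'
  · refine h.chain.congr (fun i hi => d1.col_of_ne ?_ ?_) rfl fun _ _ _ _ => rfl
    · rintro rfl; exact (h.chain.mem hi).2 d.col_e
    · rintro rfl
      rcases h.colors with ⟨-, h'⟩ | ⟨-, h'⟩
      · exact (h.fs_col _ hi).2 (h' ▸ d.col_f)
      · exact (h.fs_col _ hi).1 (h' ▸ d.col_f)
  · intro i hi
    rw [d1.col_of_ne]
    · exact h.fs_col i hi
    · rintro rfl; exact (h.chain.mem hi).2 d.col_e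
    · rintro rfl
      rcases h.colors with ⟨-, h'⟩ | ⟨-, h'⟩
      · exact (h.fs_col _ hi).2 (h' ▸ d.col_f)
      · exact (h.fs_col _ hi).1 (h' ▸ d.col_f)
  · intro i hi
    rw [(b1.frame_move ht hf).live]
    change ¬ g.Live (Function.update g.own e id i)
    by_cases hie : i = e
    · simpa [hie] using hidl
    · simpa [hie] using h.fs_dead i hi

/-- A walk can meet itself only in its first edge. -/
theorem WalkInv.meets_start (ht : g.tab x c = some f) (ho : g.own f = id) :
    f = e₀ ∧ x = z₀ ∧ c = β ∧ a = α := by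
  have k := h.busy.base.core
  have hf := (h.own f).1 ho
  have h1 : f = e₀ ∧ x = z₀ := by
    -- The vertex `x` lies on the visited edge `f`. It is not `z`, and not an inner vertex of the
    -- trail, since those have an edge of color `a`, which is missing at `x`. Only the starting leaf
    -- remains.
    rcases h.visited f hf x (k.inc_of_tab ht) with h' | h' | h'
    · exact absurd h'.symm h.busy.tok.ends.ne
    · obtain ⟨j, -, hj⟩ := h' a (Or.inl rfl)
      rw [h.busy.tok.tab_x k] at hj; cases hj
    · exact h'
  have h2 := (h.first (List.ne_nil_of_mem hf)).2
  rw [← h1.1, k.col_of_tab ht] at h2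
  have h3 : c = β := Option.some.inj h2
  refine ⟨h1.1, h1.2, h3, ?_⟩
  rcases h.colors with h' | h'
  · exact h'.1
  · have hne : a ≠ c := by
      rintro rfl; rw [h.busy.tok.tab_x k] at ht; cases ht
    exact absurd (h'.1.trans h3.symm) hne

end Walk

/-- Invariant of the walk back through a fan at `u` after which the color `β` is missing at `u`. -/
structure UnfanInv (N : Net n m) (F : Set (Fin m)) (T M U₀ b q S : ℕ) (g : Cfg n m K) (id : ℕ)
    (z u : Fin n) (β c : Fin K) (e : Fin m) (fs : List (Fin m)) : Prop where
  busy : Busy N F T M U₀ b q S g id z u β c e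
  nodup : fs.Nodup
  dead : ∀ i ∈ fs, ¬ g.Live (g.own i)
  head : (fs = [] ∧ c = β) ∨ ∃ e' es' w, fs = e' :: es' ∧ N.Ends e' u w ∧ g.col e' = some c ∧
    N.Chain g.col g.free u (fun d => d = β) w es'

/-- One more move, over the first edge of the walk, brings the token back to the last leaf and `u`,
now with the two path colors exchanged, so that `β` is missing at `u`. After the leaf has traded the
color `α` for its stocked one, the chain `fs` leads the token to the leaf with stocked color `β`. -/
theorem WalkInv.unfan {z₀ : Fin n} {e₀ : Fin m} {es fs : List (Fin m)}
    (h : WalkInv N F T M U₀ b q S g id z x a c e z₀ u e₀ α β es fs)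
    (ht : g.tab x c = some f) (ho : g.own f = id) :
    N.Ends f x u ∧
    UnfanInv N F T M U₀ b q S ((g.move id z x u a c e f).swap id x a f) id x u c (g.free x) f fs
      := by
  obtain ⟨rfl, rfl, rfl, rfl⟩ := h.meets_start ht ho
  have hf := h.ends₀
  have hl : ¬ g.Live (g.own f) := by rw [ho]; exact not_live_of_log h.busy.log
  have d := h.busy.moveData ht hf
  have b1 := h.busy.move ht hf hl
  have hlive : ∀ j, ((g.move id z x u a c e f).swap id x a f).Live j ↔ g.Live j := fun j =>
    (b1.frame_swap.live j).trans ((h.busy.frame_move ht hf).live j)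
  have hcol : ∀ i ∈ fs, (g.move id z x u a c e f).col i = g.col i := by
    intro i hi
    refine d.col_of_ne ?_ ?_
    · rintro rfl; exact (h.chain.mem hi).2 d.col_e
    · rintro rfl; exact (h.fs_col _ hi).2 d.col_f
  refine ⟨hf, b1.swap, h.fs_nodup, fun i hi => ?_, ?_⟩
  · rw [hlive]; exact h.fs_dead i hi
  · rcases fs with _ | ⟨e', es'⟩
    · exact Or.inl ⟨rfl, h.chain⟩
    · obtain ⟨w, h1, h2, h3⟩ := h.chain
      refine Or.inr ⟨e', es', w, rfl, h1, (hcol _ (by simp)).trans h2,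
        h3.congr (fun i hi => hcol i (by simp [hi])) ?_ fun i hi w' hw => ?_⟩
      all_goals
        change Function.update g.free x a _ = _
        rw [Function.update_of_ne]
        rintro rfl
      · exact (h.fs_col e' (by simp)).2 (h1.symm.eq_of hf ▸ d.col_f)
      · exact (h.fs_col i (by simp [hi])).2 (hw.symm.eq_of hf ▸ d.col_f)

/-! ### Running the fan backwards. -/

section Unfan

variable {fs : List (Fin m)} (h : UnfanInv N F T M U₀ b q S g id z u β c e fs)
include h

/-- The edge found by the lookup is the head of the chain, so the loop consumes the chain and stops
at its end. There the held color is `β`, which is reserved at `u`; the lookup fails and the edge can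
be colored. -/
theorem UnfanInv.step (ht : g.tab u c = some f) (hf : N.Ends f u y) :
    ∃ fs', fs = f :: fs' ∧ UnfanInv N F T M U₀ b q S (g.fanStep id z u y β c e f) id y u β
      (g.free y) f fs' := by
  have k := h.busy.base.core
  rcases h.head with ⟨-, rfl⟩ | ⟨e', es', w, rfl, h1, h2, h3⟩
  · rw [h.busy.tok.tab_x k] at ht; cases ht
  · have he' : e' = f := by
      have := (k.tab_iff u c e').2 ⟨h1.inc_left, h2⟩
      rw [ht] at this; exact (Option.some.inj this).symm
    subst he'
    obtain rfl := h1.right_unique hf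
    have d := h.busy.moveData ht hf
    have b1 := h.busy.move ht hf (h.dead _ (by simp))
    have b2 : Busy N F T M U₀ b q S (g.move id z u w β c e e') id w u β c e' :=
      ⟨b1.base, b1.tok.swap_ends, b1.log, b1.id_pos⟩
    have hlive : ∀ j, (g.fanStep id z u w β c e e').Live j ↔ g.Live j := fun j =>
      (b2.frame_swap.live j).trans ((h.busy.frame_move ht hf).live j)
    have hnd := List.nodup_cons.1 h.nodup
    have hcol : ∀ i ∈ es', (g.move id z u w β c e e').col i = g.col i := by
      intro i hi
      refine d.col_of_ne ?_ ?_
      · rintro rfl; exact (h3.mem hi).2 d.col_e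
      · rintro rfl; exact hnd.1 hi
    refine ⟨es', rfl, b2.swap, hnd.2, fun i hi => ?_, ?_⟩
    · rw [hlive]; exact h.dead i (by simp [hi])
    · rcases es' with _ | ⟨e'', es''⟩
      · exact Or.inl ⟨rfl, h3⟩
      · obtain ⟨w', h4, h5, h6⟩ := h3
        refine Or.inr ⟨e'', es'', w', rfl, h4, (hcol _ (by simp)).trans h5,
          h6.congr (fun i hi => hcol i (by simp [hi])) ?_ fun i hi w'' hw => ?_⟩
        all_goals
          change Function.update g.free w c _ = _
          rw [Function.update_of_ne]
          rintro rfl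
        · exact hnd.1 (h4.eq_of h1 ▸ by simp)
        · exact hnd.1 (hw.eq_of h1 ▸ by simp [hi])

end Unfan

/-- Token `id` has met the trail of token `p` in the edge `f`, and `p` walks back to `f`. -/
structure CollInv (N : Net n m) (F : Set (Fin m)) (T M U₀ b q S : ℕ) (g : Cfg n m K) (id : ℕ)
    (z₁ x₁ : Fin n) (a₁ c₁ : Fin K) (e₁ f : Fin m) (p : ℕ) (z x : Fin n) (a c : Fin K)
    (e : Fin m) (es : List (Fin m)) : Prop where
  busy₁ : Busy N F T M U₀ b q S g id z₁ x₁ a₁ c₁ e₁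
  busy : Busy N F T M U₀ b q S g p z x a c e
  ne : p ≠ id
  tab : g.tab x₁ c₁ = some f
  trail : N.Trail g.col x c a es
  nodup : es.Nodup
  mem : f ∈ es
  own : ∀ i ∈ es, g.own i = p

/-- Withdrawing the record of `p` makes its trail dead, so `p` may recolor it. This costs one in the
count; the end of the collision earns it back. -/
theorem Busy.resume (h : Busy N F T M U₀ b q S g id z x a c e) (ht : g.tab x c = some f)
    {p : ℕ} (ho : g.own f = p) {z' x' : Fin n} {a' c' : Fin K} {e' : Fin m}
    (hlog : g.log p = .pend z' x' a' c' e') (hl : g.Live p) :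
    ∃ es, es.length = T ∧ CollInv N F T M U₀ b (q - 1) S (g.record p .none) id z x a c e f
      p z' x' a' c' e' es := by
  have hp : p ≠ id := by rintro rfl; exact not_live_of_log h.log hl
  obtain ⟨hb, es, h1, h2, h3, h4⟩ := h.base.resume hlog hl
  refine ⟨es, h3, ⟨hb.base, ⟨h.tok.ends, h.tok.hz, h.tok.hx, h.tok.only⟩, ?_, h.id_pos⟩, hb, hp,
    ht, h1, h2, (h4 f).1 ho, fun i hi => (h4 i).2 hi⟩
  simp [Cfg.record, Ne.symm hp, h.log]

/-! ### Collision of two tokens. -/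

section Coll

variable {z₁ x₁ : Fin n} {a₁ c₁ : Fin K} {e₁ : Fin m} {p : ℕ} {es : List (Fin m)}
  (h : CollInv N F T M U₀ b q S g id z₁ x₁ a₁ c₁ e₁ f p z x a c e es)
include h

theorem CollInv.next : ∃ f' es', es = f' :: es' ∧ g.tab x c = some f' := by
  have htr := h.trail
  rcases es with _ | ⟨f', es'⟩
  · cases h.mem
  · obtain ⟨w, h1, h2, -⟩ := htr
    exact ⟨f', es', rfl, (h.busy.base.core.tab_iff _ _ _).2 ⟨h1.inc_left, h2⟩⟩

/-- Token `p` retraces one edge other than `f`. The waiting token keeps its reservations, and `f`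
keeps its color, so `f` is still the next edge for it. -/
theorem CollInv.step {f' : Fin m} (ht : g.tab x c = some f') (hf : N.Ends f' x y)
    (hne : f' ≠ f) :
    ∃ es', es = f' :: es' ∧ CollInv N F T M U₀ b q S (g.move p z x y a c e f') id z₁ x₁ a₁ c₁ e₁ f
      p x y c a f' es' := by
  have k := h.busy.base.core
  obtain ⟨f'', es', rfl, ht'⟩ := h.next
  obtain rfl : f'' = f' := by rw [ht] at ht'; exact (Option.some.inj ht').symm
  have hl : ¬ g.Live (g.own f'') := by
    rw [h.own f'' (by simp)]; exact not_live_of_log h.busy.log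
  have d := h.busy.moveData ht hf
  have b1 := h.busy.move ht hf hl
  have hcf := k.col_of_tab h.tab
  have hfe : f ≠ e := by rintro rfl; rw [d.col_e] at hcf; cases hcf
  obtain ⟨w, h1, h2, h3⟩ := h.trail
  obtain rfl := h1.right_unique hf
  have hnd := List.nodup_cons.1 h.nodup
  have hmem : f ∈ es' := by
    rcases List.mem_cons.1 h.mem with h' | h'
    · exact absurd h'.symm hne
    · exact h'
  refine ⟨es', rfl, ⟨b1.base, d.tok_other h.ne.symm h.busy₁.tok, h.busy₁.log, h.busy₁.id_pos⟩, b1,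
    h.ne, ?_, h3.congr fun i hi => d.col_of_ne ?_ ?_, hnd.2, hmem,
    fun i hi => h.own i (by simp [hi])⟩
  · rw [d.core_move.tab_iff, d.col_of_ne hfe hne.symm]
    exact (k.tab_iff _ _ _).1 h.tab
  · rintro rfl
    clear hmem hnd
    generalize w = v, a = d₁, c = d₂ at h3
    have : ∀ {es : List (Fin m)} {v c₁ c₂}, N.Trail g.col v c₁ c₂ es → i ∉ es := by
      intro es
      induction es with
      | nil => simp
      | cons e' es ih =>
        rintro v c₁ c₂ ⟨w, -, h2, h3⟩ hm
        rcases List.mem_cons.1 hm with rfl | hm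
        · rw [d.col_e] at h2; cases h2
        · exact ih h3 hm
    exact this h3 hi
  · rintro rfl; exact hnd.1 hi

theorem CollInv.color_eq (ht : g.tab x c = some f) : c = c₁ := by
  have k := h.busy.base.core
  have h1 := k.col_of_tab ht
  rw [k.col_of_tab h.tab] at h1
  exact (Option.some.inj h1).symm

/-- Both tokens stand at the same end of `f` and want the same color. That this color differs from
the one missing at the center holds because `f` carries it there. -/
theorem CollInv.fan (hM : b < M) (ht : g.tab x c = some f) (hx : x = x₁) :
    Base N F T M U₀ b (q + 2) S (g.makeFan id z₁ x₁ z a₁ a c₁ e) := by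
  have hc := h.color_eq ht
  have hb := h.busy
  subst hx hc
  exact h.busy₁.makeFan hM hb h.ne (h.busy₁.moveData h.tab
    (h.busy.base.core.inc_of_tab h.tab).ends.choose_spec).a_ne_c

theorem CollInv.ends (ht : g.tab x c = some f) (hx : x ≠ x₁) : N.Ends f x x₁ := by
  have k := h.busy.base.core
  obtain ⟨y, hy⟩ := (k.inc_of_tab ht).ends
  rcases hy.inc_iff.1 (k.inc_of_tab h.tab) with h' | h'
  · exact absurd h'.symm hx
  · rw [h']; exact hy

/-- The tokens stand at opposite ends of `f`. When `p` moves over `f`, the color `c₁` leaves `x₁`,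
and the edge of the waiting token can be colored. Claim `p` is abandoned: its log entry is empty, so
it counts for nothing. -/
theorem CollInv.gain (ht : g.tab x c = some f) (hx : x ≠ x₁) :
    Busy N F T M U₀ b q S (g.move p z x x₁ a c e f) id z₁ x₁ a₁ c₁ e₁ ∧
      (g.move p z x x₁ a c e f).tab x₁ c₁ = none := by
  have hf := h.ends ht hx
  have hl : ¬ g.Live (g.own f) := by
    rw [h.own f h.mem]; exact not_live_of_log h.busy.log
  have d := h.busy.moveData ht hf
  have b1 := h.busy.move ht hf hl
  refine ⟨⟨b1.base, d.tok_other h.ne.symm h.busy₁.tok, h.busy₁.log, h.busy₁.id_pos⟩, ?_⟩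
  rw [← h.color_eq ht, d.tab_eq]
  simp [d.z_ne_y.symm, Ne.symm hx]

end Coll

end

end EdgeColoring

/-! ## Machine representation of configurations, and the basic blocks -/

namespace WordRAM

infixr:60 " ;; " => Prog.seq

@[simp] theorem setReg_reg_self (s : State) (x v : ℕ) : (s.setReg x v).reg x = v := by
  simp [State.setReg]

@[simp] theorem setReg_reg_ne (s : State) {x y : ℕ} (v : ℕ) (h : y ≠ x) :
    (s.setReg x v).reg y = s.reg y := by
  simp [State.setReg, h]

@[simp] theorem setReg_arr (s : State) (x v : ℕ) : (s.setReg x v).arr = s.arr := rfl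

@[simp] theorem setArr_reg (s : State) (a i v : ℕ) : (s.setArr a i v).reg = s.reg := rfl

@[simp] theorem setArr_arr_self (s : State) (a i v : ℕ) :
    (s.setArr a i v).arr a = Function.update (s.arr a) i v := by
  simp [State.setArr]

@[simp] theorem setArr_arr_ne (s : State) {a b : ℕ} (i v : ℕ) (h : b ≠ a) :
    (s.setArr a i v).arr b = s.arr b := by
  simp [State.setArr, h]

section

variable {B W : ℕ} {s : State} {Q : State → Prop} {p q : Prog}

theorem Run.assign_seq (hr : Room B W) (hs : s.Bdd B) {x : ℕ} {e : Expr} (he : e.small = true)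
    (hv : e.eval s ≤ B) {t : ℕ}
    (h : (s.setReg x (e.eval s)).Bdd B → Run B W q (s.setReg x (e.eval s)) t Q) :
    Run B W (.assign x e ;; q) s (e.cost + 1 + t) Q :=
  (Run.flat hr (p := .assign x e) he hs hv).seq
    (fun s' hb h' => by subst h'; exact h hb) le_rfl

theorem Run.store_seq (hr : Room B W) (hs : s.Bdd B) {a : ℕ} {i e : Expr}
    (he : (i.small && e.small) = true) (hv : e.eval s ≤ B) {t : ℕ}
    (h : (s.setArr a (i.eval s) (e.eval s)).Bdd B →
      Run B W q (s.setArr a (i.eval s) (e.eval s)) t Q) :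
    Run B W (.store a i e ;; q) s (i.cost + e.cost + 1 + t) Q :=
  (Run.flat hr (p := .store a i e) he hs hv).seq
    (fun s' hb h' => by subst h'; exact h hb) le_rfl

theorem Run.assign (hr : Room B W) (hs : s.Bdd B) {x : ℕ} {e : Expr} (he : e.small = true)
    (hv : e.eval s ≤ B) (h : Q (s.setReg x (e.eval s))) :
    Run B W (.assign x e) s (e.cost + 1) Q :=
  Run.flat' hr (p := .assign x e) he hs hv le_rfl h

theorem Run.store (hr : Room B W) (hs : s.Bdd B) {a : ℕ} {i e : Expr}
    (he : (i.small && e.small) = true) (hv : e.eval s ≤ B)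
    (h : Q (s.setArr a (i.eval s) (e.eval s))) :
    Run B W (.store a i e) s (i.cost + e.cost + 1) Q :=
  Run.flat' hr (p := .store a i e) he hs hv le_rfl h

theorem Run.skip (hs : s.Bdd B) (h : Q s) : Run B W .skip s 1 Q :=
  ⟨1, s, le_rfl, .skip s, hs, h⟩

/-- Branching, with the sum of the times of both branches as time bound. -/
theorem Run.ite_add (hr : Room B W) {b : Expr} (hs : s.Bdd B) (hb : b.small = true) {t₁ t₂ : ℕ}
    (hp : b.eval s ≠ 0 → Run B W p s t₁ Q) (hq : b.eval s = 0 → Run B W q s t₂ Q) :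
    Run B W (.ite b p q) s (b.cost + 1 + (t₁ + t₂)) Q :=
  Run.ite hr hs hb (fun h => (hp h).mono (by omega) fun _ _ h => h)
    (fun h => (hq h).mono (by omega) fun _ _ h => h) le_rfl

end

end WordRAM

namespace EdgeColoring

open WordRAM

section

variable {n m K l : ℕ}

/-- Vertex-color tables are stored row by row, so a write changes a single logical cell. -/
theorem index_inj {v v' c c' : ℕ} (hc : c < K) (hc' : c' < K) :
    v * K + c = v' * K + c' ↔ v = v' ∧ c = c' := by
  constructor
  · intro h
    have h1 : (v * K + c) / K = (v' * K + c') / K := by rw [h]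
    have hK : 0 < K := by omega
    rw [mul_comm v, mul_comm v', Nat.mul_add_div hK, Nat.mul_add_div hK, Nat.div_eq_of_lt hc,
      Nat.div_eq_of_lt hc'] at h1
    simp only [add_zero] at h1
    subst h1
    exact ⟨rfl, by omega⟩
  · rintro ⟨rfl, rfl⟩; rfl

@[simp] theorem index_fin_inj (v v' : Fin n) (c c' : Fin K) :
    ((v : ℕ) * K + c = (v' : ℕ) * K + c') ↔ v = v' ∧ c = c' := by
  rw [index_inj c.2 c'.2, Fin.val_inj, Fin.val_inj]

/-- Machine code of a reservation. -/
def idCode : Option (ℕ × Fin m) → ℕ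
  | none => 0
  | some (j, _) => j

/-- The arrays `14` to `19` of the memory hold the record `r` of claim `j`. -/
def HoldsRec (A : ℕ → ℕ → ℕ) (j : ℕ) : Rec n m K → Prop
  | .none => A 14 j = 0
  | .pend z x a c e => A 14 j = 1 ∧ A 15 j = z ∧ A 16 j = x ∧ A 17 j = a ∧ A 18 j = c ∧ A 19 j = e
  | .fan u v w α β => A 14 j = 2 ∧ A 15 j = u ∧ A 16 j = v ∧ A 17 j = w ∧ A 18 j = α ∧ A 19 j = β

/-- The arrays `A` hold the configuration `g`. -/
structure Rel (N : Net n m) (g : Cfg n m K) (A : ℕ → ℕ → ℕ) : Prop where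
  src : ∀ i : Fin m, A 0 i = N.src i
  tgt : ∀ i : Fin m, A 1 i = N.tgt i
  col : ∀ i : Fin m, A 2 i = labelCode (g.col i)
  tab : ∀ (v : Fin n) (c : Fin K), A 9 (v * K + c) = labelCode (g.tab v c)
  res : ∀ (v : Fin n) (c : Fin K), A 10 (v * K + c) = idCode (g.res v c)
  free : ∀ v : Fin n, A 11 v = g.free v
  own : ∀ i : Fin m, A 12 i = g.own i
  log : ∀ j, HoldsRec A j (g.log j)

/-- Fixed data of a run of the algorithm. -/
structure Par (n m K l : ℕ) where
  N : Net n m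
  U : Fin l → Fin m
  /-- The edges that are uncolored in the beginning. -/
  F₀ : Set (Fin m)
  /-- The maximal length of a walk. -/
  T : ℕ
  B : ℕ
  W : ℕ
  room : Room B W
  hn : n ≤ B
  hm : m + 1 ≤ B
  hK : K + 1 ≤ B
  hl : l + 1 ≤ B
  hT : T + 1 ≤ B
  deg : ∀ v : Fin n, {i | N.Inc v i}.ncard < K
  inj : Function.Injective U
  mem : ∀ j, U j ∈ F₀

/-- The number of edges that are uncolored in the beginning. -/
noncomputable def Par.U₀ (P : Par n m K l) : ℕ := P.F₀.ncard

/-- The uncolored edges that are left alone before round `k`. -/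
def Par.fut (P : Par n m K l) (k : ℕ) : Set (Fin m) := {e | e ∈ P.F₀ ∧ ∀ j : Fin l, j < k → P.U j ≠ e}

/-- The memory `s` holds the configuration `g` in round `k` with `S` successes so far; all stamps
are at most `b`. -/
structure Sync (P : Par n m K l) (s : State) (k b S : ℕ) (g : Cfg n m K) : Prop where
  bdd : s.Bdd P.B
  reg1 : s.reg 1 = m
  reg3 : s.reg 3 = l
  reg4 : s.reg 4 = K
  reg5 : s.reg 5 = P.T
  reg6 : s.reg 6 = k
  reg7 : s.reg 7 = S
  arr3 : ∀ j : Fin l, s.arr 3 j = P.U j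
  stamp : ∀ i : Fin m, s.arr 13 i ≤ b
  rel : Rel P.N g s.arr

theorem Sync.congr {P : Par n m K l} {s s' : State} {k b S : ℕ} {g g' : Cfg n m K}
    (h : Sync P s k b S g) (hb : s'.Bdd P.B) (hr : ∀ r < 8, s'.reg r = s.reg r)
    (h3 : s'.arr 3 = s.arr 3) (h13 : s'.arr 13 = s.arr 13) (hrel : Rel P.N g' s'.arr) :
    Sync P s' k b S g' :=
  ⟨hb, (hr 1 (by norm_num)).trans h.reg1, (hr 3 (by norm_num)).trans h.reg3,
    (hr 4 (by norm_num)).trans h.reg4, (hr 5 (by norm_num)).trans h.reg5,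
    (hr 6 (by norm_num)).trans h.reg6, (hr 7 (by norm_num)).trans h.reg7,
    fun j => by rw [h3]; exact h.arr3 j, fun i => by rw [h13]; exact h.stamp i, hrel⟩

theorem Sync.setReg {P : Par n m K l} {s : State} {k b S : ℕ} {g : Cfg n m K}
    (h : Sync P s k b S g) {x v : ℕ} (hb : (s.setReg x v).Bdd P.B) (hx : 8 ≤ x) :
    Sync P (s.setReg x v) k b S g :=
  h.congr hb (fun r hr => setReg_reg_ne _ _ (by omega)) rfl rfl h.rel

/-- Registers `8` to `13` hold a token. -/
structure TokRegs (s : State) (id : ℕ) (z x : Fin n) (a c : Fin K) (e : Fin m) : Prop where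
  z : s.reg 8 = z
  x : s.reg 9 = x
  a : s.reg 10 = a
  c : s.reg 11 = c
  e : s.reg 12 = e
  id : s.reg 13 = id

theorem TokRegs.congr {s s' : State} {id : ℕ} {z x : Fin n} {a c : Fin K} {e : Fin m}
    (h : TokRegs s id z x a c e) (hr : ∀ r, 8 ≤ r → r ≤ 13 → s'.reg r = s.reg r) :
    TokRegs s' id z x a c e :=
  ⟨(hr 8 (by norm_num) (by norm_num)).trans h.z, (hr 9 (by norm_num) (by norm_num)).trans h.x,
    (hr 10 (by norm_num) (by norm_num)).trans h.a, (hr 11 (by norm_num) (by norm_num)).trans h.c,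
    (hr 12 (by norm_num) (by norm_num)).trans h.e, (hr 13 (by norm_num) (by norm_num)).trans h.id⟩

theorem TokRegs.setReg {s : State} {id : ℕ} {z x : Fin n} {a c : Fin K} {e : Fin m}
    (h : TokRegs s id z x a c e) {r v : ℕ} (hr : 13 < r) :
    TokRegs (s.setReg r v) id z x a c e :=
  h.congr fun i _ _ => setReg_reg_ne _ _ (by omega)

/-- The cell of color `c` at vertex `v`. -/
def cellE (v c : Expr) : Expr := .op .add (.op .mul v (.reg 4)) c

/-- The recoloring step. -/
def moveProg : Prog :=
  .assign 15 (.op .sub (.op .add (.get 0 (.reg 14)) (.get 1 (.reg 14))) (.reg 9)) ;;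
  .store 2 (.reg 12) (.op .add (.reg 11) (.lit 1)) ;;
  .store 2 (.reg 14) (.lit 0) ;;
  .store 9 (cellE (.reg 8) (.reg 11)) (.op .add (.reg 12) (.lit 1)) ;;
  .store 9 (cellE (.reg 9) (.reg 11)) (.op .add (.reg 12) (.lit 1)) ;;
  .store 9 (cellE (.reg 15) (.reg 11)) (.lit 0) ;;
  .store 10 (cellE (.reg 8) (.reg 11)) (.lit 0) ;;
  .store 10 (cellE (.reg 15) (.reg 11)) (.reg 13)

/-- The token follows the recolored edge. -/
def shiftProg : Prog :=
  .assign 25 (.reg 10) ;;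
  .assign 10 (.reg 11) ;;
  .assign 11 (.reg 25) ;;
  .assign 8 (.reg 9) ;;
  .assign 9 (.reg 15) ;;
  .assign 12 (.reg 14)

/-- One step of a walk. -/
def walkProg : Prog := moveProg ;; shiftProg

/-- Exchange the held color with the free color. -/
def swapProg : Prog :=
  .assign 25 (.get 11 (.reg 8)) ;;
  .store 10 (cellE (.reg 8) (.reg 11)) (.lit 0) ;;
  .store 10 (cellE (.reg 8) (.reg 25)) (.reg 13) ;;
  .store 11 (.reg 8) (.reg 11) ;;
  .assign 11 (.reg 25)

/-- One step of a fan. -/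
def fanProg : Prog :=
  moveProg ;;
  .assign 8 (.reg 15) ;;
  .assign 12 (.reg 14) ;;
  swapProg

theorem HoldsRec.congr {A A' : ℕ → ℕ → ℕ} {j : ℕ} {r : Rec n m K} (h : HoldsRec A j r)
    (h' : ∀ i, 14 ≤ i → A' i j = A i j) : HoldsRec A' j r := by
  cases r <;> simp only [HoldsRec] at h ⊢ <;>
    simpa only [h' 14 (by norm_num), h' 15 (by norm_num), h' 16 (by norm_num),
      h' 17 (by norm_num), h' 18 (by norm_num), h' 19 (by norm_num)] using h

/-- This finds the other endpoint without a test for the orientation of the edge. -/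
theorem Net.Ends.sum_sub {N : Net n m} {f : Fin m} {x y : Fin n} (h : N.Ends f x y) :
    (N.src f : ℕ) + N.tgt f - x = y := by
  rcases h with ⟨rfl, rfl⟩ | ⟨rfl, rfl⟩ <;> omega

variable {P : Par n m K l} {s : State} {k b S : ℕ} {g : Cfg n m K} {id : ℕ} {z x y : Fin n}
  {a c : Fin K} {e f : Fin m} {F : Set (Fin m)}

/-- What the blocks leave unchanged. -/
structure Keeps (s s' : State) : Prop where
  reg : ∀ r, r < 8 ∨ r = 13 ∨ r = 14 ∨ (16 ≤ r ∧ r ≤ 24) → s'.reg r = s.reg r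
  arr3 : s'.arr 3 = s.arr 3
  arr13 : s'.arr 13 = s.arr 13

theorem Sync.keeps {s' : State} {g' : Cfg n m K} (h : Sync P s k b S g) (hk : Keeps s s')
    (hb : s'.Bdd P.B) (hrel : Rel P.N g' s'.arr) : Sync P s' k b S g' :=
  h.congr hb (fun r hr => hk.reg r (Or.inl hr)) hk.arr3 hk.arr13 hrel

theorem run_move (hs : Sync P s k b S g) (hr : TokRegs s id z x a c e) (hf : s.reg 14 = f)
    (d : MoveData P.N F g id z x y a c e f) :
    Run P.B P.W moveProg s moveProg.time (fun s' => Keeps s s' ∧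
      Sync P s' k b S (g.move id z x y a c e f) ∧ TokRegs s' id z x a c e ∧
      s'.reg 14 = f ∧ s'.reg 15 = y) := by
  have hy : s.arr 0 (s.reg 14) + s.arr 1 (s.reg 14) - s.reg 9 = y := by
    rw [hf, hr.x, hs.rel.src, hs.rel.tgt]; exact d.ends.sum_sub
  have hy' : s.arr 0 f + s.arr 1 f - (x : ℕ) = y := by rw [← hy, hf, hr.x]
  have hB := P.room.big
  have hm := P.hm
  have hn := P.hn
  have hK := P.hK
  have hb := hs.bdd
  refine (Run.flat P.room (by rfl) hb ?_).mono le_rfl ?_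
  · have := y.2
    have := e.2
    have := c.2
    have := hs.bdd.reg 13
    simp [moveProg, Prog.Safe, Prog.final, Expr.eval, Op.eval, cellE, hy, hr.c, hr.e]
    omega
  · rintro s' hb' rfl
    have hcol := hs.rel.col
    have htab := hs.rel.tab
    have hres := hs.rel.res
    have hkeep : Keeps s (moveProg.final s) := by
      refine ⟨fun r h => ?_, ?_, ?_⟩
      · have : r ≠ 15 := by omega
        simp [moveProg, Prog.final, this]
      · simp [moveProg, Prog.final]
      · simp [moveProg, Prog.final]
    refine ⟨hkeep, hs.keeps hkeep hb' ?_, hr.congr fun r h1 h2 => ?_, ?_, ?_⟩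
    · have h1 := d.z_ne_x
      have h2 := d.x_ne_y
      have h3 := d.z_ne_y
      have h4 := d.a_ne_c
      -- The memory stores claim numbers only, not the edges they are held for. The cell of `a` at
      -- `x` already contains `id`, so the program does not write it when the reservation passes
      -- from `e` to `f`.
      have h5 := d.tok.hx
      refine ⟨?_, ?_, fun i => ?_, fun v c' => ?_, fun v c' => ?_, ?_, ?_, fun j => ?_⟩
      · simpa [moveProg, Prog.final] using hs.rel.src
      · simpa [moveProg, Prog.final] using hs.rel.tgt
      · simp only [moveProg, Prog.final, Expr.eval, Op.eval, cellE, setReg_reg_self,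
          setReg_arr, setArr_reg, setArr_arr_self, hr.e, hr.c, hf, Function.update_apply, Cfg.move,
          ne_eq, not_false_eq_true, setArr_arr_ne, setReg_reg_ne,
          Nat.reduceEqDiff, Fin.val_inj]
        split_ifs <;> simp [labelCode, hcol]
      · simp only [moveProg, Prog.final, Expr.eval, Op.eval, cellE, setReg_reg_self,
          setReg_arr, setArr_reg, setArr_arr_self, hr.e, hr.c, hr.z, hr.x, hf, hy', hs.reg4,
          Function.update_apply, Cfg.move, upd, index_fin_inj,
          ne_eq, not_false_eq_true, setArr_arr_ne, setReg_reg_ne,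
          Nat.reduceEqDiff]
        split_ifs <;> simp [labelCode, htab]
      · simp only [moveProg, Prog.final, Expr.eval, Op.eval, cellE, setReg_reg_self,
          setReg_arr, setArr_reg, setArr_arr_self, hr.e, hr.c, hr.z, hr.x, hr.id, hf, hy', hs.reg4,
          Function.update_apply, Cfg.move, upd, index_fin_inj,
          ne_eq, not_false_eq_true, setArr_arr_ne, setReg_reg_ne,
          Nat.reduceEqDiff]
        split_ifs <;> grind [idCode]
      · simpa [moveProg, Prog.final, Cfg.move] using hs.rel.free
      · simpa [moveProg, Prog.final, Cfg.move] using hs.rel.own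
      · refine (hs.rel.log j).congr fun i hi => ?_
        have h1 : i ≠ 2 := by omega
        have h2 : i ≠ 9 := by omega
        have h3 : i ≠ 10 := by omega
        simp [moveProg, Prog.final, h1, h2, h3]
    · have : r ≠ 15 := by omega
      simp [moveProg, Prog.final, this]
    · simp [moveProg, Prog.final, hf]
    · simp [moveProg, Prog.final, Expr.eval, Op.eval, hy]

end

end EdgeColoring

/-! ## Steps of walks and fans, liveness test -/

namespace EdgeColoring

open WordRAM

section

variable {n m K l : ℕ} {P : Par n m K l} {s : State} {k b S : ℕ} {g : Cfg n m K} {id : ℕ}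
  {z x y : Fin n} {a c : Fin K} {e f : Fin m} {F : Set (Fin m)}

theorem Keeps.trans {s s' s'' : State} (h : Keeps s s') (h' : Keeps s' s'') : Keeps s s'' :=
  ⟨fun r hr => (h'.reg r hr).trans (h.reg r hr), h'.arr3.trans h.arr3, h'.arr13.trans h.arr13⟩

theorem run_walk (hs : Sync P s k b S g) (hr : TokRegs s id z x a c e) (hf : s.reg 14 = f)
    (d : MoveData P.N F g id z x y a c e f) :
    Run P.B P.W walkProg s walkProg.time (fun s' => Keeps s s' ∧
      Sync P s' k b S (g.move id z x y a c e f) ∧ TokRegs s' id x y c a f) := by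
  refine (run_move hs hr hf d).seq (Q' := _) ?_ le_rfl
  rintro s₁ hb₁ ⟨hk, hs₁, hr₁, hf₁, hy₁⟩
  refine (Run.flat P.room (by rfl) hb₁ ?_).mono le_rfl ?_
  · simp [shiftProg, Prog.Safe, Prog.final, Expr.eval, hb₁.reg]
  · rintro s' hb' rfl
    have hk' : Keeps s₁ (shiftProg.final s₁) := ⟨fun r h => ?_, rfl, rfl⟩
    refine ⟨hk.trans hk', hs₁.keeps hk' hb' hs₁.rel, ?_⟩
    · constructor <;> simp [shiftProg, Prog.final, Expr.eval, hr₁.x, hr₁.a, hr₁.c, hr₁.id, hf₁, hy₁]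
    · have h8 : r ≠ 8 := by omega
      have h9 : r ≠ 9 := by omega
      have h10 : r ≠ 10 := by omega
      have h11 : r ≠ 11 := by omega
      have h12 : r ≠ 12 := by omega
      have h25 : r ≠ 25 := by omega
      simp [shiftProg, Prog.final, h8, h9, h10, h11, h12, h25]

theorem run_swap (hs : Sync P s k b S g) (hr : TokRegs s id z x a c e) :
    Run P.B P.W swapProg s swapProg.time (fun s' => Keeps s s' ∧
      Sync P s' k b S (g.swap id z c e) ∧ TokRegs s' id z x a (g.free z) e) := by
  have hB := P.room.big
  have hb := hs.bdd
  have hfr : s.arr 11 z = g.free z := hs.rel.free z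
  refine (Run.flat P.room (by rfl) hb ?_).mono le_rfl ?_
  · simp [swapProg, Prog.Safe, Prog.final, Expr.eval, hb.reg, hb.arr]
  · rintro s' hb' rfl
    have hkeep : Keeps s (swapProg.final s) := by
      refine ⟨fun r h => ?_, ?_, ?_⟩
      · have h11 : r ≠ 11 := by omega
        have h25 : r ≠ 25 := by omega
        simp [swapProg, Prog.final, h11, h25]
      · simp [swapProg, Prog.final]
      · simp [swapProg, Prog.final]
    refine ⟨hkeep, hs.keeps hkeep hb' ?_, ?_⟩
    · refine ⟨?_, ?_, ?_, ?_, fun v c' => ?_, fun v => ?_, ?_, fun j => ?_⟩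
      · simpa [swapProg, Prog.final] using hs.rel.src
      · simpa [swapProg, Prog.final] using hs.rel.tgt
      · simpa [swapProg, Prog.final, Cfg.swap] using hs.rel.col
      · simpa [swapProg, Prog.final, Cfg.swap] using hs.rel.tab
      · have hres := hs.rel.res
        simp only [swapProg, Prog.final, Expr.eval, Op.eval, cellE, setReg_reg_self,
          setReg_arr, setArr_reg, setArr_arr_self, hr.c, hr.z, hr.id, hs.reg4, hfr,
          Function.update_apply, Cfg.swap, upd, index_fin_inj,
          ne_eq, not_false_eq_true, setArr_arr_ne, setReg_reg_ne,
          Nat.reduceEqDiff]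
        split_ifs <;> simp [idCode, hres]
      · have hfree := hs.rel.free
        simp only [swapProg, Prog.final, Expr.eval, Op.eval, cellE, setReg_reg_self,
          setReg_arr, setArr_reg, setArr_arr_self, hr.c, hr.z, hr.id, hs.reg4, hfr,
          Function.update_apply, Cfg.swap,
          ne_eq, not_false_eq_true, setArr_arr_ne, setReg_reg_ne,
          Nat.reduceEqDiff, Fin.val_inj]
        split_ifs <;> simp [hfree]
      · simpa [swapProg, Prog.final, Cfg.swap] using hs.rel.own
      · refine (hs.rel.log j).congr fun i hi => ?_
        have h2 : i ≠ 11 := by omega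
        have h3 : i ≠ 10 := by omega
        simp [swapProg, Prog.final, h2, h3]
    · constructor <;> simp [swapProg, Prog.final, Expr.eval, hr.z, hr.x, hr.a, hr.c, hr.id, hr.e,
        hfr]

theorem run_fan (hs : Sync P s k b S g) (hr : TokRegs s id z x a c e) (hf : s.reg 14 = f)
    (d : MoveData P.N F g id z x y a c e f) :
    Run P.B P.W fanProg s fanProg.time (fun s' => Keeps s s' ∧
      Sync P s' k b S (g.fanStep id z x y a c e f) ∧ TokRegs s' id y x a (g.free y) f) := by
  refine (run_move hs hr hf d).seq (Q' := _) ?_ le_rfl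
  rintro s₁ hb₁ ⟨hk, hs₁, hr₁, hf₁, hy₁⟩
  refine Run.assign_seq P.room hb₁ (by rfl) (by exact hb₁.reg _) fun hb₂ => ?_
  refine Run.assign_seq P.room hb₂ (by rfl) (by exact hb₂.reg _) fun hb₃ => ?_
  simp only [Expr.eval] at hb₃ ⊢
  have hk' : Keeps s₁ ((s₁.setReg 8 (s₁.reg 15)).setReg 12 ((s₁.setReg 8 (s₁.reg 15)).reg 14)) := by
    refine ⟨fun r h => ?_, rfl, rfl⟩
    have h8 : r ≠ 8 := by omega
    have h12 : r ≠ 12 := by omega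
    simp [h8, h12]
  have hr₂ : TokRegs ((s₁.setReg 8 (s₁.reg 15)).setReg 12 ((s₁.setReg 8 (s₁.reg 15)).reg 14))
      id y x a c f := by
    constructor <;> simp [hr₁.x, hr₁.a, hr₁.c, hr₁.id, hf₁, hy₁]
  refine (run_swap (hs₁.keeps hk' hb₃ hs₁.rel) hr₂).mono le_rfl ?_
  rintro s' hb' ⟨h1, h2, h3⟩
  exact ⟨(hk.trans hk').trans h1, h2, h3⟩

/-- Is the claim in register `17` a live pending token? -/
def liveE : Expr :=
  .op .mul (.op .eq (.get 14 (.reg 17)) (.lit 1))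
    (.op .mul
      (.op .eq (.get 10 (cellE (.get 15 (.reg 17)) (.get 18 (.reg 17)))) (.reg 17))
      (.op .eq (.get 10 (cellE (.get 16 (.reg 17)) (.get 17 (.reg 17)))) (.reg 17)))

theorem idCode_eq {o : Option (ℕ × Fin m)} {j : ℕ} (hj : j ≠ 0) :
    idCode o = j ↔ ∃ e, o = some (j, e) := by
  rcases o with _ | ⟨i, e⟩
  · simp [idCode, Ne.symm hj]
  · simp only [idCode, Option.some.injEq, Prod.mk.injEq]
    constructor
    · rintro rfl; exact ⟨e, rfl, rfl⟩
    · rintro ⟨e', rfl, -⟩; rfl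

/-- Comparing claim numbers at two cells is enough, although the edges are not stored: whatever a
pending claim holds, it holds for its recorded edge. Claim `0`, whose number also encodes an absent
reservation, has an empty log and fails the first factor. -/
theorem liveE_iff {N : Net n m} {T M U₀ b' q S' : ℕ} (hrel : Rel N g s.arr) (h4 : s.reg 4 = K)
    (hb : Base N F T M U₀ b' q S' g) {j : ℕ} (hj : s.reg 17 = j) :
    liveE.eval s ≠ 0 ↔ g.Live j := by
  have hl := hrel.log j
  simp only [liveE, Expr.eval, Op.eval, cellE, hj, h4]
  rcases hlog : g.log j with _ | ⟨z, x, a, c, e⟩ | ⟨u, v, w, α, β⟩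
  · rw [hlog] at hl
    simp only [HoldsRec] at hl
    simp [hl, not_live_of_log hlog]
  · rw [hlog] at hl
    obtain ⟨h1, h2, h3, h4, h5, h6⟩ := hl
    have hj0 : j ≠ 0 := by
      rintro rfl; rw [hb.log_none 0 (Or.inl rfl)] at hlog; cases hlog
    have hp := (hb.claims.pend _ _ _ _ _ _ hlog).2
    simp only [h1, h2, h3, h4, h5, hrel.res, idCode_eq hj0, if_true]
    constructor
    · intro h
      by_cases hA : ∃ e, g.res z c = some (j, e)
      · by_cases hB : ∃ e, g.res x a = some (j, e)
        · obtain ⟨e₁, hA⟩ := hA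
          obtain ⟨e₂, hB⟩ := hB
          obtain rfl := hp _ _ _ hA
          obtain rfl := hp _ _ _ hB
          exact ⟨_, _, _, _, _, hlog, hA, hB⟩
        · simp [hB] at h
      · simp [hA] at h
    · rintro ⟨z', x', a', c', e', hl', hA, hB⟩
      rw [hlog] at hl'; cases hl'
      simp [hA, hB]
  · rw [hlog] at hl
    simp only [HoldsRec] at hl
    simp only [hl.1]
    refine iff_of_false (by simp) ?_
    rintro ⟨_, _, _, _, _, h, -⟩
    rw [hlog] at h; cases h

end

end EdgeColoring

/-! ## The loops of one round -/

namespace EdgeColoring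

open WordRAM

/-- The content of register `i` equals `j`. -/
def isE (i j : ℕ) : Expr := .op .eq (.reg i) (.lit j)

/-- Table entry for the vertex in register `9` and the color in register `11`. -/
def tabE : Expr := .get 9 (cellE (.reg 9) (.reg 11))

/-- One round of the fan loop. -/
def fanBody : Prog :=
  .assign 14 tabE ;;
  .ite (.reg 14)
    (.assign 14 (.op .sub (.reg 14) (.lit 1)) ;;
      .assign 17 (.get 12 (.reg 14)) ;;
      .ite liveE (.assign 16 (.lit 2))
        (.ite (.op .eq (.get 13 (.reg 14)) (.reg 13)) (.assign 16 (.lit 3))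
          (.store 13 (.reg 12) (.reg 13) ;; fanProg)))
    (.assign 16 (.lit 1))

/-- One round of the walk loop. -/
def walkBody : Prog :=
  .assign 14 tabE ;;
  .ite (.reg 14)
    (.assign 14 (.op .sub (.reg 14) (.lit 1)) ;;
      .assign 17 (.get 12 (.reg 14)) ;;
      .ite (.op .eq (.reg 17) (.reg 13)) (.assign 16 (.lit 4))
        (.ite liveE (.assign 16 (.lit 2))
          (.ite (.op .lt (.reg 24) (.reg 5))
            (.store 12 (.reg 12) (.reg 13) ;; .assign 24 (.op .add (.reg 24) (.lit 1)) ;; walkProg)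
            (.assign 16 (.lit 5)))))
    (.assign 16 (.lit 1))

section

variable {n m K l : ℕ} (P : Par n m K l)

/-- The memory in the middle of round `k`. -/
structure Mid (s : State) (k q S : ℕ) (g : Cfg n m K) (z x : Fin n) (a c : Fin K)
    (e : Fin m) : Prop where
  sync : Sync P s k (k + 1) S g
  regs : TokRegs s (k + 1) z x a c e
  busy : Busy P.N (P.fut (k + 1)) P.T (l + 1) P.U₀ (k + 1) q S g (k + 1) z x a c e

/-- The token can be colored. -/
def AtEnd (k : ℕ) (s : State) : Prop :=
  ∃ q S g z x a c e, Mid P s k q S g z x a c e ∧ k ≤ q + 1 ∧ g.tab x c = none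

/-- The token has met the trail of a live pending token. -/
def AtHit (k : ℕ) (s : State) : Prop :=
  ∃ S g z x a c e f, Mid P s k k S g z x a c e ∧ g.tab x c = some f ∧ s.reg 14 = f ∧
    s.reg 17 = g.own f ∧ g.Live (g.own f)

/-- The fan is finished and a walk can begin. -/
def AtWalk (k : ℕ) (s : State) : Prop :=
  ∃ S g z x a c e fs, Mid P s k k S g z x a c e ∧
    WalkInv P.N (P.fut (k + 1)) P.T (l + 1) P.U₀ (k + 1) k S g (k + 1) z x a c e z x e a c [] fs

/-- The walk has met itself. -/
def AtBad (k : ℕ) (s : State) : Prop :=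
  ∃ S g z x a c e z₀ u e₀ α β es fs f, Mid P s k k S g z x a c e ∧
    WalkInv P.N (P.fut (k + 1)) P.T (l + 1) P.U₀ (k + 1) k S g (k + 1) z x a c e z₀ u e₀ α β es
      fs ∧ g.tab x c = some f ∧ g.own f = k + 1 ∧ s.reg 14 = f

/-- The walk has reached the maximal length. -/
def AtPend (k : ℕ) (s : State) : Prop :=
  ∃ S g z x a c e es, Mid P s k k S g z x a c e ∧ P.N.Trail g.col z a c es ∧ es.Nodup ∧
    es.length = P.T ∧ ∀ i, g.own i = k + 1 ↔ i ∈ es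

/-- The token has been dealt with. -/
def AtDone (k : ℕ) (s : State) : Prop :=
  ∃ S g, Sync P s k (k + 1) S g ∧
    Base P.N (P.fut (k + 1)) P.T (l + 1) P.U₀ (k + 1) (k + 1) S g

/-- The outcomes of the fan loop. -/
def AfterFan (k : ℕ) (s : State) : Prop :=
  (s.reg 16 = 1 ∧ AtEnd P k s) ∨ (s.reg 16 = 2 ∧ AtHit P k s) ∨ (s.reg 16 = 3 ∧ AtWalk P k s)

/-- The outcomes of the walk loop. -/
def AfterWalk (k : ℕ) (s : State) : Prop :=
  (s.reg 16 = 1 ∧ AtEnd P k s) ∨ (s.reg 16 = 2 ∧ AtHit P k s) ∨ (s.reg 16 = 4 ∧ AtBad P k s) ∨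
    (s.reg 16 = 5 ∧ AtPend P k s)

variable {P} {s : State} {k q S : ℕ} {g : Cfg n m K} {z x y : Fin n} {a c : Fin K} {e f : Fin m}

theorem Mid.setReg (h : Mid P s k q S g z x a c e) {r v : ℕ} (hb : (s.setReg r v).Bdd P.B)
    (hr : 13 < r) : Mid P (s.setReg r v) k q S g z x a c e :=
  ⟨h.sync.setReg hb (by omega), h.regs.setReg hr, h.busy⟩

theorem Mid.tabE (h : Mid P s k q S g z x a c e) : tabE.eval s = labelCode (g.tab x c) := by
  simp only [EdgeColoring.tabE, cellE, Expr.eval, Op.eval, h.regs.x, h.regs.c, h.sync.reg4]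
  exact h.sync.rel.tab x c

theorem Mid.tabE_le (h : Mid P s k q S g z x a c e) : EdgeColoring.tabE.eval s ≤ P.B :=
  h.sync.bdd.arr _ _

theorem Mid.live_iff (h : Mid P s k q S g z x a c e) {j : ℕ} (hj : s.reg 17 = j) :
    liveE.eval s ≠ 0 ↔ g.Live j :=
  liveE_iff h.sync.rel h.sync.reg4 h.busy.base hj

theorem Par.one_le (P : Par n m K l) : 16 ≤ P.B := P.room.big

/-- Look up the next edge. -/
theorem Mid.lookup (h : Mid P s k q S g z x a c e) {p p' : Prog} {t t' : ℕ} {Q : State → Prop}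
    (hsome : ∀ f s', g.tab x c = some f → Mid P s' k q S g z x a c e → s'.reg 14 = f →
      s'.reg 17 = g.own f → (∀ r, r ≠ 14 → r ≠ 17 → s'.reg r = s.reg r) → s'.arr = s.arr →
      Run P.B P.W p s' t Q)
    (hnone : ∀ s', g.tab x c = none → Mid P s' k q S g z x a c e → s'.arr = s.arr →
      Run P.B P.W p' s' t' Q) :
    Run P.B P.W
      (.assign 14 EdgeColoring.tabE ;;
        .ite (.reg 14)
          (.assign 14 (.op .sub (.reg 14) (.lit 1)) ;; .assign 17 (.get 12 (.reg 14)) ;; p)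
          p') s (16 + t + t') Q := by
  refine Run.mono (Run.assign_seq P.room h.sync.bdd (by rfl) h.tabE_le (t := 9 + t + t')
    fun hb₁ => ?_) ?_ fun _ _ h => h
  · rw [h.tabE] at hb₁ ⊢
    have h₁ := h.setReg hb₁ (by norm_num)
    refine (Run.ite_add P.room hb₁ (by rfl) (t₁ := 3 + 1 + (2 + 1 + t)) (t₂ := t')
      (fun h0 => ?_) fun h0 => ?_).mono (by simp [Expr.cost]; omega) fun _ _ h => h
    · simp only [Expr.eval, setReg_reg_self] at h0
      obtain ⟨f, hf⟩ : ∃ f, g.tab x c = some f := by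
        rcases hf : g.tab x c with _ | f
        · simp [hf, labelCode] at h0
        · exact ⟨f, rfl⟩
      have hlc : labelCode (g.tab x c) = f + 1 := by rw [hf]; rfl
      refine Run.assign_seq P.room hb₁ (by rfl) ?_ fun hb₂ => ?_
      · have := hb₁.reg 14
        simp only [Expr.eval, Op.eval]; omega
      refine Run.assign_seq P.room hb₂ (by rfl) (by exact hb₂.arr _ _) fun hb₃ => ?_
      simp only [Expr.eval, Op.eval, setReg_reg_self, setReg_arr, hlc, Nat.add_sub_cancel] at *
      rw [h.sync.rel.own f] at hb₃ ⊢
      refine hsome f _ hf ((h₁.setReg hb₂ (by norm_num)).setReg hb₃ (by norm_num)) ?_ ?_ ?_ rfl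
      · simp
      · simp
      · intro r h14 h17
        simp [h14, h17]
    · simp only [Expr.eval, setReg_reg_self] at h0
      refine hnone _ ?_ h₁ rfl
      rcases hf : g.tab x c with _ | f
      · rfl
      · simp [hf, labelCode] at h0
  · simp [EdgeColoring.tabE, cellE, Expr.cost]; omega

end

end EdgeColoring

/-! ## Correctness of the fan loop and of the walk loop -/

namespace EdgeColoring

open WordRAM

section

variable {n m K l : ℕ} {P : Par n m K l} {s : State} {k q S : ℕ} {g : Cfg n m K} {z x y u : Fin n}
  {a c α : Fin K} {e f : Fin m}

/-- Invariant of the fan loop. -/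
def FanLoop (P : Par n m K l) (k N : ℕ) (s : State) : Prop :=
  (s.reg 16 = 0 ∧ ∃ S g z u α c e es, Mid P s k k S g z u α c e ∧
    FanInv P.N (P.fut (k + 1)) P.T (l + 1) P.U₀ (k + 1) k S g (k + 1) z u α c e
      (fun i => s.arr 13 i) es ∧ N + es.length = K) ∨ AfterFan P k s

theorem Rel.congr {N : Net n m} {A A' : ℕ → ℕ → ℕ} (h : Rel N g A)
    (h' : ∀ i, i ≠ 3 → i ≠ 13 → A' i = A i) : Rel N g A' := by
  refine ⟨?_, ?_, ?_, ?_, ?_, ?_, ?_, fun j => (h.log j).congr fun i hi => ?_⟩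
  · simpa only [h' 0 (by norm_num) (by norm_num)] using h.src
  · simpa only [h' 1 (by norm_num) (by norm_num)] using h.tgt
  · simpa only [h' 2 (by norm_num) (by norm_num)] using h.col
  · simpa only [h' 9 (by norm_num) (by norm_num)] using h.tab
  · simpa only [h' 10 (by norm_num) (by norm_num)] using h.res
  · simpa only [h' 11 (by norm_num) (by norm_num)] using h.free
  · simpa only [h' 12 (by norm_num) (by norm_num)] using h.own
  · rw [h' i (by omega) (by omega)]

theorem Mid.stamp (h : Mid P s k q S g z x a c e) {i : ℕ}
    (hb : (s.setArr 13 i (k + 1)).Bdd P.B) : Mid P (s.setArr 13 i (k + 1)) k q S g z x a c e := by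
  refine ⟨⟨hb, h.sync.reg1, h.sync.reg3, h.sync.reg4, h.sync.reg5, h.sync.reg6, h.sync.reg7,
    by simpa using h.sync.arr3, fun j => ?_, h.sync.rel.congr fun i _ h13 => by simp [h13]⟩,
    h.regs.congr fun _ _ _ => rfl, h.busy⟩
  simp only [setArr_arr_self, Function.update_apply]
  split
  · exact le_rfl
  · exact h.sync.stamp j

/-- Register `16` is the mode: zero while the loop runs, otherwise the reason for leaving. The exit
states belong to the invariant with `0` rounds left, so that a single invariant covers all ways out.
-/
theorem run_fanLoop (hI : FanLoop P k K s) (hb : s.Bdd P.B) :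
    Run P.B P.W (.while (isE 16 0) fanBody) s ((K + 1) * (500)) (AfterFan P k) := by
  refine (Run.while P.room (by rfl) (FanLoop P k) (t := 16 + 450 + 2) ?_ hb hI).mono
    (by simp only [isE, Expr.cost]; gcongr; norm_num) ?_
  swap
  · rintro s' - ⟨h0, M, ⟨h1, -⟩ | h1⟩
    · simp [isE, Expr.eval, Op.eval, h1] at h0
    · exact h1
  rintro N s hb hI h0
  replace h0 : s.reg 16 = 0 := by
    by_contra h; simp [isE, Expr.eval, Op.eval, h] at h0
  rcases hI with ⟨-, S, g, z, u, α, c, e, es, hm, hf, hN⟩ | hI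
  swap
  · rcases hI with ⟨h, -⟩ | ⟨h, -⟩ | ⟨h, -⟩ <;> omega
  -- The edges of the fan are distinct edges at `u`, fewer than `K`; hence the round counter is
  -- still positive.
  have hlen := length_lt_of_inc P.deg hf.nodup fun i hi => (hf.chain.mem hi).1
  have hpos : 0 < N := by omega
  have hB := P.one_le
  refine hm.lookup (t := 450) (t' := 2) (fun f s₁ ht hm₁ h14 h17 hreg harr => ?_)
    fun s₁ ht hm₁ harr => ?_
  swap
  · refine Run.assign P.room hm₁.sync.bdd (by rfl) (by simp only [Expr.eval]; omega)
      ⟨0, hpos, Or.inr (Or.inl ⟨by simp [Expr.eval], k, S, g, z, u, α, c, e, ?_, by omega, ht⟩)⟩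
    exact hm₁.setReg (hm₁.sync.bdd.setReg (by simp only [Expr.eval]; omega)) (by norm_num)
  have hb₁ := hm₁.sync.bdd
  refine (Run.ite_add P.room hb₁ (by rfl) (t₁ := 2) (t₂ := 300) (fun hl => ?_) fun hl => ?_).mono
    (by simp [liveE, cellE, Expr.cost]) fun _ _ h => h
  · refine Run.assign P.room hb₁ (by rfl) (by simp only [Expr.eval]; omega)
      ⟨0, hpos, Or.inr (Or.inr (Or.inl ⟨by simp [Expr.eval], S, g, z, u, α, c, e, f, ?_, ht,
        by simpa using h14, by simpa using h17, (hm₁.live_iff h17).1 hl⟩))⟩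
    exact hm₁.setReg (hb₁.setReg (by simp only [Expr.eval]; omega)) (by norm_num)
  have hl' : ¬ g.Live (g.own f) := fun h => (hm₁.live_iff h17).2 h hl
  refine (Run.ite_add P.room hb₁ (by rfl) (t₁ := 2) (t₂ := 250) (fun hst => ?_)
    fun hst => ?_).mono (by simp [Expr.cost]) fun _ _ h => h
  · have hst' : f ∈ es := by
      rw [← hf.stamp]
      by_contra h
      simp [Expr.eval, Op.eval, h14, hm₁.regs.id, harr, h] at hst
    obtain ⟨fs, hw⟩ := hf.walk ht hst'
    refine Run.assign P.room hb₁ (by rfl) (by simp only [Expr.eval]; omega)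
      ⟨0, hpos, Or.inr (Or.inr (Or.inr ⟨by simp [Expr.eval], S, g, z, u, α, c, e, fs, ?_, hw⟩))⟩
    exact hm₁.setReg (hb₁.setReg (by simp only [Expr.eval]; omega)) (by norm_num)
  · have hst' : f ∉ es := by
      rw [← hf.stamp]
      intro h
      simp [Expr.eval, Op.eval, h14, hm₁.regs.id, harr, h] at hst
    refine (Run.store_seq P.room hb₁ (by rfl) (by exact hb₁.reg _) (t := fanProg.time)
      fun hb₂ => ?_).mono (by decide) fun _ _ h => h
    simp only [Expr.eval, hm₁.regs.id, hm₁.regs.e] at hb₂ ⊢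
    have hm₂ := hm₁.stamp hb₂
    obtain ⟨y, hy⟩ := (hf.busy.base.core.inc_of_tab ht).ends
    refine (run_fan hm₂.sync hm₂.regs (by simpa using h14)
      (hf.busy.moveData ht hy)).mono le_rfl ?_
    rintro s₃ hb₃ ⟨hk, hs₃, hr₃⟩
    have hstep := hf.step ht hy hl' hst'
    refine ⟨N - 1, by omega, Or.inl ⟨?_, S, _, _, _, _, _, _, e :: es, ⟨hs₃, hr₃, hstep.busy⟩,
      ?_, by simp; omega⟩⟩
    · rw [hk.reg 16 (by norm_num)]
      simp [hreg, h0]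
    -- Writing the claim number into array `13` at `e` is the update of the stamps that the fan step
    -- asks for.
    · convert hstep using 1
      funext i
      rw [hk.arr13]
      simp [Function.update_apply, harr, Fin.val_inj]

/-- Invariant of the walk loop. -/
def WalkLoop (P : Par n m K l) (k N : ℕ) (s : State) : Prop :=
  (s.reg 16 = 0 ∧ ∃ S g z x a c e z₀ u e₀ α β es fs, Mid P s k k S g z x a c e ∧
    WalkInv P.N (P.fut (k + 1)) P.T (l + 1) P.U₀ (k + 1) k S g (k + 1) z x a c e z₀ u e₀ α β es
      fs ∧ s.reg 24 = es.length ∧ N + es.length = P.T + 1 ∧ es.length ≤ P.T) ∨ AfterWalk P k s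

theorem Mid.mark (h : Mid P s k q S g z x a c e)
    (hb : (s.setArr 12 e (k + 1)).Bdd P.B) :
    Mid P (s.setArr 12 e (k + 1)) k q S (g.mark (k + 1) e) z x a c e := by
  have hrel := h.sync.rel
  refine ⟨⟨hb, h.sync.reg1, h.sync.reg3, h.sync.reg4, h.sync.reg5, h.sync.reg6, h.sync.reg7,
    by simpa using h.sync.arr3, by simpa using h.sync.stamp, ⟨by simpa using hrel.src,
    by simpa using hrel.tgt, by simpa [Cfg.mark] using hrel.col, by simpa [Cfg.mark] using hrel.tab,
    by simpa [Cfg.mark] using hrel.res, by simpa [Cfg.mark] using hrel.free, fun i => ?_, fun j =>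
    (hrel.log j).congr fun i hi => ?_⟩⟩,
    h.regs.congr fun _ _ _ => rfl, h.busy.mark⟩
  · simp only [setArr_arr_self, Function.update_apply, Cfg.mark, Fin.val_inj, hrel.own]
  · rw [setArr_arr_ne]; omega

/-- The test against the own claim number comes before the liveness test and before the length test,
so a closed path is recognized even when the trail already has the maximal length. -/
theorem run_walkLoop (hI : WalkLoop P k (P.T + 1) s) (hb : s.Bdd P.B) :
    Run P.B P.W (.while (isE 16 0) walkBody) s ((P.T + 2) * (500)) (AfterWalk P k) := by
  refine (Run.while P.room (by rfl) (WalkLoop P k) (t := 16 + 450 + 2) ?_ hb hI).mono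
    (by simp only [isE, Expr.cost]; gcongr; norm_num) ?_
  swap
  · rintro s' - ⟨h0, M, ⟨h1, -⟩ | h1⟩
    · simp [isE, Expr.eval, Op.eval, h1] at h0
    · exact h1
  rintro N s hb hI h0
  replace h0 : s.reg 16 = 0 := by
    by_contra h; simp [isE, Expr.eval, Op.eval, h] at h0
  rcases hI with ⟨-, S, g, z, x, a, c, e, z₀, u, e₀, α, β, es, fs, hm, hw, h24, hN, hT⟩ | hI
  swap
  · rcases hI with ⟨h, -⟩ | ⟨h, -⟩ | ⟨h, -⟩ | ⟨h, -⟩ <;> omega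
  have hpos : 0 < N := by omega
  have hB := P.one_le
  refine hm.lookup (t := 450) (t' := 2) (fun f s₁ ht hm₁ h14 h17 hreg harr => ?_)
    fun s₁ ht hm₁ harr => ?_
  swap
  · refine Run.assign P.room hm₁.sync.bdd (by rfl) (by simp only [Expr.eval]; omega)
      ⟨0, hpos, Or.inr (Or.inl ⟨by simp [Expr.eval], k, S, g, z, x, a, c, e, ?_, by omega, ht⟩)⟩
    exact hm₁.setReg (hm₁.sync.bdd.setReg (by simp only [Expr.eval]; omega)) (by norm_num)
  have hb₁ := hm₁.sync.bdd
  refine (Run.ite_add P.room hb₁ (by rfl) (t₁ := 2) (t₂ := 400) (fun ho => ?_)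
    fun ho => ?_).mono (by simp [Expr.cost]) fun _ _ h => h
  · have ho' : g.own f = k + 1 := by
      by_contra h
      simp [Expr.eval, Op.eval, h17, hm₁.regs.id, h] at ho
    refine Run.assign P.room hb₁ (by rfl) (by simp only [Expr.eval]; omega)
      ⟨0, hpos, Or.inr (Or.inr (Or.inr (Or.inl ⟨by simp [Expr.eval], S, g, z, x, a, c, e, z₀, u,
        e₀, α, β, es, fs, f, ?_, hw, ht, ho', by simpa using h14⟩)))⟩
    exact hm₁.setReg (hb₁.setReg (by simp only [Expr.eval]; omega)) (by norm_num)
  have ho' : g.own f ≠ k + 1 := by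
    intro h
    simp [Expr.eval, Op.eval, h17, hm₁.regs.id, h] at ho
  refine (Run.ite_add P.room hb₁ (by rfl) (t₁ := 2) (t₂ := 300) (fun hl => ?_) fun hl => ?_).mono
    (by simp [liveE, cellE, Expr.cost]) fun _ _ h => h
  · refine Run.assign P.room hb₁ (by rfl) (by simp only [Expr.eval]; omega)
      ⟨0, hpos, Or.inr (Or.inr (Or.inl ⟨by simp [Expr.eval], S, g, z, x, a, c, e, f, ?_, ht,
        by simpa using h14, by simpa using h17, (hm₁.live_iff h17).1 hl⟩))⟩
    exact hm₁.setReg (hb₁.setReg (by simp only [Expr.eval]; omega)) (by norm_num)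
  have hl' : ¬ g.Live (g.own f) := fun h => (hm₁.live_iff h17).2 h hl
  have h24' : s₁.reg 24 = es.length := by rw [hreg 24 (by norm_num) (by norm_num), h24]
  refine (Run.ite_add P.room hb₁ (by rfl) (t₁ := 250) (t₂ := 2) (fun hlt => ?_)
    fun hlt => ?_).mono (by simp [Expr.cost]) fun _ _ h => h
  · have hlt' : es.length < P.T := by
      by_contra h
      simp [Expr.eval, Op.eval, h24', hm₁.sync.reg5, h] at hlt
    refine (Run.store_seq P.room hb₁ (by rfl) (by exact hb₁.reg _) (t := 4 + walkProg.time)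
      fun hb₂ => ?_).mono (by decide) fun _ _ h => h
    simp only [Expr.eval, hm₁.regs.id, hm₁.regs.e] at hb₂ ⊢
    have hm₂ := hm₁.mark hb₂
    refine Run.assign_seq P.room hb₂ (by rfl) ?_ fun hb₃ => ?_
    · have := P.hT
      simp only [Expr.eval, Op.eval, setArr_reg, h24']; omega
    have hm₃ := hm₂.setReg hb₃ (by norm_num)
    obtain ⟨y, hy⟩ := (hw.busy.base.core.inc_of_tab ht).ends
    refine (run_walk hm₃.sync hm₃.regs (by simpa using h14)
      (hm₃.busy.moveData ht hy)).mono le_rfl ?_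
    rintro s₄ hb₄ ⟨hk, hs₄, hr₄⟩
    have hstep := hw.step ht hy hl' ho'
    refine ⟨N - 1, by omega, Or.inl ⟨?_, S, _, _, _, _, _, _, _, _, _, _, _, e :: es, _,
      ⟨hs₄, hr₄, hstep.busy⟩, hstep, ?_, by simp; omega, by simp; omega⟩⟩
    · rw [hk.reg 16 (by norm_num)]
      simp [hreg, h0]
    · rw [hk.reg 24 (by norm_num)]
      simp [Expr.eval, Op.eval, h24']
  · have hlt' : es.length = P.T := by
      by_contra h
      have : es.length < P.T := by omega
      simp [Expr.eval, Op.eval, h24', hm₁.sync.reg5, this] at hlt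
    refine Run.assign P.room hb₁ (by rfl) (by simp only [Expr.eval]; omega)
      ⟨0, hpos, Or.inr (Or.inr (Or.inr (Or.inr ⟨by simp [Expr.eval], S, g, z, x, a, c, e, es, ?_,
        hw.trail, hw.nodup, hlt', hw.own⟩)))⟩
    exact hm₁.setReg (hb₁.setReg (by simp only [Expr.eval]; omega)) (by norm_num)

end

end EdgeColoring

/-! ## The stages of a round that follow the fan loop -/

namespace EdgeColoring

open WordRAM

/-- Walk along an alternating path. -/
def walkStage : Prog :=
  .ite (isE 16 3) (.assign 24 (.lit 0) ;; .assign 16 (.lit 0) ;; .while (isE 16 0) walkBody) .skip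

/-- Run a fan backwards. -/
def unfanStage : Prog :=
  .ite (isE 16 4)
    (walkProg ;; swapProg ;; .assign 14 tabE ;;
      .while (.reg 14)
        (.assign 14 (.op .sub (.reg 14) (.lit 1)) ;; fanProg ;; .assign 14 tabE) ;;
      .assign 16 (.lit 1)) .skip

section

variable {n m K l : ℕ} (P : Par n m K l)

/-- The outcomes of the walk stage and the backward fan. -/
def AfterUnfan (k : ℕ) (s : State) : Prop :=
  (s.reg 16 = 1 ∧ AtEnd P k s) ∨ (s.reg 16 = 2 ∧ AtHit P k s) ∨ (s.reg 16 = 5 ∧ AtPend P k s)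

/-- Invariant of the backward fan loop. -/
def UnfanLoop (k N : ℕ) (s : State) : Prop :=
  ∃ S g z u β c e fs, Mid P s k k S g z u β c e ∧
    UnfanInv P.N (P.fut (k + 1)) P.T (l + 1) P.U₀ (k + 1) k S g (k + 1) z u β c e fs ∧
    s.reg 14 = labelCode (g.tab u c) ∧ fs.length ≤ N

variable {P} {s : State} {k q S : ℕ} {g : Cfg n m K} {z x y : Fin n} {a c : Fin K} {e f : Fin m}

theorem isE_ne_zero {i j : ℕ} : (isE i j).eval s ≠ 0 ↔ s.reg i = j := by
  simp only [isE, Expr.eval, Op.eval]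
  split_ifs <;> simp_all

theorem isE_eq_zero {i j : ℕ} : (isE i j).eval s = 0 ↔ s.reg i ≠ j := by
  simp only [isE, Expr.eval, Op.eval]
  split_ifs <;> simp_all

/-- Do something in one mode only. -/
theorem run_mode {p : Prog} {j t : ℕ} {Q : State → Prop} (hr : Room P.B P.W) (hb : s.Bdd P.B)
    (hj : j ≤ 16) (hp : s.reg 16 = j → Run P.B P.W p s t Q) (hq : s.reg 16 ≠ j → Q s) :
    Run P.B P.W (.ite (isE 16 j) p .skip) s (5 + t) Q := by
  refine (Run.ite_add hr hb (by simpa [isE, Expr.small, Expr.cost, Expr.maxLit]) (t₁ := t)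
    (t₂ := 1) (fun h => hp (isE_ne_zero.1 h)) fun h => Run.skip hb (hq (isE_eq_zero.1 h))).mono
    (by simp only [isE, Expr.cost]; omega) fun _ _ h => h

theorem run_walkStage (hI : AfterFan P k s) (hb : s.Bdd P.B) :
    Run P.B P.W walkStage s ((P.T + 3) * 500) (AfterWalk P k) := by
  refine (run_mode P.room hb (j := 3) (t := 4 + (P.T + 2) * 500) (by norm_num) (fun h => ?_)
    fun h => ?_).mono (by omega) fun _ _ h => h
  · obtain ⟨h1, -⟩ | ⟨h1, -⟩ | ⟨-, S, g, z, x, a, c, e, fs, hm, hw⟩ := hI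
    · omega
    · omega
    refine (Run.assign_seq P.room hb (by rfl) (by simp [Expr.eval]) (t := 2 + (P.T + 2) * 500)
      fun hb₁ => ?_).mono (by simp only [Expr.cost]; omega) fun _ _ h => h
    refine (Run.assign_seq P.room hb₁ (by rfl) (by simp [Expr.eval]) (t := (P.T + 2) * 500)
      fun hb₂ => ?_).mono (by simp only [Expr.cost]; omega) fun _ _ h => h
    refine run_walkLoop (Or.inl ⟨by simp [Expr.eval], S, g, z, x, a, c, e, _, _, _, _, _, [], fs,
      (hm.setReg hb₁ (by norm_num)).setReg hb₂ (by norm_num), hw, by simp [Expr.eval], by simp,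
      by simp⟩) hb₂
  · obtain h1 | h1 | h1 := hI
    · exact Or.inl h1
    · exact Or.inr (Or.inl h1)
    · exact absurd h1.1 h

theorem run_unfanLoop {N : ℕ} (hI : UnfanLoop P k N s) (hb : s.Bdd P.B) :
    Run P.B P.W (.while (.reg 14)
        (.assign 14 (.op .sub (.reg 14) (.lit 1)) ;; fanProg ;; .assign 14 tabE)) s
      ((N + 1) * 450) (fun s' => s'.reg 14 = 0 ∧ UnfanLoop P k N s') := by
  refine (Run.while P.room (by rfl) (fun M s => M ≤ N ∧ UnfanLoop P k M s) (t := 400) ?_ hb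
    ⟨le_rfl, hI⟩).mono
    (by simp only [Expr.cost]; gcongr; norm_num) ?_
  swap
  · rintro s' - ⟨h0, M, hM, S, g, z, u, β, c, e, fs, h1, h2, h3, h4⟩
    exact ⟨h0, S, g, z, u, β, c, e, fs, h1, h2, h3, h4.trans hM⟩
  rintro M s hb ⟨hMN, S, g, z, u, β, c, e, fs, hm, hu, h14, hM⟩ h0
  simp only [Expr.eval, h14] at h0
  obtain ⟨f, ht⟩ : ∃ f, g.tab u c = some f := by
    rcases hf : g.tab u c with _ | f
    · simp [hf, labelCode] at h0
    · exact ⟨f, rfl⟩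
  obtain ⟨y, hy⟩ := (hu.busy.base.core.inc_of_tab ht).ends
  obtain ⟨fs', rfl, hu'⟩ := hu.step ht hy
  have hv : Expr.eval s (.op .sub (.reg 14) (.lit 1)) = f := by
    simp [Expr.eval, Op.eval, h14, ht, labelCode]
  refine (Run.assign_seq P.room hb (by rfl) ?_ (t := fanProg.time + 20) fun hb₁ => ?_).mono
    (by decide) fun _ _ h => h
  · rw [hv]; have := f.2; have := P.hm; omega
  rw [hv] at hb₁ ⊢
  have hm₁ := hm.setReg hb₁ (by norm_num)
  refine (run_fan hm₁.sync hm₁.regs (by simp) (hu.busy.moveData ht hy)).seq ?_ le_rfl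
  rintro s₂ hb₂ ⟨hk, hs₂, hr₂⟩
  have hm₂ : Mid P s₂ k k S _ y u β _ f := ⟨hs₂, hr₂, hu'.busy⟩
  have hv₂ := hm₂.tabE
  refine (Run.assign P.room hb₂ (by rfl) hm₂.tabE_le (Q := fun s' => ∃ M' < M, M' ≤ N ∧ UnfanLoop P k M' s') ?_).mono
    (by decide) fun _ _ h => h
  rw [List.length_cons] at hM
  refine ⟨M - 1, by omega, by omega, S, _, _, _, _, _, _, fs',
    hm₂.setReg (hb₂.setReg hm₂.tabE_le) (by norm_num), hu', ?_, by omega⟩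
  rw [setReg_reg_self, hv₂]

/-- After the closing step and the exchange at the leaf, the chain is shorter than `K`, so the
backward fan costs `O(Δ)` and always ends with an edge that can be colored. -/
theorem run_unfanStage (hI : AfterWalk P k s) (hb : s.Bdd P.B) :
    Run P.B P.W unfanStage s ((K + 2) * 450) (AfterUnfan P k) := by
  refine (run_mode P.room hb (j := 4)
    (t := walkProg.time + (swapProg.time + (20 + ((K + 1) * 450 + 2)))) (by norm_num) (fun h => ?_)
    fun h => ?_).mono ?_ fun _ _ h => h
  · obtain ⟨h1, -⟩ | ⟨h1, -⟩ | ⟨-, S, g, z, x, a, c, e, z₀, u, e₀, α, β, es, fs, f, hm, hw, ht, ho,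
      h14⟩ | ⟨h1, -⟩ := hI
    · omega
    · omega
    swap
    · omega
    obtain ⟨hy, hu⟩ := hw.unfan ht ho
    have hlen := length_lt_of_inc P.deg hw.fs_nodup fun i hi => (hw.chain.mem hi).1
    refine (run_walk hm.sync hm.regs h14 (hm.busy.moveData ht hy)).seq ?_ le_rfl
    rintro s₁ hb₁ ⟨hk₁, hs₁, hr₁⟩
    refine (run_swap hs₁ hr₁).seq ?_ le_rfl
    rintro s₂ hb₂ ⟨hk₂, hs₂, hr₂⟩
    have hm₂ : Mid P s₂ k k S _ x u c _ f := ⟨hs₂, hr₂, hu.busy⟩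
    have hv₂ := hm₂.tabE
    refine (Run.assign_seq P.room hb₂ (by rfl) hm₂.tabE_le (t := (K + 1) * 450 + 2)
      fun hb₃ => ?_).mono (by simp [tabE, cellE, Expr.cost]) fun _ _ h => h
    refine (run_unfanLoop (N := K) ⟨S, _, _, _, _, _, _, fs, hm₂.setReg hb₃ (by norm_num), hu, ?_,
      hlen.le⟩ hb₃).seq (t₂ := 2) ?_ le_rfl
    · rw [setReg_reg_self, hv₂]
    rintro s₄ hb₄ ⟨h0, S, g, z, u, β, c, e, fs, hm, hu, h14, -⟩
    have hB := P.one_le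
    refine Run.assign P.room hb₄ (by rfl) (by simp only [Expr.eval]; omega) (Or.inl
      ⟨by simp [Expr.eval], k, S, g, z, u, β, c, e, hm.setReg (hb₄.setReg
        (by simp only [Expr.eval]; omega)) (by norm_num), by omega, ?_⟩)
    rcases hf : g.tab u c with _ | f
    · rfl
    · rw [hf, h0] at h14; simp [labelCode] at h14
  · obtain h1 | h1 | h1 | h1 := hI
    · exact Or.inl h1
    · exact Or.inr (Or.inl h1)
    · exact absurd h1.1 h
    · exact Or.inr (Or.inr h1)
  · have h1 : walkProg.time ≤ 150 := by decide
    have h2 : swapProg.time ≤ 150 := by decide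
    omega

end

end EdgeColoring

/-! ## Collisions with the trail of a pending token -/

namespace EdgeColoring

open WordRAM

/-- Put the token aside and load the pending token. -/
def loadProg : Prog :=
  .assign 18 (.reg 8) ;; .assign 19 (.reg 9) ;; .assign 20 (.reg 10) ;; .assign 21 (.reg 11) ;;
  .assign 22 (.reg 12) ;; .assign 23 (.reg 14) ;;
  .assign 8 (.get 15 (.reg 17)) ;; .assign 9 (.get 16 (.reg 17)) ;;
  .assign 10 (.get 17 (.reg 17)) ;; .assign 11 (.get 18 (.reg 17)) ;;
  .assign 12 (.get 19 (.reg 17)) ;; .assign 13 (.reg 17) ;; .store 14 (.reg 17) (.lit 0)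

/-- The edge that is next on the walk. -/
def nextE : Expr := .op .sub tabE (.lit 1)

/-- Move the pending token back to the place of the collision. -/
def returnProg : Prog :=
  .while (.op .sub (.lit 1) (.op .eq (.reg 14) (.reg 23))) (walkProg ;; .assign 14 nextE)

/-- Form a u-fan. -/
def makeFanProg : Prog :=
  .assign 13 (.op .add (.reg 6) (.lit 1)) ;;
  .store 10 (cellE (.reg 9) (.reg 10)) (.lit 0) ;;
  .store 10 (cellE (.reg 8) (.reg 11)) (.reg 13) ;;
  .store 14 (.reg 13) (.lit 2) ;; .store 15 (.reg 13) (.reg 19) ;;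
  .store 16 (.reg 13) (.reg 18) ;; .store 17 (.reg 13) (.reg 8) ;;
  .store 18 (.reg 13) (.reg 20) ;; .store 19 (.reg 13) (.reg 21) ;; .assign 16 (.lit 6)

/-- Take up the token that was put aside. -/
def restoreProg : Prog :=
  .assign 8 (.reg 18) ;; .assign 9 (.reg 19) ;; .assign 10 (.reg 20) ;; .assign 11 (.reg 21) ;;
  .assign 12 (.reg 22) ;; .assign 13 (.op .add (.reg 6) (.lit 1)) ;; .assign 16 (.lit 1)

/-- Deal with a collision. -/
def collStage : Prog :=
  .ite (isE 16 2)
    (loadProg ;; .assign 14 nextE ;; returnProg ;;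
      .ite (.op .eq (.reg 9) (.reg 19)) makeFanProg (moveProg ;; restoreProg)) .skip

section

variable {n m K l : ℕ} (P : Par n m K l)

/-- The memory while the token `k + 1` is put aside. -/
structure Aside (s : State) (k S : ℕ) (g : Cfg n m K) (z₁ x₁ : Fin n) (a₁ c₁ : Fin K)
    (e₁ f : Fin m) (p : ℕ) (z x : Fin n) (a c : Fin K) (e : Fin m) (es : List (Fin m)) :
    Prop where
  sync : Sync P s k (k + 1) S g
  regs : TokRegs s p z x a c e
  reg18 : s.reg 18 = z₁
  reg19 : s.reg 19 = x₁
  reg20 : s.reg 20 = a₁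
  reg21 : s.reg 21 = c₁
  reg22 : s.reg 22 = e₁
  reg23 : s.reg 23 = f
  coll : CollInv P.N (P.fut (k + 1)) P.T (l + 1) P.U₀ (k + 1) (k - 1) S g (k + 1) z₁ x₁ a₁ c₁ e₁ f
    p z x a c e es

/-- Invariant of the loop that moves the pending token back. -/
def CollLoop (k N : ℕ) (s : State) : Prop :=
  ∃ S g z₁ x₁ a₁ c₁ e₁ f p z x a c e es f', Aside P s k S g z₁ x₁ a₁ c₁ e₁ f p z x a c e es ∧
    g.tab x c = some f' ∧ s.reg 14 = f' ∧ es.length ≤ N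

/-- The outcomes of the collision stage. -/
def AfterColl (k : ℕ) (s : State) : Prop :=
  (s.reg 16 = 1 ∧ AtEnd P k s) ∨ (s.reg 16 = 5 ∧ AtPend P k s) ∨ (s.reg 16 = 6 ∧ AtDone P k s)

variable {P} {s : State} {k q S : ℕ} {g : Cfg n m K} {z x y z₁ x₁ : Fin n} {a c a₁ c₁ : Fin K}
  {e f e₁ : Fin m} {p : ℕ} {es : List (Fin m)}

theorem Aside.setReg14 (h : Aside P s k S g z₁ x₁ a₁ c₁ e₁ f p z x a c e es) {v : ℕ}
    (hb : (s.setReg 14 v).Bdd P.B) :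
    Aside P (s.setReg 14 v) k S g z₁ x₁ a₁ c₁ e₁ f p z x a c e es :=
  ⟨h.sync.setReg hb (by norm_num), h.regs.setReg (by norm_num), by simp [h.reg18],
    by simp [h.reg19], by simp [h.reg20], by simp [h.reg21], by simp [h.reg22], by simp [h.reg23],
    h.coll⟩

/-- Look up the next edge of the trail. -/
theorem Aside.next (h : Aside P s k S g z₁ x₁ a₁ c₁ e₁ f p z x a c e es) {N : ℕ}
    (hN : es.length ≤ N) :
    Run P.B P.W (.assign 14 nextE) s 20 (CollLoop P k N) := by
  obtain ⟨f', es', -, ht⟩ := h.coll.next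
  have hv : nextE.eval s = f' := by
    simp only [nextE, tabE, cellE, Expr.eval, Op.eval, h.regs.x, h.regs.c, h.sync.reg4]
    rw [h.sync.rel.tab x c, ht]
    simp [labelCode]
  have hf' : (f' : ℕ) ≤ P.B := by have := f'.2; have := P.hm; omega
  refine (Run.assign P.room h.sync.bdd (by rfl) (hv.trans_le hf') ?_).mono (by decide)
    fun _ _ h => h
  rw [hv]
  exact ⟨S, g, z₁, x₁, a₁, c₁, e₁, f, p, z, x, a, c, e, es, f',
    h.setReg14 (h.sync.bdd.setReg hf'), ht, by simp, hN⟩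

theorem run_load (h : Mid P s k q S g z x a c e) (h17 : s.reg 17 = p) (hf : s.reg 14 = f)
    (hlog : g.log p = .pend z₁ x₁ a₁ c₁ e₁)
    (hc : CollInv P.N (P.fut (k + 1)) P.T (l + 1) P.U₀ (k + 1) (k - 1) S (g.record p .none)
      (k + 1) z x a c e f p z₁ x₁ a₁ c₁ e₁ es) :
    Run P.B P.W loadProg s loadProg.time (fun s' =>
      Aside P s' k S (g.record p .none) z x a c e f p z₁ x₁ a₁ c₁ e₁ es) := by
  have hb := h.sync.bdd
  have hB := P.one_le
  refine (Run.flat P.room (by rfl) hb ?_).mono le_rfl ?_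
  · simp [loadProg, Prog.Safe, Prog.final, Expr.eval, hb.reg, hb.arr]
  rintro s' hb' rfl
  have hl := h.sync.rel.log p
  rw [hlog] at hl
  obtain ⟨h1, h2, h3, h4, h5, h6⟩ := hl
  refine ⟨h.sync.congr hb' (fun r hr => ?_) ?_ ?_ ?_, ?_, ?_, ?_, ?_, ?_, ?_, ?_, hc⟩
  · simp only [loadProg, Prog.final, setArr_reg]
    repeat rw [setReg_reg_ne _ _ (by omega)]
  · simp [loadProg, Prog.final]
  · simp [loadProg, Prog.final]
  · have hrel := h.sync.rel
    refine ⟨?_, ?_, ?_, ?_, ?_, ?_, ?_, fun j => ?_⟩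
    · simpa [loadProg, Prog.final] using hrel.src
    · simpa [loadProg, Prog.final] using hrel.tgt
    · simpa [loadProg, Prog.final, Cfg.record] using hrel.col
    · simpa [loadProg, Prog.final, Cfg.record] using hrel.tab
    · simpa [loadProg, Prog.final, Cfg.record] using hrel.res
    · simpa [loadProg, Prog.final, Cfg.record] using hrel.free
    · simpa [loadProg, Prog.final, Cfg.record] using hrel.own
    · by_cases hj : j = p
      · subst hj
        simp [Cfg.record, HoldsRec, loadProg, Prog.final, Expr.eval, h17]
      · have := hrel.log j
        simp only [Cfg.record, Function.update_apply, hj, if_false]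
        refine this.congr fun i hi => ?_
        by_cases h14 : i = 14
        · subst h14
          simp [loadProg, Prog.final, Expr.eval, h17, hj]
        · simp [loadProg, Prog.final, h14]
  · constructor <;> simp [loadProg, Prog.final, Expr.eval, h17, h2, h3, h4, h5, h6]
  all_goals simp [loadProg, Prog.final, Expr.eval, h.regs.z, h.regs.x, h.regs.a, h.regs.c,
    h.regs.e, hf]

theorem Aside.walk (h : Aside P s k S g z₁ x₁ a₁ c₁ e₁ f p z x a c e es) {f' : Fin m}
    (ht : g.tab x c = some f') (h14 : s.reg 14 = f') (hne : f' ≠ f) {N : ℕ} (hN : es.length ≤ N) :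
    Run P.B P.W (walkProg ;; .assign 14 nextE) s (walkProg.time + 20)
      (fun s' => ∃ M < N, CollLoop P k M s') := by
  obtain ⟨y, hy⟩ := (h.coll.busy.base.core.inc_of_tab ht).ends
  obtain ⟨es', rfl, hc⟩ := h.coll.step ht hy hne
  refine (run_walk h.sync h.regs h14 (h.coll.busy.moveData ht hy)).seq ?_ le_rfl
  rintro s₁ hb₁ ⟨hk, hs₁, hr₁⟩
  rw [List.length_cons] at hN
  have hA : Aside P s₁ k S _ z₁ x₁ a₁ c₁ e₁ f p x y c a f' es' :=
    ⟨hs₁, hr₁, (hk.reg 18 (by norm_num)).trans h.reg18, (hk.reg 19 (by norm_num)).trans h.reg19,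
      (hk.reg 20 (by norm_num)).trans h.reg20, (hk.reg 21 (by norm_num)).trans h.reg21,
      (hk.reg 22 (by norm_num)).trans h.reg22, (hk.reg 23 (by norm_num)).trans h.reg23, hc⟩
  exact (hA.next (N := N - 1) (by omega)).mono le_rfl fun s' _ h => ⟨N - 1, by omega, h⟩

theorem run_return {N : ℕ} (hI : CollLoop P k N s) (hb : s.Bdd P.B) :
    Run P.B P.W returnProg s ((N + 1) * 200) (fun s' => ∃ S g z₁ x₁ a₁ c₁ e₁ f p z x a c e es,
      Aside P s' k S g z₁ x₁ a₁ c₁ e₁ f p z x a c e es ∧ g.tab x c = some f ∧ s'.reg 14 = f) := by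
  refine (Run.while P.room (by rfl) (CollLoop P k) (t := walkProg.time + 20) ?_ hb hI).mono
    (by gcongr; decide) ?_
  · rintro M s hb ⟨S, g, z₁, x₁, a₁, c₁, e₁, f, p, z, x, a, c, e, es, f', hA, ht, h14, hM⟩ h0
    refine hA.walk ht h14 ?_ hM
    rintro rfl
    simp [Expr.eval, Op.eval, hA.reg23, h14] at h0
  · rintro s' - ⟨h0, M, S, g, z₁, x₁, a₁, c₁, e₁, f, p, z, x, a, c, e, es, f', hA, ht, h14, hM⟩
    have : f' = f := by
      by_contra hne
      simp [Expr.eval, Op.eval, hA.reg23, h14, Fin.val_inj, hne] at h0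
    subst this
    exact ⟨S, g, z₁, x₁, a₁, c₁, e₁, f', p, z, x, a, c, e, es, hA, ht, h14⟩

theorem Base.weaken {N : Net n m} {F : Set (Fin m)} {T M U₀ b q q' S : ℕ}
    (h : Base N F T M U₀ b q S g) (hq : q' ≤ q) : Base N F T M U₀ b q' S g :=
  ⟨h.core, h.claims, h.log_none, h.res_le, h.own_le, h.unc, hq.trans h.count⟩

theorem Aside.makeFan (h : Aside P s k S g z₁ x₁ a₁ c₁ e₁ f p z x a c e es) (hkl : k < l)
    (ht : g.tab x c = some f) (hx : x = x₁) :
    Run P.B P.W makeFanProg s makeFanProg.time (AfterColl P k) := by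
  have hb := h.sync.bdd
  have hB := P.one_le
  have hl := P.hl
  -- Resuming the pending token left `k - 1` in the count, and the u-fan adds 2. Truncation at `k =
  -- 0` does no harm.
  have hbase := (h.coll.fan (by omega) ht hx).weaken (q' := k + 1) (by omega)
  obtain rfl := h.coll.color_eq ht
  subst hx
  refine (Run.flat P.room (by rfl) hb ?_).mono le_rfl ?_
  · simp [makeFanProg, Prog.Safe, Prog.final, Expr.eval, hb.reg, Op.eval, h.sync.reg6]
    omega
  rintro s' hb' rfl
  refine Or.inr (Or.inr ⟨by simp [makeFanProg, Prog.final, Expr.eval], S, _, ?_, hbase⟩)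
  refine h.sync.congr hb' (fun r hr => ?_) ?_ ?_ ?_
  · simp only [makeFanProg, Prog.final]
    rw [setReg_reg_ne _ _ (by omega)]
    simp only [setArr_reg]
    rw [setReg_reg_ne _ _ (by omega)]
  · simp [makeFanProg, Prog.final]
  · simp [makeFanProg, Prog.final]
  · have hrel := h.sync.rel
    refine ⟨?_, ?_, ?_, ?_, fun v c' => ?_, ?_, ?_, fun j => ?_⟩
    · simpa [makeFanProg, Prog.final] using hrel.src
    · simpa [makeFanProg, Prog.final] using hrel.tgt
    · simpa [makeFanProg, Prog.final, Cfg.makeFan] using hrel.col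
    · simpa [makeFanProg, Prog.final, Cfg.makeFan] using hrel.tab
    · have hres := hrel.res
      simp only [makeFanProg, Prog.final, Expr.eval, Op.eval, cellE, setReg_reg_self,
        setReg_arr, setArr_reg, setArr_arr_self, h.regs.c, h.regs.z, h.regs.x, h.regs.a,
        h.sync.reg4, h.sync.reg6,
        Function.update_apply, Cfg.makeFan, upd, index_fin_inj,
        ne_eq, not_false_eq_true, setArr_arr_ne, setReg_reg_ne,
        Nat.reduceEqDiff]
      split_ifs <;> simp [idCode, hres]
    · simpa [makeFanProg, Prog.final, Cfg.makeFan] using hrel.free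
    · simpa [makeFanProg, Prog.final, Cfg.makeFan] using hrel.own
    · by_cases hj : j = k + 1
      · subst hj
        simp [Cfg.makeFan, HoldsRec, makeFanProg, Prog.final, Expr.eval, Op.eval, h.sync.reg6,
          h.reg18, h.reg19, h.reg20, h.reg21, h.regs.z]
      · have := hrel.log j
        simp only [Cfg.makeFan, Function.update_apply, hj, if_false]
        refine this.congr fun i hi => ?_
        by_cases hi : 20 ≤ i
        · simp only [makeFanProg, Prog.final, setReg_arr]
          repeat rw [setArr_arr_ne _ _ _ (by omega)]
          rfl
        · obtain rfl | rfl | rfl | rfl | rfl | rfl : i = 14 ∨ i = 15 ∨ i = 16 ∨ i = 17 ∨ i = 18 ∨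
            i = 19 := by omega
          all_goals simp [makeFanProg, Prog.final, Expr.eval, Op.eval, h.sync.reg6,
            hj]

theorem Aside.returned (h : Aside P s k S g z₁ x₁ a₁ c₁ e₁ f p z x a c e es) (hkl : k < l)
    (ht : g.tab x c = some f) (h14 : s.reg 14 = f) (hx : x ≠ x₁) :
    Run P.B P.W (moveProg ;; restoreProg) s (moveProg.time + restoreProg.time)
      (AfterColl P k) := by
  have hy := h.coll.ends ht hx
  obtain ⟨hbusy, htab⟩ := h.coll.gain ht hx
  refine (run_move h.sync h.regs h14 (h.coll.busy.moveData ht hy)).seq ?_ le_rfl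
  rintro s₁ hb₁ ⟨hk, hs₁, -, -, -⟩
  have hB := P.one_le
  have hl := P.hl
  refine (Run.flat P.room (by rfl) hb₁ ?_).mono le_rfl ?_
  · simp [restoreProg, Prog.Safe, Prog.final, Expr.eval, hb₁.reg, Op.eval, hs₁.reg6]
    omega
  rintro s' hb' rfl
  refine Or.inl ⟨by simp [restoreProg, Prog.final, Expr.eval], k - 1, S, _, z₁, x₁, a₁, c₁, e₁,
    ⟨hs₁.congr hb' (fun r hr => ?_) rfl rfl hs₁.rel, ?_, hbusy⟩, by omega, htab⟩
  · simp only [restoreProg, Prog.final]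
    repeat rw [setReg_reg_ne _ _ (by omega)]
  · constructor <;> simp [restoreProg, Prog.final, Expr.eval, Op.eval, hs₁.reg6,
      (hk.reg 18 (by norm_num)).trans h.reg18, (hk.reg 19 (by norm_num)).trans h.reg19,
      (hk.reg 20 (by norm_num)).trans h.reg20, (hk.reg 21 (by norm_num)).trans h.reg21,
      (hk.reg 22 (by norm_num)).trans h.reg22]

/-- The resumed trail has exactly `T` edges and contains `f`, so the way back takes `O(T)` steps. -/
theorem run_collStage (hI : AfterUnfan P k s) (hb : s.Bdd P.B) (hkl : k < l) :
    Run P.B P.W collStage s ((P.T + 10) * 200) (AfterColl P k) := by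
  refine (run_mode P.room hb (j := 2)
    (t := loadProg.time + (20 + ((P.T + 1) * 200 + (4 + (makeFanProg.time +
      (moveProg.time + restoreProg.time)))))) (by norm_num) (fun h => ?_) fun h => ?_).mono ?_
      fun _ _ h => h
  · obtain ⟨h1, -⟩ | ⟨-, S, g, z₁, x₁, a₁, c₁, e₁, f, hm, ht, h14, h17, hlive⟩ | ⟨h1, -⟩ := hI
    · omega
    swap
    · omega
    obtain ⟨z, x, a, c, e, hlog, -⟩ := id hlive
    obtain ⟨es, hlen, hc⟩ := hm.busy.resume ht rfl hlog hlive
    refine (run_load hm h17 h14 hlog hc).seq ?_ le_rfl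
    rintro s₁ hb₁ hA
    refine (hA.next (N := P.T) hlen.le).seq ?_ le_rfl
    rintro s₂ hb₂ hL
    refine (run_return hL hb₂).seq ?_ le_rfl
    rintro s₃ hb₃ ⟨S, g, z₁, x₁, a₁, c₁, e₁, f, p, z, x, a, c, e, es, hA, ht, h14⟩
    refine (Run.ite_add P.room hb₃ (by rfl) (fun h => hA.makeFan hkl ht ?_)
      fun h => hA.returned hkl ht h14 ?_).mono (by simp [Expr.cost]) fun _ _ h => h
    · by_contra hne
      simp [Expr.eval, Op.eval, hA.reg19, hA.regs.x, Fin.val_inj, hne] at h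
    · rintro rfl
      simp [Expr.eval, Op.eval, hA.reg19, hA.regs.x] at h
  · obtain h1 | h1 | h1 := hI
    · exact Or.inl h1
    · exact absurd h1.1 h
    · exact Or.inr (Or.inl h1)
  · have h1 : loadProg.time + makeFanProg.time + moveProg.time + restoreProg.time ≤ 500 := by decide
    omega

end

end EdgeColoring

/-! ## The end of a round -/

namespace EdgeColoring

open WordRAM

/-- Color the edge of the token. -/
def completeProg : Prog :=
  .store 2 (.reg 12) (.op .add (.reg 11) (.lit 1)) ;;
  .store 9 (cellE (.reg 8) (.reg 11)) (.op .add (.reg 12) (.lit 1)) ;;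
  .store 9 (cellE (.reg 9) (.reg 11)) (.op .add (.reg 12) (.lit 1)) ;;
  .store 10 (cellE (.reg 8) (.reg 11)) (.lit 0) ;;
  .store 10 (cellE (.reg 9) (.reg 10)) (.lit 0) ;;
  .store 10 (cellE (.reg 9) (.reg 11)) (.lit 0) ;;
  .store 11 (.reg 9) (.op .add (.op .mul (.get 11 (.reg 9)) (.op .eq (.reg 10) (.reg 11)))
    (.op .mul (.reg 10) (.op .sub (.lit 1) (.op .eq (.reg 10) (.reg 11))))) ;;
  .assign 7 (.op .add (.reg 7) (.lit 1)) ;;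
  .assign 16 (.lit 6)

/-- Record a pending token. -/
def pendProg : Prog :=
  .store 14 (.reg 13) (.lit 1) ;; .store 15 (.reg 13) (.reg 9) ;;
  .store 16 (.reg 13) (.reg 8) ;; .store 17 (.reg 13) (.reg 11) ;;
  .store 18 (.reg 13) (.reg 10) ;; .store 19 (.reg 13) (.reg 12)

/-- All stages of a round that follow the initialization. -/
def stages : Prog :=
  .while (isE 16 0) fanBody ;; walkStage ;; unfanStage ;; collStage ;;
    .ite (isE 16 1) completeProg .skip ;; .ite (isE 16 5) pendProg .skip

section

variable {n m K l : ℕ} {P : Par n m K l} {s : State} {k q S : ℕ} {g : Cfg n m K} {z x : Fin n}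
  {a c : Fin K} {e : Fin m}

theorem Par.U₀_le (P : Par n m K l) : P.U₀ ≤ m := by
  have := Set.ncard_le_card P.F₀
  simpa [Par.U₀] using this

/-- The hypothesis allows for the one lost in a collision: a success adds 2, which reaches `k + 1`
in either case. -/
theorem Mid.complete (h : Mid P s k q S g z x a c e) (hq : k ≤ q + 1)
    (ht : g.tab x c = none) :
    Run P.B P.W completeProg s completeProg.time (fun s' => s'.reg 16 = 6 ∧ AtDone P k s') := by
  have hb := h.sync.bdd
  have hB := P.one_le
  have hm := P.hm
  have hK := P.hK
  have hU := P.U₀_le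
  have hbase := (h.busy.complete ht).weaken (q' := k + 1) (by omega)
  -- The number of successes is at most `U₀ ≤ m`, so the success counter stays within the memory
  -- bound.
  have hS := hbase.unc
  have hfx : s.arr 11 x = g.free x := h.sync.rel.free x
  refine (Run.flat P.room (by rfl) hb ?_).mono le_rfl ?_
  · have h1 := a.2
    have h2 := c.2
    have h3 := e.2
    have h4 := (g.free x).2
    simp [completeProg, Prog.Safe, Prog.final, Expr.eval, Op.eval, h.regs.x, h.regs.c, h.regs.a,
      h.regs.e, h.sync.reg7, hfx]
    split_ifs <;> simp <;> omega
  rintro s' hb' rfl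
  refine ⟨by simp [completeProg, Prog.final, Expr.eval], S + 1, _, ?_, hbase⟩
  have hrel := h.sync.rel
  have hr : ∀ r < 8, r ≠ 7 → (completeProg.final s).reg r = s.reg r := by
    intro r h8 h7
    have h16 : r ≠ 16 := by omega
    simp [completeProg, Prog.final, h7, h16]
  refine ⟨hb', (hr 1 (by norm_num) (by norm_num)).trans h.sync.reg1,
    (hr 3 (by norm_num) (by norm_num)).trans h.sync.reg3,
    (hr 4 (by norm_num) (by norm_num)).trans h.sync.reg4,
    (hr 5 (by norm_num) (by norm_num)).trans h.sync.reg5,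
    (hr 6 (by norm_num) (by norm_num)).trans h.sync.reg6, ?_, ?_, ?_, ?_⟩
  · simp [completeProg, Prog.final, Expr.eval, Op.eval, h.sync.reg7]
  · simpa [completeProg, Prog.final] using h.sync.arr3
  · simpa [completeProg, Prog.final] using h.sync.stamp
  · refine ⟨?_, ?_, fun i => ?_, fun v c' => ?_, fun v c' => ?_, fun v => ?_, ?_, fun j => ?_⟩
    · simpa [completeProg, Prog.final] using hrel.src
    · simpa [completeProg, Prog.final] using hrel.tgt
    · have hcol := hrel.col
      simp only [completeProg, Prog.final, Expr.eval, Op.eval,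
        setReg_arr, setArr_reg, setArr_arr_self, h.regs.c, h.regs.e,
        Function.update_apply, Cfg.complete,
        ne_eq, not_false_eq_true, setArr_arr_ne,
        Nat.reduceEqDiff, Fin.val_inj]
      split_ifs <;> simp [labelCode, hcol]
    · have htab := hrel.tab
      simp only [completeProg, Prog.final, Expr.eval, Op.eval, cellE,
        setReg_arr, setArr_reg, setArr_arr_self, h.regs.c, h.regs.e, h.regs.z, h.regs.x,
        h.sync.reg4, upd, index_fin_inj,
        Function.update_apply, Cfg.complete,
        ne_eq, not_false_eq_true, setArr_arr_ne,
        Nat.reduceEqDiff]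
      split_ifs <;> simp [labelCode, htab]
    · have hres := hrel.res
      simp only [completeProg, Prog.final, Expr.eval, Op.eval, cellE,
        setReg_arr, setArr_reg, setArr_arr_self, h.regs.c, h.regs.e, h.regs.z, h.regs.x, h.regs.a,
        h.sync.reg4, upd, index_fin_inj,
        Function.update_apply, Cfg.complete,
        ne_eq, not_false_eq_true, setArr_arr_ne,
        Nat.reduceEqDiff, Fin.val_inj]
      split_ifs <;> simp [idCode, hres]
    · have hfree := hrel.free
      simp only [completeProg, Prog.final, Expr.eval, Op.eval, cellE,
        setReg_arr, setArr_reg, setArr_arr_self, h.regs.c, h.regs.x, h.regs.a,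
        Function.update_apply, Cfg.complete,
        ne_eq, not_false_eq_true, setArr_arr_ne,
        Nat.reduceEqDiff, Fin.val_inj]
      by_cases hac : a = c <;> by_cases hv : v = x <;> simp [hac, hv, hfree]
    · simpa [completeProg, Prog.final, Cfg.complete] using hrel.own
    · refine (hrel.log j).congr fun i hi => ?_
      simp only [completeProg, Prog.final, setReg_arr]
      repeat rw [setArr_arr_ne _ _ _ (by omega)]

theorem Mid.pending (h : Mid P s k k S g z x a c e) (hkl : k < l) {es : List (Fin m)}
    (h1 : P.N.Trail g.col z a c es) (h2 : es.Nodup) (h3 : es.length = P.T)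
    (h4 : ∀ i, g.own i = k + 1 ↔ i ∈ es) :
    Run P.B P.W pendProg s pendProg.time (AtDone P k) := by
  have hb := h.sync.bdd
  have hB := P.one_le
  have hbase := h.busy.pending (by omega) h1 h2 h3 h4
  refine (Run.flat P.room (by rfl) hb ?_).mono le_rfl ?_
  · simp [pendProg, Prog.Safe, Prog.final, Expr.eval, hb.reg]
    omega
  rintro s' hb' rfl
  have hrel := h.sync.rel
  refine ⟨S, _, h.sync.congr hb' (fun _ _ => rfl) (by simp [pendProg, Prog.final])
    (by simp [pendProg, Prog.final]) ?_, hbase⟩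
  refine ⟨?_, ?_, ?_, ?_, ?_, ?_, ?_, fun j => ?_⟩
  · simpa [pendProg, Prog.final] using hrel.src
  · simpa [pendProg, Prog.final] using hrel.tgt
  · simpa [pendProg, Prog.final, Cfg.record] using hrel.col
  · simpa [pendProg, Prog.final, Cfg.record] using hrel.tab
  · simpa [pendProg, Prog.final, Cfg.record] using hrel.res
  · simpa [pendProg, Prog.final, Cfg.record] using hrel.free
  · simpa [pendProg, Prog.final, Cfg.record] using hrel.own
  · by_cases hj : j = k + 1
    · subst hj
      simp [Cfg.record, HoldsRec, pendProg, Prog.final, Expr.eval, h.regs.id, h.regs.z, h.regs.x,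
        h.regs.a, h.regs.c, h.regs.e]
    · have := hrel.log j
      simp only [Cfg.record, Function.update_apply, hj, if_false]
      refine this.congr fun i hi => ?_
      by_cases hi : 20 ≤ i
      · simp only [pendProg, Prog.final]
        repeat rw [setArr_arr_ne _ _ _ (by omega)]
      · obtain rfl | rfl | rfl | rfl | rfl | rfl : i = 14 ∨ i = 15 ∨ i = 16 ∨ i = 17 ∨ i = 18 ∨
          i = 19 := by omega
        all_goals simp [pendProg, Prog.final, Expr.eval, h.regs.id, hj]

theorem run_stages (hI : FanLoop P k K s) (hb : s.Bdd P.B) (hkl : k < l) :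
    Run P.B P.W stages s ((K + P.T + 10) * 1000) (AtDone P k) := by
  have h1 : completeProg.time + pendProg.time ≤ 300 := by decide
  refine (run_fanLoop hI hb).seq (t₂ := (P.T + 3) * 500 + ((K + 2) * 450 + ((P.T + 10) * 200 +
    (5 + completeProg.time + (5 + pendProg.time))))) (fun s₁ hb₁ h₁ => ?_) (by omega)
  refine (run_walkStage h₁ hb₁).seq (fun s₂ hb₂ h₂ => ?_) le_rfl
  refine (run_unfanStage h₂ hb₂).seq (fun s₃ hb₃ h₃ => ?_) le_rfl
  refine (run_collStage h₃ hb₃ hkl).seq (fun s₄ hb₄ h₄ => ?_) le_rfl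
  refine (run_mode (Q := fun s => (s.reg 16 = 5 ∧ AtPend P k s) ∨ (s.reg 16 = 6 ∧ AtDone P k s))
    P.room hb₄ (by norm_num) (fun h => ?_) fun h => ?_).seq (fun s₅ hb₅ h₅ => ?_) le_rfl
  · obtain ⟨-, q, S, g, z, x, a, c, e, hm, hq, ht⟩ | ⟨h', -⟩ | ⟨h', -⟩ := h₄
    · exact (hm.complete hq ht).mono le_rfl fun _ _ h => Or.inr h
    · omega
    · omega
  · obtain h' | h' | h' := h₄
    · exact absurd h'.1 h
    · exact Or.inl h'
    · exact Or.inr h'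
  · refine run_mode P.room hb₅ (by norm_num) (fun h => ?_) fun h => ?_
    · obtain ⟨-, S, g, z, x, a, c, e, es, hm, h1, h2, h3, h4⟩ | ⟨h', -⟩ := h₅
      · exact hm.pending hkl h1 h2 h3 h4
      · omega
    · obtain h' | h' := h₅
      · exact absurd h'.1 h
      · exact h'.2

end

end EdgeColoring

/-! ## The main loop -/

namespace EdgeColoring

open WordRAM

/-- Reserve the free color of the vertex in register `v`, and find a new one. -/
def acquireProg (v r : ℕ) : Prog :=
  .assign r (.get 11 (.reg v)) ;;
  .store 10 (cellE (.reg v) (.reg r)) (.reg 13) ;;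
  .assign 25 (.lit 0) ;;
  .while (.op .add (.get 9 (cellE (.reg v) (.reg 25))) (.get 10 (cellE (.reg v) (.reg 25))))
    (.assign 25 (.op .add (.reg 25) (.lit 1))) ;;
  .store 11 (.reg v) (.reg 25)

/-- Set up the token of a round. -/
def startProg : Prog :=
  .assign 12 (.get 3 (.reg 6)) ;; .assign 9 (.get 0 (.reg 12)) ;; .assign 8 (.get 1 (.reg 12)) ;;
  .assign 13 (.op .add (.reg 6) (.lit 1)) ;; .assign 16 (.lit 0) ;;
  acquireProg 8 11 ;; acquireProg 9 10

/-- All rounds. -/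
def mainLoop : Prog :=
  .while (.op .lt (.reg 6) (.reg 3))
    (startProg ;; stages ;; .assign 6 (.op .add (.reg 6) (.lit 1)))

section

variable {n m K l : ℕ} {N : Net n m} {F F' : Set (Fin m)} {T M U₀ b q S id : ℕ} {g : Cfg n m K}
  {v : Fin n} {d : Fin K} {e : Fin m}

theorem Base.acquire (h : Base N F T M U₀ b q S g) (a : AcqData N F g id v d e)
    (hlog : g.log id = .none) (h1 : 1 ≤ id) (hb : id ≤ b) :
    Base N F T M U₀ b q S (g.acquire id v d e) := by
  have fr : Frame id g (g.acquire id v d e) := by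
    refine ⟨rfl, hlog, fun j hj v' c' e' => ?_⟩
    rw [a.res_iff]
    exact or_iff_right fun h => hj h.2.2.1
  refine ⟨a.core_acquire, fr.claims h.claims fun _ _ _ _ => ⟨Iff.rfl, fun _ => rfl⟩, h.log_none, ?_,
    h.own_le, h.unc, ?_⟩
  · intro v' c' j e' hr
    rcases a.res_iff.1 hr with ⟨-, -, rfl, -⟩ | hr
    · exact ⟨h1, hb⟩
    · exact h.res_le _ _ _ _ hr
  · rw [fr.score]; exact h.count

theorem Base.next (h : Base N F T M U₀ b q S g) (hF : F' ⊆ F) :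
    Base N F' T M U₀ (b + 1) q S g :=
  ⟨⟨h.core.tab_iff, h.core.res_tab, h.core.res_inc, h.core.res_col,
    fun v c j e hr he => h.core.res_fut v c j e hr (hF he), h.core.res_color, h.core.res_id,
    h.core.free_tab, h.core.free_res, fun e he => h.core.fut e (hF he)⟩, h.claims,
    fun j hj => h.log_none j (by omega), fun v c j e hr =>
    ⟨(h.res_le v c j e hr).1, (h.res_le v c j e hr).2.trans (by omega)⟩,
    fun i => (h.own_le i).trans (by omega), h.unc, h.count⟩

variable {P : Par n m K l} {s : State} {k : ℕ}

theorem setReg_setReg (s : State) (x v w : ℕ) : (s.setReg x v).setReg x w = s.setReg x w := by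
  simp [State.setReg]

theorem idCode_eq_zero {o : Option (ℕ × Fin m)} (h : ∀ j e, o = some (j, e) → 1 ≤ j) :
    idCode o = 0 ↔ o = none := by
  rcases o with _ | ⟨j, e⟩
  · simp [idCode]
  · have := h j e rfl
    simp [idCode]; omega

theorem labelCode_eq_zero {o : Option (Fin m)} : labelCode o = 0 ↔ o = none := by
  rcases o with _ | j <;> simp [labelCode]

/-- The old stocked color is reserved before the scan, so the scan for a color that is neither used
nor reserved cannot return it. The scan takes `O(Δ)` steps and is run twice per round. The edge `e`
is arbitrary since memory keeps only claim numbers. -/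
theorem run_acquire (hs : Sync P s k b S g) {vr r : ℕ} (hv : vr ≠ 25) (hr8 : 8 ≤ r)
    (hr : r ≠ 25) (hvr : r ≠ vr) (hr13 : r ≠ 13) (hsv : s.reg vr = v) (hid : s.reg 13 = id)
    (h1 : 1 ≤ id) (hpos : ∀ v c j e, g.res v c = some (j, e) → 1 ≤ j)
    (hex : ∃ d, g.tab v d = none ∧ g.res v d = none ∧ d ≠ g.free v) (e : Fin m) :
    Run P.B P.W (acquireProg vr r) s ((K + 2) * 20) (fun s' => ∃ d, g.tab v d = none ∧
      g.res v d = none ∧ d ≠ g.free v ∧ Sync P s' k b S (g.acquire id v d e) ∧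
      s'.reg r = g.free v ∧ (∀ i, i ≠ r → i ≠ 25 → s'.reg i = s.reg i) ∧
      s'.arr 13 = s.arr 13) := by
  obtain ⟨d, hd1, hd2, hd3⟩ := hex
  have hb := hs.bdd
  have hB := P.one_le
  have hK := P.hK
  have hrel := hs.rel
  have hdK := d.2
  have hfree : (Expr.get 11 (.reg vr)).eval s = g.free v := by
    simp only [Expr.eval, hsv]; exact hrel.free v
  refine (Run.assign_seq P.room hb (by rfl) (by exact hb.arr _ _) (t := 8 + (2 + (K * 20 + 3)))
    fun hb₁ => ?_).mono (by simp only [Expr.cost]; omega) fun _ _ h => h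
  rw [hfree] at hb₁ ⊢
  refine (Run.store_seq P.room hb₁ (by rfl) (by exact hb₁.reg _) (t := 2 + (K * 20 + 3))
    fun hb₂ => ?_).mono (by simp only [Expr.cost, cellE]; omega) fun _ _ h => h
  have hix : (cellE (.reg vr) (.reg r)).eval (s.setReg r (g.free v)) = v * K + g.free v := by
    have h4 : (4 : ℕ) ≠ r := by omega
    simp [cellE, Expr.eval, Op.eval, h4, hs.reg4, hsv, hvr.symm]
  have hid' : (Expr.reg 13).eval (s.setReg r (g.free v)) = id := by
    simp [Expr.eval, hr13.symm, hid]
  rw [hix, hid'] at hb₂ ⊢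
  refine (Run.assign_seq P.room hb₂ (by rfl) (by simp [Expr.eval]) (t := K * 20 + 3)
    fun hb₃ => ?_).mono (by simp only [Expr.cost]; omega) fun _ _ h => h
  set s₂ := (s.setReg r (g.free v)).setArr 10 (v * K + g.free v) id with hs₂
  have hreg : ∀ i, i ≠ r → s₂.reg i = s.reg i := fun i hi => by simp [hs₂, hi]
  have h4 : s₂.reg 4 = K := by rw [hreg 4 (by omega), hs.reg4]
  have hv₂ : s₂.reg vr = v := by rw [hreg vr hvr.symm, hsv]
  have h9 : s₂.arr 9 = s.arr 9 := by simp [hs₂]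
  have h10 : ∀ j : Fin K, s₂.arr 10 (v * K + j) = if j = g.free v then id else idCode (g.res v j) := by
    intro j
    simp [hs₂, Function.update_apply, hrel.res, Fin.val_inj]
  have hcond : ∀ j : Fin K, Expr.eval (s₂.setReg 25 j)
      (.op .add (.get 9 (cellE (.reg vr) (.reg 25))) (.get 10 (cellE (.reg vr) (.reg 25)))) = 0 ↔
      g.tab v j = none ∧ g.res v j = none ∧ j ≠ g.free v := by
    intro j
    simp only [cellE, Expr.eval, Op.eval, setReg_reg_self, setReg_reg_ne _ _ hv,
      setReg_reg_ne _ _ (show (4 : ℕ) ≠ 25 by norm_num), setReg_arr, h4, hv₂, h9, h10, hrel.tab,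
      Nat.add_eq_zero_iff, labelCode_eq_zero]
    split_ifs with h
    · simp only [h, ne_eq, not_true, and_false, iff_false, not_and]
      intro _; omega
    · rw [idCode_eq_zero fun j e => hpos _ _ _ _]
      simp [h]
  refine (Run.while P.room (by rfl)
    (fun M s' => ∃ j ≤ (d : ℕ), s' = s₂.setReg 25 j ∧ M + j = d) (t := 4) (N := d) ?_ hb₃
      ⟨0, by omega, rfl, rfl⟩).seq (t₂ := 3) ?_ ?_
  · rintro M s' hb' ⟨j, hj, rfl, hM⟩ h0
    have hjd : j ≠ d := by
      rintro rfl
      exact h0 ((hcond d).2 ⟨hd1, hd2, hd3⟩)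
    refine Run.assign P.room hb' (by rfl) ?_ ⟨M - 1, by omega, j + 1, by omega, ?_, by omega⟩
    · simp only [Expr.eval, Op.eval, setReg_reg_self]; omega
    · simp only [Expr.eval, Op.eval, setReg_reg_self]
      exact setReg_setReg _ _ _ _
  · rintro s' hb' ⟨h0, M, j, hj, rfl, -⟩
    obtain ⟨d', rfl⟩ : ∃ d' : Fin K, (d' : ℕ) = j := ⟨⟨j, by omega⟩, rfl⟩
    obtain ⟨e1, e2, e3⟩ := (hcond d').1 h0
    have hv₃ : (Expr.reg vr).eval (s₂.setReg 25 d') = v := by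
      simp only [Expr.eval, setReg_reg_ne _ _ hv, hv₂]
    have hd₃ : (Expr.reg 25).eval (s₂.setReg 25 d') = d' := by
      simp only [Expr.eval, setReg_reg_self]
    refine Run.store P.room hb' (by rfl) (by exact hb'.reg _) ⟨d', e1, e2, e3, ?_, ?_, ?_, ?_⟩
    · rw [hv₃, hd₃]
      refine hs.congr (hb'.setArr (by have := d'.2; omega)) (fun i hi => ?_) ?_ ?_ ?_
      · rw [setArr_reg, setReg_reg_ne _ _ (by omega), hreg i (by omega)]
      · simp [hs₂]
      · simp [hs₂]
      · refine ⟨?_, ?_, ?_, ?_, fun v' c' => ?_, fun v' => ?_, ?_, fun j => ?_⟩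
        · simpa [hs₂] using hrel.src
        · simpa [hs₂] using hrel.tgt
        · simpa [hs₂, Cfg.acquire] using hrel.col
        · simpa [hs₂, Cfg.acquire] using hrel.tab
        · have hres := hrel.res
          simp only [hs₂, setArr_arr_self, setReg_arr, ne_eq, not_false_eq_true, setArr_arr_ne,
            Nat.reduceEqDiff, Cfg.acquire, upd, Function.update_apply, index_fin_inj]
          split_ifs <;> simp [idCode, hres]
        · have hfr := hrel.free
          simp only [hs₂, setArr_arr_self, setReg_arr, ne_eq, not_false_eq_true, setArr_arr_ne,
            Nat.reduceEqDiff, Cfg.acquire, Function.update_apply, Fin.val_inj]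
          split_ifs <;> simp [hfr]
        · simpa [hs₂, Cfg.acquire] using hrel.own
        · refine (hrel.log j).congr fun i hi => ?_
          rw [setArr_arr_ne _ _ _ (by omega), setReg_arr, hs₂, setArr_arr_ne _ _ _ (by omega),
            setReg_arr]
    · rw [setArr_reg, setReg_reg_ne _ _ hr]; simp [hs₂]
    · intro i hi hi'
      rw [setArr_reg, setReg_reg_ne _ _ hi', hreg i hi]
    · simp [hs₂]
  · have : ((d : ℕ) + 1) * 20 ≤ K * 20 := Nat.mul_le_mul_right _ (by omega)
    simp only [Expr.cost, cellE]
    omega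

/-- The memory between two rounds. -/
def Idle (P : Par n m K l) (k : ℕ) (s : State) : Prop :=
  ∃ S g, Sync P s k k S g ∧ Base P.N (P.fut k) P.T (l + 1) P.U₀ k k S g

theorem Par.fut_succ_subset (P : Par n m K l) (k : ℕ) : P.fut (k + 1) ⊆ P.fut k :=
  fun _ he => ⟨he.1, fun j hj => he.2 j (by omega)⟩

theorem run_start (hI : Idle P k s) (hb : s.Bdd P.B) (hkl : k < l) :
    Run P.B P.W startProg s ((K + 3) * 40) (FanLoop P k K) := by
  obtain ⟨S, g, hs, hB⟩ := hI
  have hrel := hs.rel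
  set e := P.U ⟨k, hkl⟩ with he
  have heF : e ∈ P.fut k := ⟨P.mem _, fun j hj h => by
    have := congrArg Fin.val (P.inj h); simp only at this; omega⟩
  have heF' : e ∉ P.fut (k + 1) := fun h => h.2 ⟨k, hkl⟩ (by simp) rfl
  have hB' : Base P.N (P.fut (k + 1)) P.T (l + 1) P.U₀ (k + 1) k S g :=
    hB.next (P.fut_succ_subset k)
  have hcol := hB.core.fut e heF
  have hno : ∀ v c j, g.res v c ≠ some (j, e) := fun v c j hr => hB.core.res_fut _ _ _ _ hr heF
  have hlog : g.log (k + 1) = .none := hB.log_none _ (Or.inr (by omega))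
  set z := P.N.tgt e
  set x := P.N.src e
  have hends : P.N.Ends e z x := Or.inr ⟨rfl, rfl⟩
  have hm := P.hm
  have hn := P.hn
  have hl := P.hl
  have hsync : ∀ {S g}, Sync P s k k S g → Sync P s k (k + 1) S g := fun h =>
    ⟨h.bdd, h.reg1, h.reg3, h.reg4, h.reg5, h.reg6, h.reg7, h.arr3,
      fun i => (h.stamp i).trans (by omega), h.rel⟩
  have h3 : s.arr 3 k = e := hs.arr3 ⟨k, hkl⟩
  have hx : s.arr 0 e = x := hrel.src e
  have hz : s.arr 1 e = z := hrel.tgt e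
  refine (Run.assign_seq P.room hb (by rfl) (by exact hb.arr _ _)
    (t := 3 + 1 + (3 + 1 + (4 + (2 + ((K + 2) * 20 + (K + 2) * 20)))))
    fun hb₁ => ?_).mono (by simp only [Expr.cost]; omega) fun _ _ h => h
  refine (Run.assign_seq P.room hb₁ (by rfl) (by exact hb₁.arr _ _)
    (t := (3 + 1 + (4 + (2 + ((K + 2) * 20 + (K + 2) * 20)))))
    fun hb₂ => ?_).mono (by simp only [Expr.cost]; omega) fun _ _ h => h
  refine (Run.assign_seq P.room hb₂ (by rfl) (by exact hb₂.arr _ _)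
    (t := (4 + (2 + ((K + 2) * 20 + (K + 2) * 20))))
    fun hb₃ => ?_).mono (by simp only [Expr.cost]; omega) fun _ _ h => h
  refine (Run.assign_seq P.room hb₃ (by rfl)
    (by simp [Expr.eval, Op.eval, hs.reg6]; omega)
    (t := ((2 + ((K + 2) * 20 + (K + 2) * 20))))
    fun hb₄ => ?_).mono (by simp only [Expr.cost]; omega) fun _ _ h => h
  refine (Run.assign_seq P.room hb₄ (by rfl) (by simp [Expr.eval])
    (t := (((K + 2) * 20 + (K + 2) * 20)))
    fun hb₅ => ?_).mono (by simp only [Expr.cost]; omega) fun _ _ h => h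
  simp only [Expr.eval, Op.eval, setReg_reg_self, setReg_arr, ne_eq, not_false_eq_true,
    setReg_reg_ne, Nat.reduceEqDiff, hs.reg6, h3, hx, hz] at hb₁ hb₂ hb₃ hb₄ hb₅ ⊢
  set s₅ := ((((s.setReg 12 e).setReg 9 x).setReg 8 z).setReg 13 (k + 1)).setReg 16 0 with hs₅
  have hsync₅ : Sync P s₅ k (k + 1) S g := (hsync hs).congr hb₅ (fun i hi => by
    rw [hs₅]; repeat rw [setReg_reg_ne _ _ (by omega)]) rfl rfl hrel
  refine (run_acquire hsync₅ (by norm_num) (by norm_num) (by norm_num) (by norm_num)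
    (by norm_num) (v := z) (by simp [hs₅]) (id := k + 1) (by simp [hs₅]) (by omega)
    (fun v c j e hr => (hB.res_le v c j e hr).1)
    (exists_fresh P.deg hB.core hends.inc_left hcol fun c' j => hno _ _ _) e).seq ?_ le_rfl
  rintro s₆ hb₆ ⟨d, d1, d2, d3, hs₆, hc₆, hr₆, ha₆⟩
  have A₁ : AcqData P.N (P.fut (k + 1)) g (k + 1) z d e :=
    ⟨hB'.core, hends.inc_left, hcol, heF', fun c j => hno _ _ _,
      fun v' c j h => absurd h (hno _ _ _), d1, d2, d3⟩
  have B₁ := hB'.acquire A₁ hlog (by omega) le_rfl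
  have hfresh : ∀ c j, (g.acquire (k + 1) z d e).res x c ≠ some (j, e) := by
    intro c j hr
    rcases A₁.res_iff.1 hr with ⟨h, -⟩ | h
    · exact hends.ne h.symm
    · exact hno _ _ _ h
  refine (run_acquire hs₆ (by norm_num) (by norm_num) (by norm_num) (by norm_num)
    (by norm_num) (v := x) (by rw [hr₆ _ (by norm_num) (by norm_num)]; simp [hs₅]) (id := k + 1)
    (by rw [hr₆ _ (by norm_num) (by norm_num)]; simp [hs₅]) (by omega)
    (fun v c j e hr => (B₁.res_le v c j e hr).1)
    (exists_fresh P.deg B₁.core hends.inc_right hcol hfresh) e).mono le_rfl ?_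
  rintro s₇ hb₇ ⟨d', d1', d2', d3', hs₇, hc₇, hr₇, ha₇⟩
  have A₂ : AcqData P.N (P.fut (k + 1)) (g.acquire (k + 1) z d e) (k + 1) x d' e :=
    ⟨B₁.core, hends.inc_right, hcol, heF', hfresh, fun v' c j h => by
      rcases A₁.res_iff.1 h with ⟨-, -, h, -⟩ | h
      · exact h
      · exact absurd h (hno _ _ _), d1', d2', d3'⟩
  have B₂ := B₁.acquire A₂ hlog (by omega) le_rfl
  have hbusy : Busy P.N (P.fut (k + 1)) P.T (l + 1) P.U₀ (k + 1) k S
      ((g.acquire (k + 1) z d e).acquire (k + 1) x d' e) (k + 1) z x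
      ((g.acquire (k + 1) z d e).free x) (g.free z) e := by
    refine ⟨B₂, ⟨hends, A₂.res_iff.2 (Or.inr (A₁.res_iff.2 (Or.inl ⟨rfl, rfl, rfl, rfl⟩))),
      A₂.res_iff.2 (Or.inl ⟨rfl, rfl, rfl, rfl⟩), fun v c' e' hr => ?_⟩, hlog, by omega⟩
    rcases A₂.res_iff.1 hr with ⟨-, -, -, h⟩ | hr
    · exact h
    rcases A₁.res_iff.1 hr with ⟨-, -, -, h⟩ | hr
    · exact h
    · have := (hB.res_le _ _ _ _ hr).2; omega
  have hreg : ∀ i, i ≠ 11 → i ≠ 10 → i ≠ 25 → s₇.reg i = s₅.reg i := fun i h1 h2 h3 => by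
    rw [hr₇ i h2 h3, hr₆ i h1 h3]
  refine Or.inl ⟨?_, S, _, z, x, _, _, e, [], ⟨hs₇, ⟨?_, ?_, hc₇, ?_, ?_, ?_⟩, hbusy⟩,
    ⟨hbusy, trivial, List.nodup_nil, fun i => ?_, fun i => ?_, by simp⟩, by simp⟩
  · rw [hreg 16 (by norm_num) (by norm_num) (by norm_num)]; simp [hs₅]
  · rw [hreg 8 (by norm_num) (by norm_num) (by norm_num)]; simp [hs₅]
  · rw [hreg 9 (by norm_num) (by norm_num) (by norm_num)]; simp [hs₅]
  · rw [hr₇ 11 (by norm_num) (by norm_num), hc₆]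
  · rw [hreg 12 (by norm_num) (by norm_num) (by norm_num)]; simp [hs₅]
  · rw [hreg 13 (by norm_num) (by norm_num) (by norm_num)]; simp [hs₅]
  -- Stamps and owners from earlier rounds are at most `k`. The new claim number `k + 1` marks
  -- nothing yet, so no array has to be cleared.
  · have := hs.stamp i
    have : s₇.arr 13 i ≤ k := by rw [ha₇, ha₆]; simpa [hs₅] using this
    simp only [List.not_mem_nil, iff_false]
    omega
  · have := hB.own_le i
    change g.own i ≠ k + 1
    omega

theorem run_mainLoop (hI : Idle P 0 s) (hb : s.Bdd P.B) :
    Run P.B P.W mainLoop s ((l + 1) * ((K + P.T + 10) * 1100)) (Idle P l) := by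
  refine (Run.while P.room (by rfl) (fun N s => ∃ k, N + k = l ∧ Idle P k s)
    (t := (K + 3) * 40 + ((K + P.T + 10) * 1000 + 4)) (N := l) ?_ hb ⟨0, rfl, hI⟩).mono ?_ ?_
  · rintro N s hb ⟨k, hk, hI⟩ h0
    have hkl : k < l := by
      obtain ⟨S, g, hs, -⟩ := hI
      by_contra h
      simp [Expr.eval, Op.eval, hs.reg6, hs.reg3, h] at h0
    refine (run_start hI hb hkl).seq (fun s₁ hb₁ h₁ => ?_) le_rfl
    refine (run_stages h₁ hb₁ hkl).seq (fun s₂ hb₂ ⟨S, g, hs, hB⟩ => ?_) le_rfl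
    have hl := P.hl
    have hv : (Expr.op .add (.reg 6) (.lit 1)).eval s₂ = k + 1 := by
      simp [Expr.eval, Op.eval, hs.reg6]
    refine Run.assign P.room hb₂ (by rfl) (by rw [hv]; omega)
      ⟨N - 1, by omega, k + 1, by omega, S, g, ?_, hB⟩
    rw [hv]
    exact ⟨hb₂.setReg (by omega), by simp [hs.reg1], by simp [hs.reg3], by simp [hs.reg4],
      by simp [hs.reg5], by simp, by simp [hs.reg7], hs.arr3, hs.stamp, hs.rel⟩
  · gcongr
    simp only [Expr.cost]
    omega
  · rintro s' - ⟨h0, N, k, hk, hI⟩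
    have : k = l := by
      obtain ⟨S, g, hs, -⟩ := id hI
      by_contra h
      have : k < l := by omega
      simp [Expr.eval, Op.eval, hs.reg6, hs.reg3, this] at h0
    exact this ▸ hI

end

end EdgeColoring

/-! ## Initialization -/

namespace EdgeColoring

open WordRAM

/-- Enter the color of the edge in register `6` into the table. -/
def enterProg : Prog :=
  .assign 14 (.get 2 (.reg 6)) ;;
  .ite (.reg 14)
    (.store 9 (cellE (.get 0 (.reg 6)) (.op .sub (.reg 14) (.lit 1)))
      (.op .add (.reg 6) (.lit 1)) ;;
    .store 9 (cellE (.get 1 (.reg 6)) (.op .sub (.reg 14) (.lit 1)))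
      (.op .add (.reg 6) (.lit 1))) .skip ;;
  .assign 6 (.op .add (.reg 6) (.lit 1))

/-- Advance the free color of the vertex `v` if it is not missing. -/
def advanceProg (v : Expr) : Prog :=
  .store 11 v (.op .add (.get 11 v) (.op .lt (.lit 0) (.get 9 (cellE v (.get 11 v)))))

/-- Set up all data structures. -/
def initProg : Prog :=
  .assign 5 (.op .add (.op .div (.op .mul (.lit 2) (.reg 1)) (.reg 3)) (.lit 1)) ;;
  .assign 4 (.op .add (.reg 2) (.lit 1)) ;;
  .while (.op .lt (.reg 6) (.reg 1)) enterProg ;;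
  .assign 6 (.lit 0) ;;
  .while (.op .lt (.reg 6) (.reg 1)) (advanceProg (.get 0 (.reg 6)) ;;
    advanceProg (.get 1 (.reg 6)) ;; .assign 6 (.op .add (.reg 6) (.lit 1))) ;;
  .assign 6 (.lit 0)

section

variable {n m K l : ℕ}

/-- Edges that share an endpoint have different colors. -/
def Net.Proper (N : Net n m) (col : Fin m → Option (Fin K)) : Prop :=
  ∀ v i j c, N.Inc v i → N.Inc v j → col i = some c → col j = some c → i = j

open Classical in
/-- The edge of each color at each vertex. -/
noncomputable def Net.table (N : Net n m) (col : Fin m → Option (Fin K)) (v : Fin n) (c : Fin K) :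
    Option (Fin m) :=
  if h : ∃ i, N.Inc v i ∧ col i = some c then some h.choose else none

variable {N : Net n m} {col : Fin m → Option (Fin K)} {v : Fin n} {c : Fin K} {e : Fin m}

theorem Net.Proper.table_iff (h : N.Proper col) :
    N.table col v c = some e ↔ N.Inc v e ∧ col e = some c := by
  unfold Net.table
  constructor
  · intro h'
    split_ifs at h' with hex
    cases h'
    exact hex.choose_spec
  · rintro ⟨h1, h2⟩
    have hex : ∃ i, N.Inc v i ∧ col i = some c := ⟨e, h1, h2⟩
    rw [dif_pos hex]
    exact congrArg some (h v _ _ c hex.choose_spec.1 h1 hex.choose_spec.2 h2)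

theorem Net.Proper.table_eq_none (h : N.Proper col) :
    N.table col v c = none ↔ ∀ i, N.Inc v i → col i ≠ some c := by
  rw [Option.eq_none_iff_forall_ne_some]
  simp only [ne_eq, h.table_iff, not_and]

/-- The memory during the initialization, at position `i` of the edge list. -/
structure Start (P : Par n m K l) (col : Fin m → Option (Fin K)) (i : ℕ) (s : State) : Prop where
  bdd : s.Bdd P.B
  reg1 : s.reg 1 = m
  reg3 : s.reg 3 = l
  reg4 : s.reg 4 = K
  reg5 : s.reg 5 = P.T
  reg6 : s.reg 6 = i
  reg7 : s.reg 7 = 0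
  src : ∀ i : Fin m, s.arr 0 i = P.N.src i
  tgt : ∀ i : Fin m, s.arr 1 i = P.N.tgt i
  col : ∀ i : Fin m, s.arr 2 i = labelCode (col i)
  arr3 : ∀ j : Fin l, s.arr 3 j = P.U j
  zero : ∀ a, a = 10 ∨ 12 ≤ a → ∀ i, s.arr a i = 0

/-- The first `i` edges have been entered into the table. -/
def Entered (P : Par n m K l) (col : Fin m → Option (Fin K)) (i : ℕ) (s : State) : Prop :=
  ∀ (v : Fin n) (c : Fin K), (s.arr 9 (v * K + c) = 0 ∧
    ∀ j : Fin m, j < i → ¬ (P.N.Inc v j ∧ col j = some c)) ∨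
    ∃ j : Fin m, j < i ∧ s.arr 9 (v * K + c) = j + 1 ∧ P.N.Inc v j ∧ col j = some c

variable {P : Par n m K l} {s s' : State} {i : ℕ}

theorem Start.congr (h : Start P col i s) (hb : s'.Bdd P.B) {i' : ℕ}
    (hr : ∀ r < 8, r ≠ 6 → s'.reg r = s.reg r) (h6 : s'.reg 6 = i')
    (ha : ∀ a, a ≠ 9 → a ≠ 11 → s'.arr a = s.arr a) : Start P col i' s' :=
  ⟨hb, (hr 1 (by norm_num) (by norm_num)).trans h.reg1,
    (hr 3 (by norm_num) (by norm_num)).trans h.reg3,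
    (hr 4 (by norm_num) (by norm_num)).trans h.reg4,
    (hr 5 (by norm_num) (by norm_num)).trans h.reg5, h6,
    (hr 7 (by norm_num) (by norm_num)).trans h.reg7,
    fun i => by rw [ha 0 (by norm_num) (by norm_num)]; exact h.src i,
    fun i => by rw [ha 1 (by norm_num) (by norm_num)]; exact h.tgt i,
    fun i => by rw [ha 2 (by norm_num) (by norm_num)]; exact h.col i,
    fun i => by rw [ha 3 (by norm_num) (by norm_num)]; exact h.arr3 i,
    fun a h' i => by rw [ha a (by omega) (by omega)]; exact h.zero a h' i⟩

/-- The invariant only asks that a nonzero cell name some matching edge, so overwriting is harmless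
and properness plays no role here. It makes the entry unique in `Entered.table`. -/
theorem run_enter (h : Start P col i s) (he : Entered P col i s) (hi : i < m) :
    Run P.B P.W enterProg s enterProg.time (fun s' => Start P col (i + 1) s' ∧
      Entered P col (i + 1) s' ∧ s'.arr 11 = s.arr 11) := by
  have hm := P.hm
  have hK := P.hK
  have hB := P.one_le
  obtain ⟨e, rfl⟩ : ∃ e : Fin m, (e : ℕ) = i := ⟨⟨i, hi⟩, rfl⟩
  have hcol := h.col e
  have hnone : col e = none → enterProg.final s = (s.setReg 14 0).setReg 6 (e + 1) := by
    intro hce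
    simp [enterProg, Prog.final, Expr.eval, Op.eval, h.reg6, hcol, hce, labelCode]
  have hsome : ∀ c₀, col e = some c₀ → enterProg.final s =
      (((s.setReg 14 (c₀ + 1)).setArr 9 (P.N.src e * K + c₀) (e + 1)).setArr 9
        (P.N.tgt e * K + c₀) (e + 1)).setReg 6 (e + 1) := by
    intro c₀ hce
    simp [enterProg, Prog.final, Expr.eval, Op.eval, h.reg6, hcol, hce, labelCode, cellE, h.reg4,
      h.src, h.tgt]
  refine (Run.flat P.room (by rfl) h.bdd ?_).mono le_rfl ?_
  · have he1 : (e : ℕ) + 1 ≤ P.B := by omega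
    rcases hce : col e with _ | c₀ <;>
      simp [enterProg, Prog.Safe, Prog.final, Expr.eval, Op.eval, h.reg6, hcol, hce, labelCode, he1]
    have := c₀.2
    omega
  rintro s' hb' rfl
  rcases hce : col e with _ | c₀
  · rw [hnone hce] at hb' ⊢
    refine ⟨h.congr hb' (fun r hr h6 => ?_) (by simp) fun _ _ _ => rfl, fun v c => ?_, rfl⟩
    · have h14 : r ≠ 14 := by omega
      simp [h6, h14]
    · rcases he v c with ⟨h1, h2⟩ | ⟨j, h1, h2⟩
      · refine Or.inl ⟨h1, fun j hj => ?_⟩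
        rcases Nat.lt_succ_iff_lt_or_eq.1 hj with hj | hj
        · exact h2 j hj
        · obtain rfl := Fin.val_injective hj
          simp [hce]
      · exact Or.inr ⟨j, by omega, h2⟩
  · rw [hsome c₀ hce] at hb' ⊢
    refine ⟨h.congr hb' (fun r hr h6 => ?_) (by simp) fun a h9 h11 => by simp [h9],
      fun v c => ?_, by simp⟩
    · have h14 : r ≠ 14 := by omega
      simp [h6, h14]
    · have h9 : ((((s.setReg 14 (c₀ + 1)).setArr 9 (P.N.src e * K + c₀) (e + 1)).setArr 9
          (P.N.tgt e * K + c₀) (e + 1)).setReg 6 (e + 1)).arr 9 (v * K + c) =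
          if (v = P.N.src e ∨ v = P.N.tgt e) ∧ c = c₀ then (e : ℕ) + 1
            else s.arr 9 (v * K + c) := by
        simp only [setReg_arr, setArr_arr_self, Function.update_apply, index_fin_inj]
        by_cases hA : v = P.N.src e <;> by_cases hB : v = P.N.tgt e <;> by_cases hC : c = c₀ <;>
          simp [hA, hB, hC]
      rw [h9]
      split_ifs with hif
      · exact Or.inr ⟨e, by omega, rfl, hif.1.imp Eq.symm Eq.symm, by rw [hce, hif.2]⟩
      · rcases he v c with ⟨h1, h2⟩ | ⟨j, h1, h2⟩
        · refine Or.inl ⟨h1, fun j hj => ?_⟩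
          rcases Nat.lt_succ_iff_lt_or_eq.1 hj with hj | hj
          · exact h2 j hj
          · obtain rfl := Fin.val_injective hj
            rintro ⟨hinc, hc⟩
            rw [hce] at hc
            exact hif ⟨hinc.imp Eq.symm Eq.symm, (Option.some.inj hc).symm⟩
        · exact Or.inr ⟨j, by omega, h2⟩

theorem Entered.table (h : Entered P col m s) (hp : P.N.Proper col) (v : Fin n) (c : Fin K) :
    s.arr 9 (v * K + c) = labelCode (P.N.table col v c) := by
  rcases h v c with ⟨h1, h2⟩ | ⟨j, -, h1, h2⟩
  · rw [h1, (hp.table_eq_none).2 fun i hi hc => h2 i i.2 ⟨hi, hc⟩]; rfl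
  · rw [h1, hp.table_iff.2 h2]; rfl

/-- The number of the first `i` edges that contain `v`. -/
noncomputable def Net.degBefore (N : Net n m) (i : ℕ) (v : Fin n) : ℕ :=
  {j : Fin m | (j : ℕ) < i ∧ N.Inc v j}.ncard

theorem Net.degBefore_succ (N : Net n m) (e : Fin m) (v : Fin n) [Decidable (N.Inc v e)] :
    N.degBefore (e + 1) v = N.degBefore e v + if N.Inc v e then 1 else 0 := by
  unfold Net.degBefore
  split_ifs with h
  · rw [← Set.ncard_insert_of_notMem (a := e)]
    · congr 1
      ext j
      simp only [Set.mem_ofPred_eq, Set.mem_insert_iff, Nat.lt_succ_iff_lt_or_eq, Fin.val_inj]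
      constructor
      · rintro ⟨h1 | h1, h2⟩
        · exact Or.inr ⟨h1, h2⟩
        · exact Or.inl h1
      · rintro (rfl | ⟨h1, h2⟩)
        · exact ⟨Or.inr rfl, h⟩
        · exact ⟨Or.inl h1, h2⟩
    · simp
  · rw [add_zero]
    congr 1
    ext j
    simp only [Set.mem_ofPred_eq, Nat.lt_succ_iff_lt_or_eq, Fin.val_inj]
    constructor
    · rintro ⟨h1 | rfl, h2⟩
      · exact ⟨h1, h2⟩
      · exact absurd h2 h
    · rintro ⟨h1, h2⟩
      exact ⟨Or.inl h1, h2⟩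

theorem Par.degBefore_lt (P : Par n m K l) (i : ℕ) (v : Fin n) : P.N.degBefore i v < K :=
  (Set.ncard_le_ncard (fun _ h => h.2) (Set.toFinite _)).trans_lt (P.deg v)

/-- A candidate `f` for a missing color of `v`, after `i` edges. -/
def Candidate (N : Net n m) (col : Fin m → Option (Fin K)) (v : Fin n) (i f : ℕ) : Prop :=
  (∀ c : Fin K, c < f → N.table col v c ≠ none) ∧
    (f = N.degBefore i v ∨ ∃ h : f < K, N.table col v ⟨f, h⟩ = none)

theorem Candidate.lt {f : ℕ} (h : Candidate P.N col v i f) : f < K := by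
  rcases h.2 with rfl | ⟨h, -⟩
  · exact P.degBefore_lt i v
  · exact h

theorem Candidate.keep {f : ℕ} (h : Candidate N col v e f) (hv : ¬ N.Inc v e) :
    Candidate N col v (e + 1) f := by
  classical
  refine ⟨h.1, h.2.imp_left fun h => ?_⟩
  rw [h, N.degBefore_succ, if_neg hv, add_zero]

/-- Each edge at `v` pays for one test of the candidate: either a missing color has been found, or
the candidate equals the number of incident edges seen so far. This gives a missing color at every
vertex in `O(m)` steps, instead of a scan per vertex. -/
theorem Candidate.advance {f : ℕ} (h : Candidate P.N col v e f) (hv : P.N.Inc v e) :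
    Candidate P.N col v (e + 1)
      (f + if 0 < labelCode (P.N.table col v ⟨f, h.lt⟩) then 1 else 0) := by
  classical
  rcases ht : P.N.table col v ⟨f, h.lt⟩ with _ | i
  · simp only [labelCode, lt_irrefl, if_false, add_zero]
    exact ⟨h.1, Or.inr ⟨h.lt, ht⟩⟩
  · simp only [labelCode, Nat.succ_pos, if_true]
    refine ⟨fun c hc => ?_, Or.inl ?_⟩
    · rcases Nat.lt_succ_iff_lt_or_eq.1 hc with hc | hc
      · exact h.1 c hc
      · have : c = ⟨f, h.lt⟩ := Fin.val_injective hc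
        rw [this, ht]; simp
    · rcases h.2 with h' | ⟨h1, h2⟩
      · rw [P.N.degBefore_succ, if_pos hv, h']
      · rw [ht] at h2; cases h2

/-- In the remaining case the candidate is the degree of `v`. If it were used as well, the colors up
to and including it would lie on one more edge at `v` than there are. -/
theorem Candidate.missing {f : ℕ} (h : Candidate P.N col v m f) (hp : P.N.Proper col) :
    P.N.table col v ⟨f, h.lt⟩ = none := by
  rcases h.2 with h' | ⟨h1, h2⟩
  swap
  · exact h2
  by_contra hne
  have hall : ∀ c : Fin (f + 1), ∃ i, P.N.table col v ⟨c, by have := h.lt; have := c.2; omega⟩ =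
      some i := by
    intro c
    apply Option.ne_none_iff_exists'.1
    rcases Nat.lt_succ_iff_lt_or_eq.1 c.2 with hc | hc
    · exact h.1 _ hc
    · simp only [hc]; exact hne
  choose φ hφ using hall
  have hinj : Function.Injective φ := by
    intro c c' hcc
    have h1 := (hp.table_iff.1 (hφ c)).2
    have h2 := (hp.table_iff.1 (hφ c')).2
    rw [hcc, h2] at h1
    simpa [Fin.ext_iff, eq_comm] using h1
  have hsub : Set.range φ ⊆ {j | (j : ℕ) < m ∧ P.N.Inc v j} := by
    rintro _ ⟨c, rfl⟩
    exact ⟨(φ c).2, (hp.table_iff.1 (hφ c)).1⟩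
  have hcard := Set.ncard_le_ncard hsub (Set.toFinite _)
  rw [Set.ncard_range_of_injective hinj, Nat.card_eq_fintype_card, Fintype.card_fin] at hcard
  have : f = {j : Fin m | (j : ℕ) < m ∧ P.N.Inc v j}.ncard := h'
  omega

/-- The vertex expression is restricted to two concrete forms so that its size and cost can be
evaluated. Vertices other than `v` keep their candidates, which allows treating the two endpoints
one after the other. -/
theorem run_advance (h : Start P col e s) (he : Entered P col m s) (hp : P.N.Proper col)
    {ve : Expr} (hve : ve = .get 0 (.reg 6) ∨ ve = .get 1 (.reg 6)) (hv : ve.eval s = v)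
    (hi : P.N.Inc v e) (hc : Candidate P.N col v e (s.arr 11 v)) :
    Run P.B P.W (advanceProg ve) s 30 (fun s' => Start P col e s' ∧ Entered P col m s' ∧
      Candidate P.N col v (e + 1) (s'.arr 11 v) ∧
      ∀ w : Fin n, w ≠ v → s'.arr 11 w = s.arr 11 w) := by
  have hval : (Expr.op .add (.get 11 ve) (.op .lt (.lit 0) (.get 9 (cellE ve (.get 11 ve))))).eval s
      = s.arr 11 v + if 0 < labelCode (P.N.table col v ⟨s.arr 11 v, hc.lt⟩) then 1 else 0 := by
    have := he.table hp v ⟨s.arr 11 v, hc.lt⟩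
    simp only [Expr.eval, Op.eval, cellE, hv, h.reg4, ← this]
  have hadv := hc.advance hi
  have hlt := hadv.lt
  have hK := P.hK
  have hB : (Expr.op .add (.get 11 ve)
      (.op .lt (.lit 0) (.get 9 (cellE ve (.get 11 ve))))).eval s ≤ P.B := by omega
  refine (Run.store P.room h.bdd (by rcases hve with rfl | rfl <;> rfl) hB ?_).mono
    (by rcases hve with rfl | rfl <;> decide) fun _ _ h => h
  rw [hv]
  refine ⟨h.congr (h.bdd.setArr hB) (fun _ _ _ => rfl) h.reg6 fun a _ h11 => by simp [h11], ?_, ?_,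
    fun w hw => ?_⟩
  · intro w c
    rw [setArr_arr_ne _ _ _ (by norm_num)]
    exact he w c
  · rw [setArr_arr_self, Function.update_self, hval]
    exact hadv
  · simp [Fin.val_inj, hw]

end

end EdgeColoring

/-! ## Correctness of the initialization -/

namespace EdgeColoring

open WordRAM

section

variable {n m K l : ℕ} {P : Par n m K l} {col : Fin m → Option (Fin K)} {s : State} {i : ℕ}

/-- The memory holds the input. -/
structure Input (P : Par n m K l) (col : Fin m → Option (Fin K)) (s : State) : Prop where
  bdd : s.Bdd P.B
  reg1 : s.reg 1 = m
  reg2 : s.reg 2 + 1 = K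
  reg3 : s.reg 3 = l
  reg6 : s.reg 6 = 0
  reg7 : s.reg 7 = 0
  src : ∀ i : Fin m, s.arr 0 i = P.N.src i
  tgt : ∀ i : Fin m, s.arr 1 i = P.N.tgt i
  col : ∀ i : Fin m, s.arr 2 i = labelCode (col i)
  arr3 : ∀ j : Fin l, s.arr 3 j = P.U j
  zero : ∀ a, 9 ≤ a → ∀ i, s.arr a i = 0

theorem run_enterLoop (h : Start P col 0 s) (he : Entered P col 0 s) (h11 : ∀ i, s.arr 11 i = 0) :
    Run P.B P.W (.while (.op .lt (.reg 6) (.reg 1)) enterProg) s ((m + 1) * 100)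
      (fun s' => Start P col m s' ∧ Entered P col m s' ∧ ∀ i, s'.arr 11 i = 0) := by
  refine (Run.while P.room (by rfl) (fun N s => ∃ i, N + i = m ∧ Start P col i s ∧
    Entered P col i s ∧ ∀ i, s.arr 11 i = 0) (t := enterProg.time) (N := m) ?_ h.bdd
    ⟨0, rfl, h, he, h11⟩).mono ?_ ?_
  · rintro N s hb ⟨i, hi, h, he, h11⟩ h0
    have him : i < m := by
      by_contra h'
      simp [Expr.eval, Op.eval, h.reg6, h.reg1, h'] at h0
    refine (run_enter h he him).mono le_rfl ?_
    rintro s' - ⟨h1, h2, h3⟩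
    exact ⟨N - 1, by omega, i + 1, by omega, h1, h2, by rw [h3]; exact h11⟩
  · gcongr
    decide
  · rintro s' - ⟨h0, N, i, hi, h, he, h11⟩
    have him : i = m := by
      by_contra h'
      have : i < m := by omega
      simp [Expr.eval, Op.eval, h.reg6, h.reg1, this] at h0
    subst him
    exact ⟨h, he, h11⟩

theorem run_advanceLoop (hp : P.N.Proper col) (h : Start P col 0 s) (he : Entered P col m s)
    (hc : ∀ v : Fin n, Candidate P.N col v 0 (s.arr 11 v)) :
    Run P.B P.W (.while (.op .lt (.reg 6) (.reg 1)) (advanceProg (.get 0 (.reg 6)) ;;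
      advanceProg (.get 1 (.reg 6)) ;; .assign 6 (.op .add (.reg 6) (.lit 1)))) s ((m + 1) * 100)
      (fun s' => Start P col m s' ∧ Entered P col m s' ∧
        ∀ v : Fin n, Candidate P.N col v m (s'.arr 11 v)) := by
  refine (Run.while P.room (by rfl) (fun N s => ∃ i, N + i = m ∧ Start P col i s ∧
    Entered P col m s ∧ ∀ v : Fin n, Candidate P.N col v i (s.arr 11 v)) (t := 30 + (30 + 4)) (N := m)
    ?_ h.bdd ⟨0, rfl, h, he, hc⟩).mono ?_ ?_
  · rintro N s hb ⟨i, hi, h, he, hc⟩ h0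
    have him : i < m := by
      by_contra h'
      simp [Expr.eval, Op.eval, h.reg6, h.reg1, h'] at h0
    obtain ⟨e, rfl⟩ : ∃ e : Fin m, (e : ℕ) = i := ⟨⟨i, him⟩, rfl⟩
    have hm := P.hm
    have hne := P.N.ne e
    refine (run_advance (v := P.N.src e) h he hp (Or.inl rfl)
      (by simp [Expr.eval, h.reg6, h.src]) (Or.inl rfl) (hc _)).seq ?_ le_rfl
    rintro s₁ hb₁ ⟨h₁, he₁, hc₁, ho₁⟩
    refine (run_advance (v := P.N.tgt e) h₁ he₁ hp (Or.inr rfl)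
      (by simp [Expr.eval, h₁.reg6, h₁.tgt]) (Or.inr rfl)
      (by rw [ho₁ _ hne.symm]; exact hc _)).seq ?_ le_rfl
    rintro s₂ hb₂ ⟨h₂, he₂, hc₂, ho₂⟩
    have hv : (Expr.op .add (.reg 6) (.lit 1)).eval s₂ = e + 1 := by
      simp [Expr.eval, Op.eval, h₂.reg6]
    refine Run.assign P.room hb₂ (by rfl) (by rw [hv]; omega) ⟨N - 1, by omega, e + 1, by omega, ?_⟩
    rw [hv]
    refine ⟨h₂.congr (hb₂.setReg (by omega)) (fun r _ h6 => setReg_reg_ne _ _ h6) (by simp)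
      fun _ _ _ => rfl, he₂, fun v => ?_⟩
    rw [setReg_arr]
    by_cases hv1 : v = P.N.tgt e
    · rw [hv1]; exact hc₂
    · rw [ho₂ _ hv1]
      by_cases hv2 : v = P.N.src e
      · rw [hv2]; exact hc₁
      · rw [ho₁ _ hv2]
        refine (hc v).keep ?_
        rintro (h | h)
        · exact hv2 h.symm
        · exact hv1 h.symm
  · gcongr
    decide
  · rintro s' - ⟨h0, N, i, hi, h, he, hc⟩
    have him : i = m := by
      by_contra h'
      have : i < m := by omega
      simp [Expr.eval, Op.eval, h.reg6, h.reg1, this] at h0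
    subst him
    exact ⟨h, he, hc⟩

/-- Zero memory already encodes no reservations, no owners and an empty log, since claim numbers
start at 1. Only the color table and the stocked colors had to be computed. -/
theorem idle_zero (hp : P.N.Proper col) (hF : ∀ i, i ∈ P.F₀ ↔ col i = none) (h : Start P col 0 s)
    (he : Entered P col m s) (hc : ∀ v : Fin n, Candidate P.N col v m (s.arr 11 v)) :
    Idle P 0 s := by
  refine ⟨0, ⟨col, P.N.table col, fun _ _ => none, fun v => ⟨s.arr 11 v, (hc v).lt⟩, fun _ => 0,
    fun _ => .none⟩, ⟨h.bdd, h.reg1, h.reg3, h.reg4, h.reg5, h.reg6, h.reg7, h.arr3,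
    fun i => (h.zero 13 (by norm_num) i).le, ⟨h.src, h.tgt, h.col, he.table hp,
    fun v c => h.zero 10 (by norm_num) _, fun v => rfl, fun i => h.zero 12 (by norm_num) _,
    fun j => h.zero 14 (by norm_num) _⟩⟩, ⟨⟨fun v c i => hp.table_iff, ?_, ?_, ?_, ?_, ?_, ?_,
    fun v => (hc v).missing hp, fun _ => rfl, fun e he => (hF e).1 he.1⟩, ⟨?_, ?_, ?_⟩,
    fun _ _ => rfl, ?_, fun _ => le_rfl, ?_, Nat.zero_le _⟩⟩
  all_goals try simp
  rw [Par.U₀]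
  congr 1
  ext i
  exact (hF i).symm

theorem run_init (hp : P.N.Proper col) (hF : ∀ i, i ∈ P.F₀ ↔ col i = none)
    (hT : P.T = 2 * m / l + 1) (h : Input P col s) :
    Run P.B P.W initProg s ((m + 1) * 300) (Idle P 0) := by
  have hB := P.hT
  have hK := P.hK
  have hv₁ : (Expr.op .add (.op .div (.op .mul (.lit 2) (.reg 1)) (.reg 3)) (.lit 1)).eval s
      = P.T := by
    simp [Expr.eval, Op.eval, h.reg1, h.reg3, hT]
  refine (Run.assign_seq P.room h.bdd (by rfl) (by rw [hv₁]; omega)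
    (t := 4 + ((m + 1) * 100 + (2 + ((m + 1) * 100 + 2)))) fun hb₁ => ?_).mono
    (by simp only [Expr.cost]; omega) fun _ _ h => h
  rw [hv₁] at hb₁ ⊢
  have hv₂ : (Expr.op .add (.reg 2) (.lit 1)).eval (s.setReg 5 P.T) = K := by
    simp [Expr.eval, Op.eval, h.reg2]
  refine (Run.assign_seq P.room hb₁ (by rfl) (by rw [hv₂]; omega)
    (t := ((m + 1) * 100 + (2 + ((m + 1) * 100 + 2)))) fun hb₂ => ?_).mono
    (by simp only [Expr.cost]; omega) fun _ _ h => h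
  rw [hv₂] at hb₂ ⊢
  have hst : Start P col 0 ((s.setReg 5 P.T).setReg 4 K) :=
    ⟨hb₂, by simp [h.reg1], by simp [h.reg3], by simp, by simp, by simp [h.reg6], by simp [h.reg7],
      h.src, h.tgt, h.col, h.arr3, fun a ha => h.zero a (by omega)⟩
  have hen : Entered P col 0 ((s.setReg 5 P.T).setReg 4 K) := fun v c =>
    Or.inl ⟨h.zero 9 le_rfl _, fun j hj => absurd hj (by omega)⟩
  refine (run_enterLoop hst hen fun i => h.zero 11 (by norm_num) i).seq ?_ le_rfl
  rintro s₃ hb₃ ⟨hst₃, hen₃, h11⟩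
  refine Run.assign_seq P.room hb₃ (by rfl) (by simp [Expr.eval]) fun hb₄ => ?_
  have hst₄ : Start P col 0 (s₃.setReg 6 0) :=
    hst₃.congr hb₄ (fun r _ h6 => setReg_reg_ne _ _ h6) (by simp [Expr.eval]) fun _ _ _ => rfl
  refine (run_advanceLoop hp hst₄ hen₃ fun v => ?_).seq ?_ le_rfl
  · rw [setReg_arr, h11]
    refine ⟨fun c hc => absurd hc (by omega), Or.inl ?_⟩
    simp [Net.degBefore]
  rintro s₅ hb₅ ⟨hst₅, hen₅, hc₅⟩
  refine Run.assign P.room hb₅ (by rfl) (by simp [Expr.eval]) ?_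
  exact idle_zero hp hF (hst₅.congr (hb₅.setReg (by simp [Expr.eval]))
    (fun r _ h6 => setReg_reg_ne _ _ h6) (by simp [Expr.eval]) fun _ _ _ => rfl) hen₅ hc₅

end

end EdgeColoring

/-! ## Output -/

namespace EdgeColoring

open WordRAM

/-- Is the claim in register `6` a u-fan that still holds its colors? -/
def fanE : Expr :=
  .op .mul (.op .eq (.get 14 (.reg 6)) (.lit 2))
    (.op .mul
      (.op .eq (.get 10 (cellE (.get 15 (.reg 6)) (.get 18 (.reg 6)))) (.reg 6))
      (.op .mul
        (.op .eq (.get 10 (cellE (.get 16 (.reg 6)) (.get 19 (.reg 6)))) (.reg 6))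
        (.op .eq (.get 10 (cellE (.get 17 (.reg 6)) (.get 19 (.reg 6)))) (.reg 6))))

/-- Append the u-fan in register `6` to the output. -/
def copyProg : Prog :=
  .store 4 (.reg 1) (.get 15 (.reg 6)) ;; .store 5 (.reg 1) (.get 16 (.reg 6)) ;;
  .store 6 (.reg 1) (.get 17 (.reg 6)) ;;
  .store 7 (.reg 1) (.op .add (.get 18 (.reg 6)) (.lit 1)) ;;
  .store 8 (.reg 1) (.op .add (.get 19 (.reg 6)) (.lit 1)) ;;
  .assign 1 (.op .add (.reg 1) (.lit 1))

/-- Report the outcome. -/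
def outProg : Prog :=
  .ite (.op .lt (.op .mul (.lit 16) (.reg 7)) (.reg 3))
    (.assign 6 (.lit 1) ;; .assign 1 (.lit 0) ;;
      .while (.op .lt (.reg 6) (.op .add (.reg 3) (.lit 1)))
        (.ite fanE copyProg .skip ;; .assign 6 (.op .add (.reg 6) (.lit 1))) ;;
      .assign 0 (.lit 2))
    (.assign 0 (.lit 1))

section

variable {n m K l : ℕ} {N : Net n m} {F : Set (Fin m)} {T M U₀ b q S r : ℕ} {g : Cfg n m K}
  {P : Par n m K l} {s s' : State} {i j : ℕ}

theorem not_valid_zero (h : Base N F T M U₀ b q S g) : ¬ g.Valid 0 :=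
  not_valid_of_log (h.log_none 0 (Or.inl rfl))

/-- A recorded u-fan counts only if all three of its cells still name its claim. The number `0` must
be excluded because it also encodes an absent reservation. -/
theorem fanE_iff (hrel : Rel N g s.arr) (h4 : s.reg 4 = K) (hj : s.reg 6 = j) (hj0 : j ≠ 0) :
    fanE.eval s ≠ 0 ↔ g.Valid j := by
  have hl := hrel.log j
  simp only [fanE, Expr.eval, Op.eval, cellE, hj, h4]
  rcases hlog : g.log j with _ | ⟨z, x, a, c, e⟩ | ⟨u, v, w, α, β⟩
  · rw [hlog] at hl
    simp only [HoldsRec] at hl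
    simp [hl, not_valid_of_log hlog]
  · rw [hlog] at hl
    simp only [HoldsRec] at hl
    simp only [hl.1]
    refine iff_of_false (by simp) ?_
    rintro ⟨_, _, _, _, _, _, _, _, h, -⟩
    rw [hlog] at h; cases h
  · rw [hlog] at hl
    obtain ⟨h1, h2, h3, h4, h5, h6⟩ := hl
    simp only [h1, h2, h3, h4, h5, h6, hrel.res, idCode_eq hj0, if_true]
    constructor
    · intro h
      by_cases hA : ∃ e, g.res u α = some (j, e)
      · by_cases hB : ∃ e, g.res v β = some (j, e)
        · by_cases hC : ∃ e, g.res w β = some (j, e)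
          · obtain ⟨e₁, hA⟩ := hA
            obtain ⟨e₂, hB⟩ := hB
            obtain ⟨e₃, hC⟩ := hC
            exact ⟨_, _, _, _, _, _, _, _, hlog, hA, hB, hC⟩
          · simp [hC] at h
        · simp [hB] at h
      · simp [hA] at h
    · rintro ⟨u', v', w', α', β', e₁, e₂, e₃, hl', hA, hB, hC⟩
      rw [hlog] at hl'; cases hl'
      simp [hA, hB, hC]

open Classical in
/-- The `r` members of the family `f` are the u-fans of the valid claims below `i`. -/
structure Listed (g : Cfg n m K) (i r : ℕ) (J : Fin r → ℕ) (f : Fin r → FanTuple (Fin n) K) :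
    Prop where
  inj : Function.Injective J
  lt : ∀ t, J t < i
  valid : ∀ t, g.Valid (J t)
  log : ∀ t, g.log (J t) = .fan (f t).u (f t).v (f t).w (f t).α (f t).β
  card : r = ((Finset.range i).filter g.Valid).card

theorem Listed.skip {J : Fin r → ℕ} {f : Fin r → FanTuple (Fin n) K} (h : Listed g i r J f)
    (hi : ¬ g.Valid i) : Listed g (i + 1) r J f := by
  classical
  refine ⟨h.inj, fun t => (h.lt t).trans (by omega), h.valid, h.log, ?_⟩
  rw [Finset.range_add_one, Finset.filter_insert, if_neg hi]
  convert h.card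

theorem Listed.snoc {J : Fin r → ℕ} {f : Fin r → FanTuple (Fin n) K} (h : Listed g i r J f)
    (hi : g.Valid i) {f' : FanTuple (Fin n) K} (hf : g.log i = .fan f'.u f'.v f'.w f'.α f'.β) :
    Listed g (i + 1) (r + 1) (Fin.snoc (α := fun _ => ℕ) J i)
      (Fin.snoc (α := fun _ => FanTuple (Fin n) K) f f') := by
  classical
  refine ⟨Fin.snoc_injective_of_injective h.inj ?_, fun t => ?_, fun t => ?_, fun t => ?_, ?_⟩
  · rintro ⟨t, ht⟩
    have := h.lt t
    omega
  · refine Fin.lastCases ?_ (fun t => ?_) t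
    · simp
    · simpa using (h.lt t).trans (Nat.lt_succ_self i)
  · refine Fin.lastCases ?_ (fun t => ?_) t
    · simpa using hi
    · simpa using h.valid t
  · refine Fin.lastCases ?_ (fun t => ?_) t
    · simpa using hf
    · simpa using h.log t
  · rw [Finset.range_add_one, Finset.filter_insert, if_pos hi,
      Finset.card_insert_of_notMem (by simp)]
    congr 1
    convert h.card

/-- The memory while the output is written. -/
structure Out (P : Par n m K l) (g : Cfg n m K) (i : ℕ) (s : State) : Prop where
  bdd : s.Bdd P.B
  reg3 : s.reg 3 = l
  reg4 : s.reg 4 = K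
  reg6 : s.reg 6 = i
  rel : Rel P.N g s.arr
  fans : ∃ (r : ℕ) (J : Fin r → ℕ) (f : Fin r → FanTuple (Fin n) K),
    Listed g i r J f ∧ HoldsFans s f

theorem run_copy (h : Out P g i s) (hi : g.Valid i) (hil : i ≤ l) :
    Run P.B P.W (copyProg ;; .assign 6 (.op .add (.reg 6) (.lit 1))) s 50 (Out P g (i + 1)) := by
  classical
  obtain ⟨u, v, w, α, β, -, -, -, hlog, -⟩ := id hi
  have hl := h.rel.log i
  rw [hlog] at hl
  obtain ⟨h1, h2, h3, h4, h5, h6⟩ := hl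
  obtain ⟨r, J, f, hL, hr, hf⟩ := h.fans
  have hrl : r ≤ i := by
    rw [hL.card]
    exact (Finset.card_filter_le _ _).trans (by simp)
  have hK := P.hK
  have hBl := P.hl
  have hα := α.2
  have hβ := β.2
  refine (Run.flat P.room (by rfl) h.bdd ?_).mono (by decide) ?_
  · simp [copyProg, Prog.Safe, Prog.final, Expr.eval, Op.eval, h.bdd.arr, h.reg6, h5, h6, hr]
    omega
  rintro s' hb' rfl
  have hrel := h.rel
  refine ⟨hb', ?_, ?_, ?_, ?_, r + 1, _, _, hL.snoc hi (f' := ⟨u, v, w, α, β⟩) hlog, ?_, ?_⟩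
  · simp [copyProg, Prog.final, h.reg3]
  · simp [copyProg, Prog.final, h.reg4]
  · simp [copyProg, Prog.final, Expr.eval, Op.eval, h.reg6]
  · refine ⟨?_, ?_, ?_, ?_, ?_, ?_, ?_, fun j => (hrel.log j).congr fun i hi => ?_⟩
    · simpa [copyProg, Prog.final] using hrel.src
    · simpa [copyProg, Prog.final] using hrel.tgt
    · simpa [copyProg, Prog.final] using hrel.col
    · simpa [copyProg, Prog.final] using hrel.tab
    · simpa [copyProg, Prog.final] using hrel.res
    · simpa [copyProg, Prog.final] using hrel.free
    · simpa [copyProg, Prog.final] using hrel.own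
    · simp only [copyProg, Prog.final, setReg_arr]
      repeat rw [setArr_arr_ne _ _ _ (by omega)]
  · simp [copyProg, Prog.final, Expr.eval, Op.eval, hr]
  · intro t
    refine Fin.lastCases ?_ (fun t => ?_) t
    · simp [copyProg, Prog.final, Expr.eval, Op.eval, hr, h.reg6, h2, h3, h4, h5, h6, labelCode]
    · have ht : (t : ℕ) ≠ r := by have := t.2; omega
      have := hf t
      simpa [copyProg, Prog.final, Expr.eval, Op.eval, hr, Function.update_apply, ht] using this

theorem run_outLoop (h : Out P g 1 s) :
    Run P.B P.W (.while (.op .lt (.reg 6) (.op .add (.reg 3) (.lit 1)))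
        (.ite fanE copyProg .skip ;; .assign 6 (.op .add (.reg 6) (.lit 1)))) s ((l + 1) * 200)
      (Out P g (l + 1)) := by
  have hl := P.hl
  refine (Run.while P.room (by rfl) (fun N s => ∃ i, 1 ≤ i ∧ N + i = l + 1 ∧ Out P g i s) (t := 150)
    (N := l) ?_ h.bdd ⟨1, le_rfl, rfl, h⟩).mono ?_ ?_
  · rintro N s hb ⟨i, hi, hN, h⟩ h0
    have hil : i ≤ l := by
      by_contra h'
      have : ¬ i < l + 1 := by omega
      simp [Expr.eval, Op.eval, h.reg6, h.reg3, this] at h0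
    have hiff := fanE_iff h.rel h.reg4 h.reg6 (by omega)
    by_cases hv : g.Valid i
    -- The run of copying and incrementing is split so that its first half can be placed inside the
    -- conditional.
    · obtain ⟨t, s', ht, hex, hb', h'⟩ := run_copy h hv hil
      cases hex with
      | seq e₁ e₂ =>
        refine ⟨_, s', ?_, .seq (.ite_true (Expr.fits P.room hb (by rfl)) (hiff.2 hv) e₁) e₂, hb',
          N - 1, by omega, i + 1, by omega, by omega, h'⟩
        have : fanE.cost ≤ 60 := by decide
        omega
    · have hv' : (Expr.op .add (.reg 6) (.lit 1)).eval s = i + 1 := by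
        simp [Expr.eval, Op.eval, h.reg6]
      refine (Run.ite_add P.room hb (by rfl) (t₁ := 1) (t₂ := 1) (Q := fun s' => s' = s)
        (fun h' => absurd (hiff.1 h') hv) fun _ => Run.skip hb rfl).seq (t₂ := 4) ?_ (by decide)
      rintro s' - rfl
      refine Run.assign P.room hb (by rfl) (by rw [hv']; omega)
        ⟨N - 1, by omega, i + 1, by omega, by omega, ?_⟩
      rw [hv']
      obtain ⟨r, J, f, hL, hr, hf⟩ := h.fans
      exact ⟨hb.setReg (by omega), by simp [h.reg3], by simp [h.reg4], by simp, h.rel,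
        r, J, f, hL.skip hv, by simpa using hr, hf⟩
  · gcongr
    decide
  · rintro s' - ⟨h0, N, i, hi, hN, h⟩
    have : i = l + 1 := by
      by_contra h'
      have : i < l + 1 := by omega
      simp [Expr.eval, Op.eval, h.reg6, h.reg3, this] at h0
    exact this ▸ h

theorem run_out (hI : Idle P l s) (hb : s.Bdd P.B) :
    Run P.B P.W outProg s ((l + 2) * 200) (fun s' => ∃ S g,
      Base P.N (P.fut l) P.T (l + 1) P.U₀ l l S g ∧ (∀ i : Fin m, s'.arr 2 i = labelCode (g.col i)) ∧
      ((s'.reg 0 = 1 ∧ l ≤ 16 * S) ∨ (s'.reg 0 = 2 ∧ 16 * S < l ∧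
        ∃ (r : ℕ) (J : Fin r → ℕ) (f : Fin r → FanTuple (Fin n) K),
          Listed g (l + 1) r J f ∧ HoldsFans s' f))) := by
  classical
  obtain ⟨S, g, hs, hB⟩ := hI
  have hroom := P.one_le
  refine (Run.ite_add P.room hb (by rfl) (t₁ := 2 + (2 + ((l + 1) * 200 + 2))) (t₂ := 2)
    (fun h0 => ?_) fun h0 => ?_).mono (by simp only [Expr.cost]; omega) fun _ _ h => h
  · have hS : 16 * S < l := by
      by_contra h
      simp [Expr.eval, Op.eval, hs.reg7, hs.reg3, h] at h0
    refine Run.assign_seq P.room hb (by rfl) (by simp only [Expr.eval]; omega) fun hb₁ => ?_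
    refine Run.assign_seq P.room hb₁ (by rfl) (by simp only [Expr.eval]; omega) fun hb₂ => ?_
    refine (run_outLoop ⟨hb₂, by simp [hs.reg3], by simp [hs.reg4], by simp [Expr.eval], hs.rel,
      0, Fin.elim0, Fin.elim0, ⟨fun t => t.elim0, fun t => t.elim0, fun t => t.elim0,
      fun t => t.elim0, ?_⟩, by simp [Expr.eval], fun t => t.elim0⟩).seq ?_ le_rfl
    · symm
      rw [Finset.card_eq_zero, Finset.filter_eq_empty_iff]
      intro j hj
      have : j = 0 := by simpa using hj
      rw [this]
      exact not_valid_zero hB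
    rintro s₃ hb₃ h₃
    obtain ⟨r, J, f, hL, hr, hf⟩ := h₃.fans
    exact Run.assign P.room hb₃ (by rfl) (by simp only [Expr.eval]; omega)
      ⟨S, g, hB, h₃.rel.col, Or.inr ⟨by simp [Expr.eval], hS, r, J, f, hL, by simpa using hr, hf⟩⟩
  · have hS : l ≤ 16 * S := by
      by_contra h
      have : 16 * S < l := by omega
      simp [Expr.eval, Op.eval, hs.reg7, hs.reg3, this] at h0
    exact Run.assign P.room hb (by rfl) (by simp only [Expr.eval]; omega)
      ⟨S, g, hB, hs.rel.col, Or.inl ⟨by simp [Expr.eval], hS⟩⟩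

open Classical in
/-- The trails of the live pending tokens are disjoint. -/
theorem Base.live_mul_le (h : Base N F T M U₀ b q S g) :
    ((Finset.range M).filter g.Live).card * T ≤ m := by
  have hfib : ∀ j ∈ (Finset.range M).filter g.Live,
      (Finset.univ.filter fun i : Fin m => g.own i = j).card = T := by
    intro j hj
    have hlive := (Finset.mem_filter.1 hj).2
    obtain ⟨z, x, a, c, e, hlog, -⟩ := id hlive
    obtain ⟨es, -, hnd, hlen, hown⟩ := h.claims.trail j z x a c e hlog hlive
    rw [← hlen, ← List.toFinset_card_of_nodup hnd]
    congr 1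
    ext i
    simp [hown]
  -- The trail of a live claim is the whole fiber of `own` over its number, and fibers of a function
  -- are disjoint.
  rw [← smul_eq_mul, ← Finset.sum_const, ← Finset.sum_congr rfl hfib]
  rw [← Finset.card_biUnion]
  · exact (Finset.card_le_univ _).trans (by simp)
  · intro j _ j' _ hne
    rw [Function.onFun, Finset.disjoint_filter]
    intro i _ h1 h2
    exact hne (h1.symm.trans h2)

open Classical in
/-- If few edges have been colored then there are many u-fans. -/
theorem Base.many_valid (h : Base N F T M U₀ b l S g) (hT : T = 2 * m / l + 1) (hS : 16 * S < l) :
    l ≤ 16 * ((Finset.range M).filter g.Valid).card := by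
  have h1 := h.live_mul_le
  have h2 := h.count
  unfold Cfg.score at h2
  set p := ((Finset.range M).filter g.Live).card
  have hl : 0 < l := by omega
  -- The choice of `T` makes `p * T ≤ m` force `2 * p < l`. Then `l ≤ p + 2 * v + 5 * S` with `16 *
  -- S < l` leaves `2 * v > 3 * l / 16`, where `v` is the number of valid u-fans.
  have h3 : 2 * m < l * T := by
    rw [hT]; exact Nat.lt_mul_div_succ _ hl
  have h4 : 2 * p < l := by
    by_contra hcon
    have : l * T ≤ 2 * p * T := Nat.mul_le_mul_right _ (by omega)
    nlinarith
  omega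

end

end EdgeColoring

/-! ## The algorithm -/

namespace EdgeColoring

open WordRAM

/-- The algorithm. In each round, one of the given uncolored edges becomes a token that is moved by a
fan and then along an alternating path, until its edge can be colored, until it meets the trail of a
pending token, with which it forms a u-fan, or until the trail is so long that the token is left
pending. Live tokens and u-fans reserve missing colors at their vertices. -/
def algorithm : Prog := initProg ;; mainLoop ;; outProg

section

variable {n m Δ l K : ℕ} {G : SimpleGraph (Fin n)}

/-- The edge list as a net. -/
def EdgeList.net (L : EdgeList G m) : Net n m where
  src := L.src
  tgt := L.tgt
  ne i h := by
    have h1 : s(L.src i, L.tgt i) ∈ G.edgeSet := L.edge_eq i ▸ (L.edge i).2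
    rw [SimpleGraph.mem_edgeSet, h] at h1
    exact h1.ne rfl
  simple i j h := by
    rw [← L.edge_eq, ← L.edge_eq] at h
    exact L.edge.injective (Subtype.ext h)

variable (L : EdgeList G m)

theorem EdgeList.inc_iff {v : Fin n} {i : Fin m} : L.net.Inc v i ↔ v ∈ (L.edge i).1 := by
  rw [L.edge_eq, Sym2.mem_iff, Net.Inc, eq_comm (a := v), eq_comm (a := v)]
  rfl

theorem EdgeList.ends_iff {u v : Fin n} {i : Fin m} :
    L.net.Ends i u v ↔ (L.edge i).1 = s(u, v) := by
  rw [L.edge_eq, Sym2.eq_iff, Net.Ends]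
  rfl

theorem EdgeList.ncard_inc_le [DecidableRel G.Adj] (v : Fin n) :
    {i | L.net.Inc v i}.ncard ≤ G.degree v := by
  rw [← G.card_incidenceFinset_eq_degree, ← Set.ncard_coe_finset]
  refine Set.ncard_le_ncard_of_injOn (fun i => (L.edge i).1) (fun i hi => ?_) ?_ (Set.toFinite _)
  · simp only [SimpleGraph.coe_incidenceFinset]
    exact ⟨(L.edge i).2, L.inc_iff.1 hi⟩
  · intro i _ j _ h
    exact L.edge.injective (Subtype.ext h)

/-- Edges have distinct pairs of endpoints. This keeps `m`, and with it all memory contents,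
polynomial in `n`. -/
theorem EdgeList.le_sq (L : EdgeList G m) : m ≤ n * n := by
  have h : Function.Injective fun i => (L.src i, L.tgt i) := by
    intro i j h
    apply L.net.simple
    simp only [Prod.mk.injEq] at h
    change s(L.src i, L.tgt i) = s(L.src j, L.tgt j)
    rw [h.1, h.2]
  simpa using Fintype.card_le_of_injective _ h

theorem EdgeList.maxDegree_le (L : EdgeList G m) [DecidableRel G.Adj] : G.maxDegree ≤ m := by
  refine G.maxDegree_le_of_forall_degree_le m fun v => (G.degree_le_card_edgeFinset v).trans ?_
  rw [SimpleGraph.edgeFinset_card, ← Fintype.card_congr L.edge, Fintype.card_fin]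

/-- The labels along the edge list. -/
def EdgeList.labels (χ : PartialLabeling G K) (i : Fin m) : Option (Fin K) := χ (L.edge i)

/-- A labeling from labels along the edge list. -/
def EdgeList.labeling (col : Fin m → Option (Fin K)) : PartialLabeling G K :=
  fun e => col (L.edge.symm e)

variable {L}

theorem EdgeList.proper_labels {χ : PartialLabeling G K} (h : IsPartialColoring χ) :
    L.net.Proper (L.labels χ) := by
  intro v i j c hi hj hci hcj
  by_contra hne
  exact h (L.edge i) (L.edge j) (fun h => hne (L.edge.injective h))
    ⟨v, L.inc_iff.1 hi, L.inc_iff.1 hj⟩ c hci hcj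

theorem EdgeList.labeling_edge (col : Fin m → Option (Fin K)) (i : Fin m) :
    L.labeling col (L.edge i) = col i := by
  simp [EdgeList.labeling]

theorem EdgeList.ncard_uncolored (χ : PartialLabeling G K) :
    (uncolored χ).ncard = {i | χ (L.edge i) = none}.ncard := by
  rw [← Set.ncard_image_of_injective _ L.edge.injective]
  congr 1
  ext e
  simp only [uncolored, Set.mem_ofPred_eq, Set.mem_image]
  constructor
  · intro h
    exact ⟨L.edge.symm e, by simpa using h, by simp⟩
  · rintro ⟨i, hi, rfl⟩
    exact hi

variable {F : Set (Fin m)} {T M U₀ b q S r : ℕ} {g : Cfg n m K}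

theorem Core.isPartialColoring (h : Core L.net F g) : IsPartialColoring (L.labeling g.col) := by
  rintro e f hne ⟨x, hxe, hxf⟩ c hc hc'
  obtain ⟨i, rfl⟩ := L.edge.surjective e
  obtain ⟨j, rfl⟩ := L.edge.surjective f
  rw [EdgeList.labeling_edge] at hc hc'
  have h1 := (h.tab_iff x c i).2 ⟨L.inc_iff.2 hxe, hc⟩
  have h2 := (h.tab_iff x c j).2 ⟨L.inc_iff.2 hxf, hc'⟩
  rw [h1] at h2
  exact hne (congrArg L.edge (Option.some.inj h2))

theorem Core.mem_missing (h : Core L.net F g) {x : Fin n} {c : Fin K} (ht : g.tab x c = none) :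
    c ∈ missing (L.labeling g.col) x := by
  intro e hx hc
  obtain ⟨i, rfl⟩ := L.edge.surjective e
  rw [EdgeList.labeling_edge] at hc
  rw [(h.tab_iff x c i).2 ⟨L.inc_iff.2 hx, hc⟩] at ht
  cases ht

/-- A u-fan that holds its colors for claim `j`. -/
structure Holds (L : EdgeList G m) (g : Cfg n m K) (j : ℕ) (f : FanTuple (Fin n) K) : Prop where
  v_ne_w : f.v ≠ f.w
  α_ne_β : f.α ≠ f.β
  uv : ∃ e, L.net.Ends e f.u f.v ∧ g.res f.v f.β = some (j, e)
  uw : ∃ e, L.net.Ends e f.u f.w ∧ g.res f.w f.β = some (j, e)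
  center : ∃ e, L.net.Ends e f.u f.v ∧ g.res f.u f.α = some (j, e)

theorem Base.holds (h : Base L.net F T M U₀ b q S g) {j : ℕ} (hv : g.Valid j)
    {f : FanTuple (Fin n) K} (hlog : g.log j = .fan f.u f.v f.w f.α f.β) : Holds L g j f := by
  obtain ⟨u, v, w, α, β, e₁, e₂, e₃, hl, h1, h2, h3⟩ := hv
  rw [hlog] at hl
  cases hl
  obtain ⟨c1, c2, c3, c4, c5⟩ := h.claims.fan _ _ _ _ _ _ hlog
  exact ⟨c1, c2, ⟨_, c4 _ h2, h2⟩, ⟨_, c5 _ h3, h3⟩, ⟨_, c3 _ h1, h1⟩⟩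

theorem Holds.assigned {j : ℕ} {f : FanTuple (Fin n) K} (h : Holds L g j f) {x : Fin n}
    (hx : x ∈ f.verts) : ∃ e, g.res x (f.assigned x) = some (j, e) := by
  obtain ⟨e₁, h1, r1⟩ := h.uv
  obtain ⟨e₂, h2, r2⟩ := h.uw
  obtain ⟨e₃, -, r3⟩ := h.center
  rcases hx with rfl | rfl | rfl
  · exact ⟨e₃, by simpa [FanTuple.assigned] using r3⟩
  · exact ⟨e₁, by simpa [FanTuple.assigned, h1.ne.symm] using r1⟩
  · exact ⟨e₂, by simpa [FanTuple.assigned, h2.ne.symm] using r2⟩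

theorem Holds.edge {j : ℕ} {f : FanTuple (Fin n) K} (h : Holds L g j f) {p : Sym2 (Fin n)}
    (hp : p ∈ f.edges) : ∃ e v c, (L.edge e).1 = p ∧ g.res v c = some (j, e) := by
  obtain ⟨e₁, h1, r1⟩ := h.uv
  obtain ⟨e₂, h2, r2⟩ := h.uw
  rcases hp with rfl | rfl
  · exact ⟨e₁, _, _, L.ends_iff.1 h1, r1⟩
  · exact ⟨e₂, _, _, L.ends_iff.1 h2, r2⟩

theorem exists_adj_get_eq_none {u v : Fin n} {e : Fin m} (he : L.net.Ends e u v)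
    (hc : g.col e = none) : ∃ h : G.Adj u v, (L.labeling g.col).get u v h = none := by
  have h1 := L.ends_iff.1 he
  have hadj : G.Adj u v := by
    rw [← SimpleGraph.mem_edgeSet, ← h1]
    exact (L.edge e).2
  refine ⟨hadj, ?_⟩
  have h2 : L.edge e = ⟨s(u, v), hadj⟩ := Subtype.ext h1
  have h3 := EdgeList.labeling_edge (L := L) g.col e
  rw [h2, hc] at h3
  exact h3

/-- Each listed u-fan still holds its assigned colors under its own claim number. A color at a
vertex has one holder, so assigned colors differ; an uncolored edge serves one claim (`res_id`), so
edges are disjoint; a reserved color is missing, so each member is a u-fan. -/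
theorem Base.isSeparable (h : Base L.net F T M U₀ b q S g) {J : Fin r → ℕ}
    {f : Fin r → FanTuple (Fin n) K} {i : ℕ} (hL : Listed g i r J f) :
    IsSeparable (L.labeling g.col) f := by
  have hh : ∀ t, Holds L g (J t) (f t) := fun t => h.holds (hL.valid t) (hL.log t)
  have k := h.core
  refine ⟨fun t => ?_, fun i j hij => ?_, fun i j hij x hxi hxj heq => ?_⟩
  · obtain ⟨e₁, h1, r1⟩ := (hh t).uv
    obtain ⟨e₂, h2, r2⟩ := (hh t).uw
    obtain ⟨e₃, -, r3⟩ := (hh t).center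
    exact ⟨h1.ne, h2.ne, (hh t).v_ne_w, (hh t).α_ne_β, exists_adj_get_eq_none h1 (k.res_col _ _ _ _ r1),
      exists_adj_get_eq_none h2 (k.res_col _ _ _ _ r2), k.mem_missing (k.res_tab _ _ _ _ r3),
      k.mem_missing (k.res_tab _ _ _ _ r1), k.mem_missing (k.res_tab _ _ _ _ r2)⟩
  · rw [Set.disjoint_left]
    intro p hp hp'
    obtain ⟨e, v, c, he, hr⟩ := (hh i).edge hp
    obtain ⟨e', v', c', he', hr'⟩ := (hh j).edge hp'
    obtain rfl := L.edge.injective (Subtype.ext (he.trans he'.symm))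
    exact hij (hL.inj (k.res_id _ _ _ _ _ _ _ hr hr'))
  · obtain ⟨e, hr⟩ := (hh i).assigned hxi
    obtain ⟨e', hr'⟩ := (hh j).assigned hxj
    rw [heq, hr'] at hr
    simp only [Option.some.injEq, Prod.mk.injEq] at hr
    exact hij (hL.inj hr.1.symm)

/-- At least `S` of the given edges have been colored. -/
theorem Base.le_ncard_colored {P : Par n m K l} (h : Base P.N (P.fut l) T M P.U₀ b q S g) :
    S ≤ {j : Fin l | g.col (P.U j) ≠ none}.ncard := by
  set A := {j : Fin l | g.col (P.U j) ≠ none}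
  have h1 : (P.fut l).ncard + l = P.U₀ := by
    have hr : (Set.range P.U).ncard = l := by
      rw [Set.ncard_range_of_injective P.inj, Nat.card_eq_fintype_card, Fintype.card_fin]
    suffices h : (P.fut l).ncard + (Set.range P.U).ncard = P.U₀ by rwa [hr] at h
    rw [Par.U₀, ← Set.ncard_union_eq ?_ (Set.toFinite _) (Set.toFinite _)]
    · congr 1
      ext e
      simp only [Par.fut, Set.mem_union, Set.mem_ofPred_eq, Set.mem_range]
      constructor
      · rintro (h | ⟨j, rfl⟩)
        · exact h.1
        · exact P.mem j
      · intro he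
        by_cases hj : ∃ j, P.U j = e
        · exact Or.inr hj
        · exact Or.inl ⟨he, fun j _ h => hj ⟨j, h⟩⟩
    · rw [Set.disjoint_left]
      rintro e he ⟨j, rfl⟩
      exact he.2 j j.2 rfl
  -- The initially uncolored edges outside `U` are never touched. Together with the given edges that
  -- are still uncolored they number at most `U₀ - S`, so at least `S` of the given edges are
  -- colored, wherever the tokens have moved.
  have h2 : (P.fut l).ncard + (P.U '' Aᶜ).ncard ≤ {i | g.col i = none}.ncard := by
    rw [← Set.ncard_union_eq ?_ (Set.toFinite _) (Set.toFinite _)]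
    · refine Set.ncard_le_ncard ?_ (Set.toFinite _)
      rintro e (he | ⟨j, hj, rfl⟩)
      · exact h.core.fut e he
      · simpa [A] using hj
    · rw [Set.disjoint_left]
      rintro _ he ⟨j, -, rfl⟩
      exact he.2 j j.2 rfl
  rw [Set.ncard_image_of_injective _ P.inj] at h2
  have h3 := Set.ncard_add_ncard_compl A
  rw [Nat.card_eq_fintype_card, Fintype.card_fin] at h3
  have h4 := h.unc
  omega

theorem run_algorithm {P : Par n m K l} {col : Fin m → Option (Fin K)} {s : State}
    (hp : P.N.Proper col) (hF : ∀ i, i ∈ P.F₀ ↔ col i = none) (hT : P.T = 2 * m / l + 1)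
    (h : Input P col s) :
    Run P.B P.W algorithm s
      ((m + 1) * 300 + ((l + 1) * ((K + P.T + 10) * 1100) + (l + 2) * 200)) (fun s' => ∃ S g,
      Base P.N (P.fut l) P.T (l + 1) P.U₀ l l S g ∧ (∀ i : Fin m, s'.arr 2 i = labelCode (g.col i)) ∧
      ((s'.reg 0 = 1 ∧ l ≤ 16 * S) ∨ (s'.reg 0 = 2 ∧ 16 * S < l ∧
        ∃ (r : ℕ) (J : Fin r → ℕ) (f : Fin r → FanTuple (Fin n) K),
          Listed g (l + 1) r J f ∧ HoldsFans s' f))) :=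
  (run_init hp hF hT h).seq (fun _ hb₁ h₁ => (run_mainLoop h₁ hb₁).seq
    (fun _ hb₂ h₂ => run_out h₂ hb₂) le_rfl) le_rfl

/-- The walks cost `l * T = O(m + l)`. The additional `Δ` and `l` terms are absorbed by `m`. For `l
= 0` the quotient is `0` by convention. -/
theorem time_le (hl : l ≤ m) (hΔ : Δ ≤ m) :
    (m + 1) * 300 + ((l + 1) * ((Δ + 1 + (2 * m / l + 1) + 10) * 1100) + (l + 2) * 200) ≤
      40000 * (m + Δ * l + 1) := by
  have h1 : (l + 1) * (2 * m / l + 1) ≤ 4 * m + 2 * l + 1 := by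
    rcases Nat.eq_zero_or_pos l with rfl | hpos
    · simp
    · have := Nat.mul_div_le (2 * m) l
      have h2 : 2 * m / l ≤ l * (2 * m / l) := Nat.le_mul_of_pos_left _ hpos
      nlinarith
  have h2 : (l + 1) * ((Δ + 1 + (2 * m / l + 1) + 10) * 1100) =
      1100 * (Δ * l + Δ + 11 * l + 11 + (l + 1) * (2 * m / l + 1)) := by ring
  rw [h2]
  omega

end

/-- The algorithm is correct and fast. -/
theorem algorithm_correct {n m Δ l : ℕ} {G : SimpleGraph (Fin n)} [DecidableRel G.Adj]
    (hΔ : G.maxDegree = Δ) (L : EdgeList G m) (χ : PartialLabeling G (Δ + 1))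
    (hχ : IsPartialColoring χ) (U : Fin l → Fin m) (hU : Function.Injective U)
    (hmem : ∀ j, L.edge (U j) ∈ uncolored χ) :
    ∃ (t : ℕ) (s : State) (χ' : PartialLabeling G (Δ + 1)),
      Exec ((n + 2) ^ 40000) algorithm (inputState L χ U) t s ∧
      t ≤ 40000 * (m + Δ * l + 1) ∧ IsPartialColoring χ' ∧ HoldsLabeling s L χ' ∧
      ((s.reg 0 = 1 ∧ Extends L χ U χ' (1 / 16 * l)) ∨
        (s.reg 0 = 2 ∧ (uncolored χ').ncard ≤ (uncolored χ).ncard ∧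
          ∃ (r : ℕ) (F : Fin r → FanTuple (Fin n) (Δ + 1)),
            1 / 16 * (l : ℝ) ≤ r ∧ IsSeparable χ' F ∧ HoldsFans s F)) := by
  have hlm : l ≤ m := by simpa using Fintype.card_le_of_injective U hU
  have hΔm : Δ ≤ m := hΔ ▸ L.maxDegree_le
  have hmn := L.le_sq
  have hdiv : 2 * m / l ≤ 2 * m := Nat.div_le_self _ _
  have h2 : 2 ≤ n + 2 := by omega
  have hB₁ : n ≤ (n + 2) ^ 4 := (show n ≤ n + 2 by omega).trans (Nat.le_self_pow (by norm_num) _)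
  have hB₂ : 2 * m + 2 ≤ (n + 2) ^ 4 := by
    have : (n + 2) ^ 4 = n * n * (n * n + 8 * n + 24) + 32 * n + 16 := by ring
    nlinarith [Nat.zero_le (n * n * (n * n + 8 * n))]
  have hB₃ : 16 ≤ (n + 2) ^ 4 := by
    calc 16 = 2 ^ 4 := by norm_num
      _ ≤ _ := Nat.pow_le_pow_left h2 4
  -- Contents stay below `(n + 2) ^ 4`, and expressions of cost at most 64 need exponent 256. The
  -- word bound uses `40000` only because a single constant serves for word size and running time.
  let P : Par n m (Δ + 1) l :=
    { N := L.net, U := U, F₀ := {i | χ (L.edge i) = none}, T := 2 * m / l + 1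
      B := (n + 2) ^ 4, W := (n + 2) ^ 40000
      room := ⟨hB₃, by rw [← pow_mul]; exact Nat.pow_lt_pow_right h2 (show 4 * 64 < 40000 by norm_num)⟩
      hn := hB₁, hm := by omega, hK := by omega, hl := by omega, hT := by omega
      deg := fun v => Nat.lt_succ_of_le ((L.ncard_inc_le v).trans (hΔ ▸ G.degree_le_maxDegree v))
      inj := hU, mem := hmem }
  have hcells : ∀ {k : ℕ} (a : Fin k → ℕ) (h : ∀ i, a i ≤ (n + 2) ^ 4) (i : ℕ),
      cells a i ≤ (n + 2) ^ 4 := by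
    intro k a h i
    unfold cells
    split_ifs
    · exact h _
    · exact Nat.zero_le _
  have hcell : ∀ {k : ℕ} (a : Fin k → ℕ) (i : Fin k), cells a i = a i := fun a i => by
    simp [cells]
  have hin : Input P (L.labels χ) (inputState L χ U) := by
    refine ⟨⟨fun x => ?_, fun a i => ?_⟩, rfl, rfl, rfl, rfl, rfl, hcell fun i => (L.src i : ℕ),
      hcell fun i => (L.tgt i : ℕ), hcell fun i => labelCode (χ (L.edge i)),
      hcell fun j => (U j : ℕ), fun a ha i => ?_⟩
    · change (inputState L χ U).reg x ≤ (n + 2) ^ 4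
      unfold inputState
      dsimp only
      split <;> omega
    · change (inputState L χ U).arr a i ≤ (n + 2) ^ 4
      unfold inputState
      dsimp only
      split
      · exact hcells _ (fun i => (L.src i).2.le.trans hB₁) i
      · exact hcells _ (fun i => (L.tgt i).2.le.trans hB₁) i
      · refine hcells _ (fun i => ?_) i
        rcases χ (L.edge i) with _ | c
        · simp [labelCode]
        · have := c.2
          simp only [labelCode]
          omega
      · exact hcells _ (fun i => (U i).2.le.trans (by omega)) i
      · exact Nat.zero_le _
    · unfold inputState
      dsimp only
      split <;> first | omega | rfl
  obtain ⟨t, s, ht, hexec, -, S, g, hbase, hcol, hout⟩ :=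
    run_algorithm (P := P) (EdgeList.proper_labels hχ) (fun i => Iff.rfl) rfl hin
  have hunc : (uncolored (L.labeling g.col)).ncard + S = (uncolored χ).ncard := by
    rw [EdgeList.ncard_uncolored (L := L), EdgeList.ncard_uncolored (L := L)]
    simp only [EdgeList.labeling_edge]
    exact hbase.unc
  refine ⟨t, s, L.labeling g.col, hexec, ht.trans (time_le hlm hΔm),
    Core.isPartialColoring (L := L) hbase.core, fun i => ?_, ?_⟩
  · rw [hcol, EdgeList.labeling_edge]
  · rcases hout with ⟨h0, hS⟩ | ⟨h0, hS, r, J, f, hL, hf⟩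
    · have hS' : (1 / 16 * l : ℝ) ≤ S := by
        have : (l : ℝ) ≤ 16 * S := by exact_mod_cast hS
        linarith
      refine Or.inl ⟨h0, ?_, ?_⟩
      · refine hS'.trans ?_
        have := Base.le_ncard_colored (P := P) hbase
        simp only [uncolored, Set.mem_ofPred_eq, EdgeList.labeling_edge]
        exact_mod_cast this
      · have : ((uncolored (L.labeling g.col)).ncard : ℝ) + S = (uncolored χ).ncard := by
          exact_mod_cast hunc
        linarith
    · refine Or.inr ⟨h0, by omega, r, f, ?_, Base.isSeparable (L := L) hbase hL, hf⟩
      have h1 := hbase.many_valid rfl hS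
      rw [← hL.card] at h1
      have : (l : ℝ) ≤ 16 * r := by exact_mod_cast h1
      linarith

end EdgeColoring

theorem lemma6p2 :
    ∃ (P : WordRAM.Prog) (C : ℕ) (c : ℝ), 0 < c ∧
      ∀ (n m Δ l : ℕ) (G : SimpleGraph (Fin n)) [DecidableRel G.Adj] (_ : G.maxDegree = Δ)
        (L : EdgeColoring.EdgeList G m) (χ : EdgeColoring.PartialLabeling G (Δ + 1))
        (_ : EdgeColoring.IsPartialColoring χ) (U : Fin l → Fin m)
        (_ : Function.Injective U) (_ : ∀ j, L.edge (U j) ∈ EdgeColoring.uncolored χ),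
        ∃ (t : ℕ) (s : WordRAM.State) (χ' : EdgeColoring.PartialLabeling G (Δ + 1)),
          WordRAM.Exec ((n + 2) ^ C) P (EdgeColoring.inputState L χ U) t s ∧
          t ≤ C * (m + Δ * l + 1) ∧
          EdgeColoring.IsPartialColoring χ' ∧
          EdgeColoring.HoldsLabeling s L χ' ∧
          ((s.reg 0 = 1 ∧ EdgeColoring.Extends L χ U χ' (c * l)) ∨
            (s.reg 0 = 2 ∧
              (EdgeColoring.uncolored χ').ncard ≤ (EdgeColoring.uncolored χ).ncard ∧
              ∃ (r : ℕ) (F : Fin r → EdgeColoring.FanTuple (Fin n) (Δ + 1)),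
                c * l ≤ r ∧ EdgeColoring.IsSeparable χ' F ∧ EdgeColoring.HoldsFans s F)) :=
  ⟨EdgeColoring.algorithm, 40000, 1 / 16, by norm_num,
    fun _ _ _ _ _ _ hΔ L χ hχ U hU hmem => EdgeColoring.algorithm_correct hΔ L χ hχ U hU hmem⟩
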